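/- Let $\alpha,\beta,L,T>0$, $\Omega=(0,L)^2$. All Sobolev spaces in space, $H^r=H^r(\Omega)$, are the $L$-periodic ones, and $W^{m,p}(0,T;H^r)$, $H^m(0,T;H^r)=W^{m,2}(0,T;H^r)$ are the usual Bochner--Sobolev spaces (with norm $\sum_{j\le m}\|\partial_t^j u\|_{L^p(0,T;H^r)}$). For $\Phi:[0,T]\to L^2(\Omega)$ continuous, with Fourier coefficients $\widehat\Phi_{k,l}(t)=\frac1{L^2}\int_\Omega\Phi(x,y,t)e^{-\frac{2\pi i}{L}(kx+ly)}\,dx\,dy$, for even $N\ge 2$ and $s>0$ put $h=L/N$ and $$\Phi_N(x,y,t)=\sum_{k,l=-N/2+1}^{N/2}\widehat\Phi_{k,l}(t)\,e^{\frac{2\pi i}{L}(kx+ly)},\qquad \Psi_N=\partial_t\Phi_N-\frac{s^2}{12}\,\partial_t^3\Phi_N$$ (derivatives are one-sided at $t=0,T$; $\Phi_N$ is complex-valued in general). Write $G^k(x,y)=G(x,y,sk)$, let $\Delta_h$ be the five-point discrete Laplacian of mesh size $h$, $\chi(\phi,\psi)=\frac{\phi^2+\psi^2}{2}\cdot\frac{\phi+\psi}{2}$,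 $K=\lfloor T/s\rfloor$, and put $\Phi_N^{-1}:=\Phi_N^0$. For an offset $o=(x_0,y_0)\in\mathbb R^2$ let $\|g\|_{2,o}=\bigl(h^2\sum_{i,j=0}^{N-1}|g(x_0+ih,y_0+jh)|^2\bigr)^{1/2}$ (vertex-centered grid for $o=(0,0)$, cell-centered grid for $o=(h/2,h/2)$). **Theorem.** There is a constant $C>0$ depending only on $\alpha,\beta,L,T$ such that the following holds. Let $\Phi$, identified with its representative in $C([0,T];L^2(\Omega))$, be an $L$-periodic solution on $(0,T)$ of $$\beta\,\partial_{tt}\Phi+\partial_t\Phi=\Delta\bigl(\Phi^3+\alpha\Phi+2\Delta\Phi+\Delta^2\Phi\bigr)$$ with $$\Phi\in H^4(0,T;L^2)\cap L^\infty(0,T;H^8)\cap W^{2,\infty}(0,T;H^2)\cap H^2(0,T;H^6).$$ Then there is $M\ge 0$ with $$M\le C\Bigl(\|\Phi\|_{H^4(0,T;L^2)}+\|\Phi\|_{W^{2,\infty}(0,T;H^2)}+\|\Phi\|_{H^2(0,T;H^6)}+\|\Phi\|_{L^\infty(0,T;H^4)}^3\bigl(1+\|\Phi\|_{H^2(0,T;H^2)}^2\bigr)+\|\Phi\|_{L^\infty(0,T;H^8)}\Bigr)$$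 such that for all even $N\ge2$ and all $s>0$ (with $h=L/N$) there are functions $\tau_1^k,\tau_2^k:\mathbb R^2\to\mathbb C$ satisfying, on all of $\mathbb R^2$ and for all $0\le k\le K-1$, $$\beta\,\frac{\Psi_N^{k+1}-\Psi_N^k}{s}=\Delta_h\Bigl(\chi(\Phi_N^{k+1},\Phi_N^k)+\frac\alpha2(\Phi_N^{k+1}+\Phi_N^k)+\Delta_h(3\Phi_N^k-\Phi_N^{k-1})\Bigr)+\frac12\Delta_h^3(\Phi_N^{k+1}+\Phi_N^k)-\frac{\Phi_N^{k+1}-\Phi_N^k}{s}+\tau_1^k,$$ $$\frac{\Phi_N^{k+1}-\Phi_N^k}{s}=\frac12(\Psi_N^{k+1}+\Psi_N^k)+s\,\tau_2^k,$$ and, for every offset $o\in\mathbb R^2$, $$\Bigl(s\sum_{k=1}^{K-1}\|\tau_1^k\|_{2,o}^2\Bigr)^{1/2}\le M(s^2+h^2),\qquad \Bigl(s\sum_{k=0}^{K-1}\|\tau_2^k\|_{2,o}^2\Bigr)^{1/2}\le M(s^2+h^2).$$ If moreover $\partial_t\Phi(\cdot,\cdot,0)=0$, the first sum may also be started at $k=0$.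 -/

import Mathlib

open MeasureTheory Set
open scoped ENNReal ContDiff

noncomputable section

namespace MPFC

/-! ### Space: periodic Sobolev norms on the square -/

/-- The open square `Ω = (0, L)²`, one period cell. -/
def square (L : ℝ) : Set (ℝ × ℝ) := Ioo 0 L ×ˢ Ioo 0 L

/-- Real `L²(Ω)`. -/
abbrev L2 (L : ℝ) : Type := Lp ℝ 2 (volume.restrict (square L))

/-- The partial derivative `∂ₓᵃ ∂_yᵇ φ` of a smooth function of two real variables. -/
def partialDeriv (a b : ℕ) (φ : ℝ × ℝ → ℝ) (p : ℝ × ℝ) : ℝ :=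
  iteratedDeriv a (fun x => iteratedDeriv b (fun y => φ (x, y)) p.2) p.1

/-- Smooth functions on the plane that are `L`-periodic in each variable. -/
def IsPeriodicTest (L : ℝ) (φ : ℝ × ℝ → ℝ) : Prop :=
  ContDiff ℝ ∞ φ ∧ ∀ x y : ℝ, φ (x + L, y) = φ (x, y) ∧ φ (x, y + L) = φ (x, y)

/-- `g = ∂ₓᵃ ∂_yᵇ f` weakly, in the sense of periodic distributions. -/
def HasWeakPartial (L : ℝ) (a b : ℕ) (f g : L2 L) : Prop :=
  ∀ φ : ℝ × ℝ → ℝ, IsPeriodicTest L φ →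
    ∫ p in square L, f p * partialDeriv a b φ p
      = (-1) ^ (a + b) * ∫ p in square L, g p * φ p

/-- `g = Δ f` weakly, in the sense of periodic distributions. -/
def HasWeakLaplacian (L : ℝ) (f g : ℝ × ℝ → ℝ) : Prop :=
  IntegrableOn f (square L) ∧ IntegrableOn g (square L) ∧
  ∀ φ : ℝ × ℝ → ℝ, IsPeriodicTest L φ →
    ∫ p in square L, f p * (partialDeriv 2 0 φ p + partialDeriv 0 2 φ p)
      = ∫ p in square L, g p * φ p

/-- The norm of the periodic Sobolev space `Hʳ(Ω)`,
`‖f‖_{Hʳ} = (∑_{a + b ≤ r} ‖∂ₓᵃ ∂_yᵇ f‖²_{L²})^{1/2}`, with value `∞` exactly when `f` is not in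
`Hʳ(Ω)`. (Weak derivatives are unique, so each infimum is over at most one element; an infimum
over the empty set is `∞`.) -/
def sobolevNorm (L : ℝ) (r : ℕ) (f : L2 L) : ℝ≥0∞ :=
  (∑ a ∈ Finset.range (r + 1), ∑ b ∈ Finset.range (r + 1 - a),
    (⨅ g : L2 L, ⨅ _ : HasWeakPartial L a b f g, ‖g‖ₑ) ^ 2) ^ (1 / 2 : ℝ)

/-! ### Time: Bochner–Sobolev norms on `(0, T)` -/

/-- `v` is the `j`-th weak time derivative of `u` on `(0, T)`, as `L²(Ω)`-valued functions. -/
def HasWeakTimeDeriv (L T : ℝ) (j : ℕ) (u v : ℝ → L2 L) : Prop :=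
  IntegrableOn u (Ioo 0 T) ∧ IntegrableOn v (Ioo 0 T) ∧
  ∀ η : ℝ → ℝ, ContDiff ℝ ∞ η → HasCompactSupport η → tsupport η ⊆ Ioo 0 T →
    ∫ t in Ioo 0 T, iteratedDeriv j η t • u t
      = (-1 : ℝ) ^ j • ∫ t in Ioo 0 T, η t • v t

/-- The norm of `Lᵖ(0, T; Hʳ(Ω))`. -/
def bochnerNorm (L T : ℝ) (p : ℝ≥0∞) (r : ℕ) (u : ℝ → L2 L) : ℝ≥0∞ :=
  eLpNorm (fun t => sobolevNorm L r (u t)) p (volume.restrict (Ioo 0 T))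

/-- The norm `∑_{j ≤ m} ‖∂ₜʲ u‖_{Lᵖ(0, T; Hʳ)}` of `W^{m,p}(0, T; Hʳ(Ω))`, with value `∞` exactly
when `u` is not in that space. -/
def bochnerSobolevNorm (L T : ℝ) (m : ℕ) (p : ℝ≥0∞) (r : ℕ) (u : ℝ → L2 L) : ℝ≥0∞ :=
  ∑ j ∈ Finset.range (m + 1),
    ⨅ v : ℝ → L2 L, ⨅ _ : HasWeakTimeDeriv L T j u v, bochnerNorm L T p r v

/-! ### The modified phase field crystal equation -/

/-- `Φ` is a periodic solution on `(0, T)` of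
`β ∂ₜₜΦ + ∂ₜΦ = Δ(Φ³ + αΦ + 2ΔΦ + Δ²Φ)`, the equation being an identity in `L²(Ω)` for almost
every time, with all derivatives taken weakly. -/
def IsSolution (α β L T : ℝ) (Φ : ℝ → L2 L) : Prop :=
  ∃ Φt Φtt : ℝ → L2 L, HasWeakTimeDeriv L T 1 Φ Φt ∧ HasWeakTimeDeriv L T 2 Φ Φtt ∧
    ∀ᵐ t ∂(volume.restrict (Ioo 0 T)), ∃ lap bilap : L2 L,
      HasWeakLaplacian L (Φ t) lap ∧ HasWeakLaplacian L lap bilap ∧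
      HasWeakLaplacian L (fun p => Φ t p ^ 3 + α * Φ t p + 2 * lap p + bilap p)
        (fun p => β * Φtt t p + Φt t p)

/-- The regularity
`H⁴(0,T;L²) ∩ L^∞(0,T;H⁸) ∩ W^{2,∞}(0,T;H²) ∩ H²(0,T;H⁶)`. -/
def IsRegular (L T : ℝ) (Φ : ℝ → L2 L) : Prop :=
  bochnerSobolevNorm L T 4 2 0 Φ < ⊤ ∧ bochnerSobolevNorm L T 0 ⊤ 8 Φ < ⊤ ∧
  bochnerSobolevNorm L T 2 ⊤ 2 Φ < ⊤ ∧ bochnerSobolevNorm L T 2 2 6 Φ < ⊤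

/-! ### The Fourier projection -/

/-- The character `exp((2πi/L)(k x + l y))`. -/
def char (L : ℝ) (k l : ℤ) (p : ℝ × ℝ) : ℂ :=
  Complex.exp (2 * Real.pi * Complex.I / L * (k * p.1 + l * p.2))

/-- The Fourier coefficient `|Ω|⁻¹ ∫_Ω f(x,y) exp(-(2πi/L)(k x + l y)) dx dy`. -/
def fourierCoeff (L : ℝ) (f : L2 L) (k l : ℤ) : ℂ :=
  (1 / (L : ℂ) ^ 2) * ∫ p in square L, (f p : ℂ) * char L (-k) (-l) p

/-- `Φ_N(t, p)`: the Fourier projection onto the modes `-N/2 + 1 ≤ k, l ≤ N/2`. (The set of modes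
is not symmetric, so the values are complex numbers.) -/
def proj (L : ℝ) (N : ℕ) (Φ : ℝ → L2 L) (t : ℝ) (p : ℝ × ℝ) : ℂ :=
  ∑ k ∈ Finset.Icc (-((N : ℤ) / 2) + 1) ((N : ℤ) / 2),
    ∑ l ∈ Finset.Icc (-((N : ℤ) / 2) + 1) ((N : ℤ) / 2), fourierCoeff L (Φ t) k l * char L k l p

/-- `Ψ_N = ∂ₜ Φ_N - (s²/12) ∂ₜ³ Φ_N` on `[0, T]`, with one-sided derivatives at the end points. -/
def projVel (L T s : ℝ) (N : ℕ) (Φ : ℝ → L2 L) (t : ℝ) (p : ℝ × ℝ) : ℂ :=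
  iteratedDerivWithin 1 (fun r => proj L N Φ r p) (Icc 0 T) t
    - (s : ℂ) ^ 2 / 12 * iteratedDerivWithin 3 (fun r => proj L N Φ r p) (Icc 0 T) t

/-! ### The difference scheme -/

/-- The five-point discrete Laplacian with mesh size `h`. -/
def discreteLaplacian (h : ℝ) (f : ℝ × ℝ → ℂ) (p : ℝ × ℝ) : ℂ :=
  (f (p.1 + h, p.2) + f (p.1 - h, p.2) + f (p.1, p.2 + h) + f (p.1, p.2 - h) - 4 * f p)
    / (h : ℂ) ^ 2

/-- `χ(φ, ψ) = ((φ² + ψ²)/2) ((φ + ψ)/2)`. -/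
def chi (φ ψ : ℝ × ℝ → ℂ) (p : ℝ × ℝ) : ℂ :=
  (φ p ^ 2 + ψ p ^ 2) / 2 * ((φ p + ψ p) / 2)

/-- First equation of the scheme with residual `τ`, for consecutive time levels
`φm = φᵏ⁻¹`, `φ = φᵏ`, `φp = φᵏ⁺¹` and `ψ = ψᵏ`, `ψp = ψᵏ⁺¹`. -/
def SchemeEq1 (α β s h : ℝ) (φm φ φp ψ ψp τ : ℝ × ℝ → ℂ) : Prop :=
  ∀ p : ℝ × ℝ,
    (β : ℂ) * ((ψp p - ψ p) / s)
      = discreteLaplacian h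
          (chi φp φ + ((α : ℂ) / 2) • (φp + φ) + discreteLaplacian h ((3 : ℂ) • φ - φm)) p
        + 1 / 2 * discreteLaplacian h (discreteLaplacian h (discreteLaplacian h (φp + φ))) p
        - (φp p - φ p) / s + τ p

/-- Second equation of the scheme with residual `s τ`. -/
def SchemeEq2 (s : ℝ) (φ φp ψ ψp τ : ℝ × ℝ → ℂ) : Prop :=
  ∀ p : ℝ × ℝ, (φp p - φ p) / s = 1 / 2 * (ψp p + ψ p) + s * τ p

/-- The discrete norm `‖g‖₂ = (h² ∑_{i,j=0}^{N-1} |g(x₀ + i h, y₀ + j h)|²)^{1/2}`. The offset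
`(0, 0)` gives the vertex-centered grid, `(h/2, h/2)` the cell-centered one. -/
def gridNorm (h : ℝ) (N : ℕ) (o : ℝ × ℝ) (g : ℝ × ℝ → ℂ) : ℝ :=
  Real.sqrt (h ^ 2 * ∑ i ∈ Finset.range N, ∑ j ∈ Finset.range N,
    ‖g (o.1 + i * h, o.2 + j * h)‖ ^ 2)

/-- The discrete space-time norm `(s ∑_{k ∈ K} ‖τᵏ‖₂²)^{1/2}` over a set `K` of time steps. -/
def spaceTimeNorm (s h : ℝ) (N : ℕ) (o : ℝ × ℝ) (K : Finset ℕ) (τ : ℕ → ℝ × ℝ → ℂ) : ℝ :=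
  Real.sqrt (s * ∑ k ∈ K, gridNorm h N o (τ k) ^ 2)

end MPFC

end

noncomputable section

namespace MPFC

/-! ### Weak derivatives on an interval -/

/-- Test functions on `(0, T)`. -/
def IsTest (T : ℝ) (η : ℝ → ℝ) : Prop :=
  ContDiff ℝ ∞ η ∧ HasCompactSupport η ∧ tsupport η ⊆ Ioo 0 T

lemma IsTest.deriv {T : ℝ} {η : ℝ → ℝ} (h : IsTest T η) : IsTest T (deriv η) :=
  ⟨(contDiff_infty_iff_deriv.1 h.1).2, h.2.1.deriv,
    (tsupport_deriv_subset).trans h.2.2⟩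

lemma IsTest.exists_Icc {T : ℝ} (hT : 0 < T) {η : ℝ → ℝ} (h : IsTest T η) :
    ∃ a b, 0 < a ∧ b < T ∧ ∀ x, x ∉ Icc a b → η x = 0 := by
  have hK : IsCompact (tsupport η ∪ {T / 2}) := h.2.1.isCompact.union isCompact_singleton
  have hne : (tsupport η ∪ {T / 2}).Nonempty := ⟨T / 2, by simp⟩
  have hsub : tsupport η ∪ {T / 2} ⊆ Ioo 0 T :=
    union_subset h.2.2 (singleton_subset_iff.2 ⟨by linarith, by linarith⟩)
  refine ⟨sInf (tsupport η ∪ {T / 2}), sSup (tsupport η ∪ {T / 2}),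
    (hsub (hK.sInf_mem hne)).1, (hsub (hK.sSup_mem hne)).2, fun x hx => ?_⟩
  by_contra hne0
  have hx' : x ∈ tsupport η ∪ {T / 2} := Or.inl (subset_tsupport _ hne0)
  exact hx ⟨csInf_le hK.bddBelow hx', le_csSup hK.bddAbove hx'⟩

lemma IsTest.integrableOn_smul {E : Type*} [NormedAddCommGroup E] [NormedSpace ℝ E] {T : ℝ}
    {η : ℝ → ℝ} (h : IsTest T η) {u : ℝ → E} (hu : IntegrableOn u (Ioo 0 T)) :
    IntegrableOn (fun t => η t • u t) (Ioo 0 T) := by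
  obtain ⟨C, hC⟩ := h.2.1.exists_bound_of_continuous h.1.continuous
  exact Integrable.bdd_smul hu C h.1.continuous.aestronglyMeasurable (Filter.Eventually.of_forall hC)

lemma IsTest.exists_primitive {T : ℝ} (hT : 0 < T) {η : ℝ → ℝ} (h : IsTest T η)
    (h0 : ∫ t in Ioo 0 T, η t = 0) : ∃ θ : ℝ → ℝ, IsTest T θ ∧ _root_.deriv θ = η := by
  obtain ⟨a, b, ha, hb, hab⟩ := h.exists_Icc hT
  have hcont := h.1.continuous
  set θ : ℝ → ℝ := fun x => ∫ t in (0 : ℝ)..x, η t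
  have hd : ∀ x, HasDerivAt θ (η x) x := fun x =>
    intervalIntegral.integral_hasDerivAt_right (hcont.intervalIntegrable _ _)
      (hcont.stronglyMeasurableAtFilter _ _) hcont.continuousAt
  have hder : _root_.deriv θ = η := funext fun x => (hd x).deriv
  have hsm : ContDiff ℝ ∞ θ :=
    contDiff_infty_iff_deriv.2 ⟨fun x => (hd x).differentiableAt, hder ▸ h.1⟩
  have hT0 : ∫ t in (0 : ℝ)..T, η t = 0 := by
    rw [intervalIntegral.integral_of_le hT.le, integral_Ioc_eq_integral_Ioo, h0]
  have hz : ∀ x, x ∉ Icc a b → θ x = 0 := by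
    intro x hx
    rcases lt_or_ge x a with hxa | hxa
    · refine (intervalIntegral.integral_congr (g := fun _ => 0) fun t ht => hab t fun h' => ?_).trans
        (by simp)
      rcases Set.mem_uIcc.1 ht with h2 | h2 <;> linarith [h'.1, h2.1, h2.2]
    · have hxb : b < x := by
        by_contra hcon
        exact hx ⟨hxa, not_lt.1 hcon⟩
      have h1 : ∫ t in x..T, η t = 0 := by
        refine (intervalIntegral.integral_congr (g := fun _ => 0)
          fun t ht => hab t fun h' => ?_).trans (by simp)
        rcases Set.mem_uIcc.1 ht with h2 | h2 <;> linarith [h'.2, h2.1, h2.2]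
      have := intervalIntegral.integral_add_adjacent_intervals
        (hcont.intervalIntegrable 0 x (μ := volume)) (hcont.intervalIntegrable x T (μ := volume))
      rw [hT0, h1, add_zero] at this
      exact this
  have hsupp : tsupport θ ⊆ Icc a b := by
    refine closure_minimal (fun x hx => ?_) isClosed_Icc
    by_contra hcon
    exact hx (hz x hcon)
  exact ⟨θ, ⟨hsm, isCompact_Icc.of_isClosed_subset (isClosed_tsupport _) hsupp,
    hsupp.trans fun x hx => ⟨ha.trans_le hx.1, hx.2.trans_lt hb⟩⟩, hder⟩

lemma exists_isTest_integral_eq_one {T : ℝ} (hT : 0 < T) :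
    ∃ η, IsTest T η ∧ ∫ t in Ioo 0 T, η t = 1 := by
  let f : ContDiffBump (T / 2) := ⟨T / 8, T / 4, by positivity, by linarith⟩
  have hsub : tsupport (f.normed volume) ⊆ Ioo 0 T := by
    rw [f.tsupport_normed_eq, Real.closedBall_eq_Icc]
    intro x hx
    have h1 : f.rOut = T / 4 := rfl
    rw [h1] at hx
    constructor <;> linarith [hx.1, hx.2]
  refine ⟨f.normed volume, ⟨f.contDiff_normed, f.hasCompactSupport_normed, hsub⟩, ?_⟩
  rw [setIntegral_eq_integral_of_forall_compl_eq_zero, f.integral_normed]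
  intro x hx
  by_contra hcon
  exact hx (hsub (subset_tsupport _ hcon))

section Weak

variable {E : Type*} [NormedAddCommGroup E] [NormedSpace ℝ E]

lemma ae_eq_zero_of_test [CompleteSpace E] {T : ℝ} {u : ℝ → E} (hu : IntegrableOn u (Ioo 0 T))
    (h : ∀ η, IsTest T η → ∫ t in Ioo 0 T, η t • u t = 0) :
    ∀ᵐ t ∂volume.restrict (Ioo 0 T), u t = 0 := by
  rw [ae_restrict_iff' measurableSet_Ioo]
  refine isOpen_Ioo.ae_eq_zero_of_integral_contDiff_smul_eq_zero hu.locallyIntegrableOn ?_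
  intro g hg hc hs
  rw [← h g ⟨hg, hc, hs⟩, setIntegral_eq_integral_of_forall_compl_eq_zero]
  intro x hx
  have : g x = 0 := by
    by_contra hcon
    exact hx (hs (subset_tsupport _ hcon))
  simp [this]

lemma exists_ae_eq_const_of_test [CompleteSpace E] {T : ℝ} (hT : 0 < T) {u : ℝ → E}
    (hu : IntegrableOn u (Ioo 0 T))
    (h : ∀ η, IsTest T η → ∫ t in Ioo 0 T, deriv η t • u t = 0) :
    ∃ c, ∀ᵐ t ∂volume.restrict (Ioo 0 T), u t = c := by
  obtain ⟨η₀, h₀, h₁⟩ := exists_isTest_integral_eq_one hT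
  refine ⟨∫ t in Ioo 0 T, η₀ t • u t, ?_⟩
  have hcI : IntegrableOn (fun _ : ℝ => ∫ t in Ioo 0 T, η₀ t • u t) (Ioo 0 T) :=
    integrableOn_const (by simp)
  have key := ae_eq_zero_of_test (u := fun t => u t - ∫ t in Ioo 0 T, η₀ t • u t)
    (hu.sub hcI) ?_
  · filter_upwards [key] with t ht using sub_eq_zero.1 ht
  intro η hη
  have hηI : IntegrableOn η (Ioo 0 T) :=
    (hη.1.continuous.integrable_of_hasCompactSupport hη.2.1).integrableOn
  have hη₀I : IntegrableOn η₀ (Ioo 0 T) :=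
    (h₀.1.continuous.integrable_of_hasCompactSupport h₀.2.1).integrableOn
  have hθ : IsTest T (fun t => η t - (∫ t in Ioo 0 T, η t) * η₀ t) := by
    refine ⟨hη.1.sub (contDiff_const.mul h₀.1), hη.2.1.sub h₀.2.1.mul_left, ?_⟩
    refine (tsupport_sub _ _).trans (union_subset hη.2.2 ?_)
    exact (closure_mono (Function.support_mul_subset_right _ _)).trans h₀.2.2
  obtain ⟨θ, hθt, hθd⟩ := hθ.exists_primitive hT (by
    rw [integral_sub hηI (hη₀I.const_mul _), integral_const_mul, h₁]; simp)
  have h2 := h θ hθt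
  rw [hθd] at h2
  have e1 : ∫ t in Ioo 0 T, (η t - (∫ t in Ioo 0 T, η t) * η₀ t) • u t
      = ∫ t in Ioo 0 T, (η t • u t - (∫ t in Ioo 0 T, η t) • η₀ t • u t) := by
    congr 1; ext t; rw [sub_smul, mul_smul]
  have h3 : IntegrableOn (fun t => (∫ t in Ioo 0 T, η t) • η₀ t • u t) (Ioo 0 T) :=
    (h₀.integrableOn_smul hu).smul _
  rw [e1, integral_sub (hη.integrableOn_smul hu) h3, integral_smul] at h2
  have e2 : ∫ t in Ioo 0 T, η t • (u t - ∫ t in Ioo 0 T, η₀ t • u t)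
      = ∫ t in Ioo 0 T, (η t • u t - η t • ∫ t in Ioo 0 T, η₀ t • u t) := by
    congr 1; ext t; rw [smul_sub]
  rw [e2, integral_sub (hη.integrableOn_smul hu) (hηI.smul_const _), integral_smul_const, h2]

/-- `u` is a primitive of the integrable function `v` on `[0, T]`. -/
def IsPrimitive (T : ℝ) (u v : ℝ → E) : Prop :=
  IntegrableOn v (Ioo 0 T) ∧ ∀ t ∈ Icc 0 T, u t = u 0 + ∫ x in (0 : ℝ)..t, v x

lemma intervalIntegrable_of_mem {F : Type*} [NormedAddCommGroup F] {T : ℝ} {v : ℝ → F}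
    (hv : IntegrableOn v (Ioo 0 T)) {a b : ℝ} (ha : a ∈ Icc 0 T) (hb : b ∈ Icc 0 T) :
    IntervalIntegrable v volume a b := by
  rw [intervalIntegrable_iff]
  refine ((integrableOn_Icc_iff_integrableOn_Ioo (by simp) (by simp)).2 hv).mono_set ?_
  exact uIoc_subset_uIcc.trans (uIcc_subset_Icc ha hb)

lemma IsPrimitive.sub_eq {T : ℝ} {u v : ℝ → E} (h : IsPrimitive T u v) {a b : ℝ}
    (ha : a ∈ Icc 0 T) (hb : b ∈ Icc 0 T) : u b - u a = ∫ x in a..b, v x := by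
  have h0 : (0 : ℝ) ∈ Icc 0 T := ⟨le_rfl, ha.1.trans ha.2⟩
  rw [h.2 a ha, h.2 b hb, add_sub_add_left_eq_sub,
    intervalIntegral.integral_interval_sub_left (intervalIntegrable_of_mem h.1 h0 hb)
      (intervalIntegrable_of_mem h.1 h0 ha)]

lemma IsPrimitive.continuousOn {T : ℝ} (hT : 0 < T) {u v : ℝ → E} (h : IsPrimitive T u v) :
    ContinuousOn u (Icc 0 T) := by
  have h1 := intervalIntegral.continuousOn_primitive_interval (μ := volume) (f := v) (a := 0) (b := T)
    (by rw [uIcc_of_le hT.le]; exact (integrableOn_Icc_iff_integrableOn_Ioo (by simp) (by simp)).2 h.1)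
  rw [uIcc_of_le hT.le] at h1
  exact (continuousOn_const.add h1).congr h.2

lemma IsPrimitive.hasDerivWithinAt [CompleteSpace E] {T : ℝ} {u v : ℝ → E} (h : IsPrimitive T u v)
    (hv : ContinuousOn v (Icc 0 T)) {t : ℝ} (ht : t ∈ Icc 0 T) :
    HasDerivWithinAt u (v t) (Icc 0 T) t := by
  have h0 : (0 : ℝ) ∈ Icc 0 T := ⟨le_rfl, ht.1.trans ht.2⟩
  have : Fact (t ∈ Icc 0 T) := ⟨ht⟩
  have h1 : HasDerivWithinAt (fun s => ∫ x in (0 : ℝ)..s, v x) (v t) (Icc 0 T) t :=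
    intervalIntegral.integral_hasDerivWithinAt_right (intervalIntegrable_of_mem h.1 h0 ht)
      (hv.stronglyMeasurableAtFilter_nhdsWithin measurableSet_Icc t) (hv t ht)
  exact (h1.const_add (u 0)).congr h.2 (h.2 t ht)

lemma integral_deriv_smul_primitive [CompleteSpace E] {T : ℝ} {v : ℝ → E}
    (hv : IntegrableOn v (Ioo 0 T)) {η : ℝ → ℝ} (hη : IsTest T η) :
    ∫ t in Ioo 0 T, deriv η t • (∫ x in (0 : ℝ)..t, v x) = -∫ t in Ioo 0 T, η t • v t := by
  have hI : IntegrableOn (deriv η) (Ioo 0 T) :=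
    (hη.deriv.1.continuous.integrable_of_hasCompactSupport hη.deriv.2.1).integrableOn
  have hm : MeasurableSet {p : ℝ × ℝ | p.2 < p.1} := measurableSet_lt measurable_snd measurable_fst
  have hprod : Integrable ({p : ℝ × ℝ | p.2 < p.1}.indicator fun p => deriv η p.1 • v p.2)
      ((volume.restrict (Ioo 0 T)).prod (volume.restrict (Ioo 0 T))) :=
    (Integrable.smul_prod hI hv).indicator hm
  have hswap := integral_integral_swap (f := fun t x =>
    {p : ℝ × ℝ | p.2 < p.1}.indicator (fun p => deriv η p.1 • v p.2) (t, x)) hprod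
  have h1 : ∀ t ∈ Ioo 0 T, ∫ x in Ioo 0 T,
      {p : ℝ × ℝ | p.2 < p.1}.indicator (fun p => deriv η p.1 • v p.2) (t, x)
      = deriv η t • ∫ x in (0 : ℝ)..t, v x := by
    intro t ht
    have : (fun x => {p : ℝ × ℝ | p.2 < p.1}.indicator (fun p => deriv η p.1 • v p.2) (t, x))
        = (Iio t).indicator (fun x => deriv η t • v x) := by
      ext x; simp [indicator]
    rw [this, setIntegral_indicator measurableSet_Iio, integral_smul,
      intervalIntegral.integral_of_le ht.1.le, integral_Ioc_eq_integral_Ioo]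
    congr 3
    ext x; constructor
    · exact fun h => ⟨h.1.1, h.2⟩
    · exact fun h => ⟨⟨h.1, h.2.trans ht.2⟩, h.2⟩
  have h2 : ∀ x ∈ Ioo 0 T, ∫ t in Ioo 0 T,
      {p : ℝ × ℝ | p.2 < p.1}.indicator (fun p => deriv η p.1 • v p.2) (t, x)
      = -(η x • v x) := by
    intro x hx
    have : (fun t => {p : ℝ × ℝ | p.2 < p.1}.indicator (fun p => deriv η p.1 • v p.2) (t, x))
        = (Ioi x).indicator (fun t => deriv η t • v x) := by
      ext t; simp [indicator]
    have hset : Ioo 0 T ∩ Ioi x = Ioo x T := by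
      ext t; constructor
      · exact fun h => ⟨h.2, h.1.2⟩
      · exact fun h => ⟨⟨hx.1.trans h.1, h.2⟩, h.1⟩
    have hηT : η T = 0 := by
      by_contra hcon
      exact lt_irrefl _ (hη.2.2 (subset_tsupport _ hcon)).2
    rw [this, setIntegral_indicator measurableSet_Ioi, integral_smul_const, hset,
      ← integral_Ioc_eq_integral_Ioo, ← intervalIntegral.integral_of_le hx.2.le,
      intervalIntegral.integral_deriv_eq_sub (fun y _ => (hη.1.differentiable (by simp)) y)
        (hη.deriv.1.continuous.intervalIntegrable _ _), hηT, zero_sub, neg_smul]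
  rw [setIntegral_congr_fun measurableSet_Ioo h1, setIntegral_congr_fun measurableSet_Ioo h2,
    integral_neg] at hswap
  exact hswap

lemma exists_isPrimitive [CompleteSpace E] {T : ℝ} (hT : 0 < T) {u v : ℝ → E} (hu : IntegrableOn u (Ioo 0 T))
    (hv : IntegrableOn v (Ioo 0 T))
    (h : ∀ η, IsTest T η → ∫ t in Ioo 0 T, deriv η t • u t = -∫ t in Ioo 0 T, η t • v t) :
    ∃ w, IsPrimitive T w v ∧ ∀ᵐ t ∂volume.restrict (Ioo 0 T), u t = w t := by
  have hc : ContinuousOn (fun t => ∫ x in (0 : ℝ)..t, v x) (Icc 0 T) := by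
    have h1 := intervalIntegral.continuousOn_primitive_interval (μ := volume) (f := v)
      (a := 0) (b := T)
      (by rw [uIcc_of_le hT.le]; exact (integrableOn_Icc_iff_integrableOn_Ioo (by simp) (by simp)).2 hv)
    rwa [uIcc_of_le hT.le] at h1
  have hp : IntegrableOn (fun t => ∫ x in (0 : ℝ)..t, v x) (Ioo 0 T) :=
    hc.integrableOn_Icc.mono_set Ioo_subset_Icc_self
  obtain ⟨c, hc⟩ := exists_ae_eq_const_of_test hT
    (u := fun t => u t - ∫ x in (0 : ℝ)..t, v x) (hu.sub hp) (by
      intro η hη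
      simp_rw [smul_sub]
      rw [integral_sub (hη.deriv.integrableOn_smul hu) (hη.deriv.integrableOn_smul hp),
        h η hη, integral_deriv_smul_primitive hv hη, sub_self])
  refine ⟨fun t => c + ∫ x in (0 : ℝ)..t, v x, ⟨hv, fun t _ => by simp⟩, ?_⟩
  filter_upwards [hc] with t ht
  rw [← ht]; abel

/-- `v` is the `j`-th weak derivative of `u` on `(0, T)`. -/
def HasWeakDerivOn (T : ℝ) (j : ℕ) (u v : ℝ → E) : Prop :=
  IntegrableOn u (Ioo 0 T) ∧ IntegrableOn v (Ioo 0 T) ∧ ∀ η, IsTest T η →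
    ∫ t in Ioo 0 T, iteratedDeriv j η t • u t = (-1 : ℝ) ^ j • ∫ t in Ioo 0 T, η t • v t

lemma HasWeakDerivOn.of_succ {T : ℝ} {j : ℕ} {u v v' : ℝ → E} (h : HasWeakDerivOn T j u v)
    (h' : HasWeakDerivOn T (j + 1) u v') : HasWeakDerivOn T 1 v v' := by
  refine ⟨h.2.1, h'.2.1, fun η hη => ?_⟩
  have h1 := h.2.2 (deriv η) hη.deriv
  have h2 := h'.2.2 η hη
  rw [iteratedDeriv_succ', h1, pow_succ, mul_smul] at h2
  have := smul_right_injective E (pow_ne_zero j (by norm_num : (-1 : ℝ) ≠ 0)) h2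
  simpa [iteratedDeriv_one] using this

lemma HasWeakDerivOn.ae_unique [CompleteSpace E] {T : ℝ} {j : ℕ} {u v v' : ℝ → E}
    (h : HasWeakDerivOn T j u v) (h' : HasWeakDerivOn T j u v') :
    ∀ᵐ t ∂volume.restrict (Ioo 0 T), v t = v' t := by
  have := ae_eq_zero_of_test (u := fun t => v t - v' t) (h.2.1.sub h'.2.1) (by
    intro η hη
    simp_rw [smul_sub]
    rw [integral_sub (hη.integrableOn_smul h.2.1) (hη.integrableOn_smul h'.2.1), sub_eq_zero]
    exact smul_right_injective E (pow_ne_zero j (by norm_num : (-1 : ℝ) ≠ 0))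
      ((h.2.2 η hη).symm.trans (h'.2.2 η hη)))
  filter_upwards [this] with t ht using sub_eq_zero.1 ht

lemma HasWeakDerivOn.exists_isPrimitive [CompleteSpace E] {T : ℝ} (hT : 0 < T) {u v : ℝ → E}
    (h : HasWeakDerivOn T 1 u v) :
    ∃ w, IsPrimitive T w v ∧ ∀ᵐ t ∂volume.restrict (Ioo 0 T), u t = w t :=
  MPFC.exists_isPrimitive hT h.1 h.2.1 fun η hη => by
    simpa [iteratedDeriv_one] using h.2.2 η hη

lemma IsPrimitive.congr_right {T : ℝ} {u v v' : ℝ → E} (h : IsPrimitive T u v)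
    (hv : ∀ᵐ t ∂volume.restrict (Ioo 0 T), v t = v' t) : IsPrimitive T u v' := by
  refine ⟨h.1.congr hv, fun t ht => ?_⟩
  rw [h.2 t ht, intervalIntegral.integral_of_le ht.1, intervalIntegral.integral_of_le ht.1,
    integral_Ioc_eq_integral_Ioo, integral_Ioc_eq_integral_Ioo]
  congr 1
  exact integral_congr_ae (ae_restrict_of_ae_restrict_of_subset (Ioo_subset_Ioo_right ht.2) hv)

lemma IsPrimitive.congr_left {T : ℝ} (hT : 0 < T) {u u' v : ℝ → E} (h : IsPrimitive T u v)
    (hc : ContinuousOn u' (Icc 0 T)) (hu : ∀ᵐ t ∂volume.restrict (Ioo 0 T), u' t = u t) :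
    IsPrimitive T u' v := by
  have heq : EqOn u' u (Icc 0 T) := by
    refine Measure.eqOn_Icc_of_ae_eq volume hT.ne ?_ hc (h.continuousOn hT)
    rw [Filter.EventuallyEq, restrict_Ioo_eq_restrict_Icc.symm]
    exact hu
  refine ⟨h.1, fun t ht => ?_⟩
  rw [heq ht, heq ⟨le_rfl, hT.le⟩, h.2 t ht]

/-- A continuous function with integrable weak derivatives of orders one to four is three times
continuously differentiable, with absolutely continuous third derivative. -/
lemma exists_isPrimitive_chain [CompleteSpace E] {T : ℝ} (hT : 0 < T) {f g₁ g₂ g₃ g₄ : ℝ → E}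
    (hf : ContinuousOn f (Icc 0 T)) (h₁ : HasWeakDerivOn T 1 f g₁) (h₂ : HasWeakDerivOn T 2 f g₂)
    (h₃ : HasWeakDerivOn T 3 f g₃) (h₄ : HasWeakDerivOn T 4 f g₄) :
    ∃ f₁ f₂ f₃ : ℝ → E, IsPrimitive T f f₁ ∧ IsPrimitive T f₁ f₂ ∧ IsPrimitive T f₂ f₃ ∧
      IsPrimitive T f₃ g₄ ∧ (∀ᵐ t ∂volume.restrict (Ioo 0 T), g₁ t = f₁ t) ∧
      (∀ᵐ t ∂volume.restrict (Ioo 0 T), g₂ t = f₂ t) ∧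
      (∀ᵐ t ∂volume.restrict (Ioo 0 T), g₃ t = f₃ t) := by
  obtain ⟨f₀, p₀, e₀⟩ := h₁.exists_isPrimitive hT
  obtain ⟨f₁, p₁, e₁⟩ := (h₁.of_succ h₂).exists_isPrimitive hT
  obtain ⟨f₂, p₂, e₂⟩ := (h₂.of_succ h₃).exists_isPrimitive hT
  obtain ⟨f₃, p₃, e₃⟩ := (h₃.of_succ h₄).exists_isPrimitive hT
  exact ⟨f₁, f₂, f₃, (p₀.congr_left hT hf e₀).congr_right e₁, p₁.congr_right e₂,
    p₂.congr_right e₃, p₃, e₁, e₂, e₃⟩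

/-! ### Truncation errors in time -/

lemma sq_integral_norm_le {F : Type*} [NormedAddCommGroup F] {v : ℝ → F} {a b : ℝ} (hab : a ≤ b)
    (hv : IntervalIntegrable v volume a b)
    (hv2 : IntervalIntegrable (fun x => ‖v x‖ ^ 2) volume a b) :
    (∫ x in a..b, ‖v x‖) ^ 2 ≤ (b - a) * ∫ x in a..b, ‖v x‖ ^ 2 := by
  rcases hab.eq_or_lt with rfl | hlt
  · simp
  set m := ∫ x in a..b, ‖v x‖
  have h0 : 0 ≤ ∫ x in a..b, (‖v x‖ ^ 2 - 2 * (m / (b - a)) * ‖v x‖ + (m / (b - a)) ^ 2) :=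
    intervalIntegral.integral_nonneg hab fun x _ => by
      nlinarith [sq_nonneg (‖v x‖ - m / (b - a))]
  rw [intervalIntegral.integral_add (hv2.sub (hv.norm.const_mul _)) intervalIntegrable_const,
    intervalIntegral.integral_sub hv2 (hv.norm.const_mul _),
    intervalIntegral.integral_const_mul, intervalIntegral.integral_const] at h0
  have hpos : 0 < b - a := sub_pos.2 hlt
  have h1 := mul_nonneg hpos.le h0
  have h2 : (b - a) * (∫ x in a..b, ‖v x‖ ^ 2) - m ^ 2
      = (b - a) * ((∫ x in a..b, ‖v x‖ ^ 2) - 2 * (m / (b - a)) * m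
        + (b - a) • (m / (b - a)) ^ 2) := by
    rw [smul_eq_mul]; field_simp; ring
  linarith

lemma IsPrimitive.norm_sub_sq_le {T : ℝ} {u v : ℝ → E} (h : IsPrimitive T u v)
    (hv2 : IntegrableOn (fun x => ‖v x‖ ^ 2) (Ioo 0 T)) {a b t : ℝ} (ha : 0 ≤ a) (hat : a ≤ t)
    (htb : t ≤ b) (hb : b ≤ T) :
    ‖u t - u a‖ ^ 2 ≤ (b - a) * ∫ x in a..b, ‖v x‖ ^ 2 := by
  have ha' : a ∈ Icc 0 T := ⟨ha, hat.trans (htb.trans hb)⟩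
  have hb' : b ∈ Icc 0 T := ⟨ha.trans (hat.trans htb), hb⟩
  have ht' : t ∈ Icc 0 T := ⟨ha.trans hat, htb.trans hb⟩
  have h1 := intervalIntegrable_of_mem h.1 ha' hb'
  refine le_trans ?_ (sq_integral_norm_le (hat.trans htb) h1
    (intervalIntegrable_of_mem hv2 ha' hb'))
  refine pow_le_pow_left₀ (norm_nonneg _) ?_ 2
  rw [h.sub_eq ha' ht']
  refine (intervalIntegral.norm_integral_le_integral_norm hat).trans ?_
  exact intervalIntegral.integral_mono_interval le_rfl hat htb
    (Filter.Eventually.of_forall fun x => norm_nonneg _) h1.norm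

lemma norm_sub_le_of_hasDerivWithinAt {T : ℝ} {g g₁ q q₁ : ℝ → E}
    (hg : ∀ t ∈ Icc 0 T, HasDerivWithinAt g (g₁ t) (Icc 0 T) t) (hq : ∀ t, HasDerivAt q (q₁ t) t)
    {a s m : ℝ} (ha : 0 ≤ a) (hs : 0 < s) (has : a + s ≤ T) (ha0 : q a = g a)
    (hm : ∀ t ∈ Icc a (a + s), ‖g₁ t - q₁ t‖ ≤ m) :
    ∀ t ∈ Icc a (a + s), ‖g t - q t‖ ≤ m * s := by
  intro t ht
  have hsub : Icc a (a + s) ⊆ Icc 0 T := Icc_subset_Icc ha has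
  have haa : a ∈ Icc a (a + s) := ⟨le_rfl, by linarith⟩
  have := Convex.norm_image_sub_le_of_norm_hasDerivWithin_le (f := fun t => g t - q t)
    (f' := fun t => g₁ t - q₁ t) (s := Icc a (a + s)) (x := a) (y := t) (C := m)
    (fun x hx => ((hg x (hsub hx)).mono hsub).sub (hq x).hasDerivWithinAt) hm
    (convex_Icc _ _) haa ht
  simp only [ha0, sub_self, sub_zero] at this
  refine this.trans (mul_le_mul_of_nonneg_left ?_ ((norm_nonneg _).trans (hm a haa)))
  rw [Real.norm_eq_abs, abs_of_nonneg (by linarith [ht.1])]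
  linarith [ht.2]

end Weak

lemma taylor_one {T : ℝ} {g g₁ : ℝ → ℂ}
    (hg : ∀ t ∈ Icc 0 T, HasDerivWithinAt g (g₁ t) (Icc 0 T) t)
    {a s m : ℝ} (ha : 0 ≤ a) (hs : 0 < s) (has : a + s ≤ T)
    (hm : ∀ t ∈ Icc a (a + s), ‖g₁ t - g₁ a‖ ≤ m) :
    ∀ t ∈ Icc a (a + s), ‖g t - (g a + ((t - a : ℝ) : ℂ) * g₁ a)‖ ≤ m * s := by
  refine norm_sub_le_of_hasDerivWithinAt (q₁ := fun _ => g₁ a) hg (fun t => ?_) ha hs has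
    (by simp) hm
  have h1 : HasDerivAt (fun t : ℝ => ((t - a : ℝ) : ℂ)) 1 t := by
    simpa using ((hasDerivAt_id t).sub_const a).ofReal_comp
  simpa using (h1.mul_const (g₁ a)).const_add (g a)

lemma taylor_two {T : ℝ} {g g₁ g₂ : ℝ → ℂ}
    (hg : ∀ t ∈ Icc 0 T, HasDerivWithinAt g (g₁ t) (Icc 0 T) t)
    (hg₁ : ∀ t ∈ Icc 0 T, HasDerivWithinAt g₁ (g₂ t) (Icc 0 T) t)
    {a s m : ℝ} (ha : 0 ≤ a) (hs : 0 < s) (has : a + s ≤ T)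
    (hm : ∀ t ∈ Icc a (a + s), ‖g₂ t - g₂ a‖ ≤ m) :
    ∀ t ∈ Icc a (a + s), ‖g t - (g a + ((t - a : ℝ) : ℂ) * g₁ a
      + ((t - a : ℝ) : ℂ) ^ 2 / 2 * g₂ a)‖ ≤ m * s * s := by
  refine norm_sub_le_of_hasDerivWithinAt
    (q₁ := fun t => g₁ a + ((t - a : ℝ) : ℂ) * g₂ a) hg (fun t => ?_) ha hs has
    (by simp) (taylor_one hg₁ ha hs has hm)
  have h1 : HasDerivAt (fun t : ℝ => ((t - a : ℝ) : ℂ)) 1 t := by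
    simpa using ((hasDerivAt_id t).sub_const a).ofReal_comp
  refine (((h1.mul_const (g₁ a)).const_add (g a)).add
    (((h1.pow 2).div_const 2).mul_const (g₂ a))).congr_deriv ?_
  push_cast; ring

lemma taylor_three {T : ℝ} {g g₁ g₂ g₃ : ℝ → ℂ}
    (hg : ∀ t ∈ Icc 0 T, HasDerivWithinAt g (g₁ t) (Icc 0 T) t)
    (hg₁ : ∀ t ∈ Icc 0 T, HasDerivWithinAt g₁ (g₂ t) (Icc 0 T) t)
    (hg₂ : ∀ t ∈ Icc 0 T, HasDerivWithinAt g₂ (g₃ t) (Icc 0 T) t)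
    {a s m : ℝ} (ha : 0 ≤ a) (hs : 0 < s) (has : a + s ≤ T)
    (hm : ∀ t ∈ Icc a (a + s), ‖g₃ t - g₃ a‖ ≤ m) :
    ∀ t ∈ Icc a (a + s), ‖g t - (g a + ((t - a : ℝ) : ℂ) * g₁ a
      + ((t - a : ℝ) : ℂ) ^ 2 / 2 * g₂ a + ((t - a : ℝ) : ℂ) ^ 3 / 6 * g₃ a)‖
      ≤ m * s * s * s := by
  refine norm_sub_le_of_hasDerivWithinAt
    (q₁ := fun t => g₁ a + ((t - a : ℝ) : ℂ) * g₂ a + ((t - a : ℝ) : ℂ) ^ 2 / 2 * g₃ a)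
    hg (fun t => ?_) ha hs has (by simp) (taylor_two hg₁ hg₂ ha hs has hm)
  have h1 : HasDerivAt (fun t : ℝ => ((t - a : ℝ) : ℂ)) 1 t := by
    simpa using ((hasDerivAt_id t).sub_const a).ofReal_comp
  refine ((((h1.mul_const (g₁ a)).const_add (g a)).add
    (((h1.pow 2).div_const 2).mul_const (g₂ a))).add
    (((h1.pow 3).div_const 6).mul_const (g₃ a))).congr_deriv ?_
  push_cast; ring

lemma norm_trapezoid_le {T : ℝ} {g g₁ g₂ : ℝ → ℂ}
    (hg : ∀ t ∈ Icc 0 T, HasDerivWithinAt g (g₁ t) (Icc 0 T) t)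
    (hg₁ : ∀ t ∈ Icc 0 T, HasDerivWithinAt g₁ (g₂ t) (Icc 0 T) t)
    {a s m : ℝ} (ha : 0 ≤ a) (hs : 0 < s) (has : a + s ≤ T)
    (hm : ∀ t ∈ Icc a (a + s), ‖g₂ t - g₂ a‖ ≤ m) :
    ‖(g (a + s) - g a) / s - (g₁ (a + s) + g₁ a) / 2‖ ≤ 3 / 2 * m * s := by
  have hb : a + s ∈ Icc a (a + s) := ⟨by linarith, le_rfl⟩
  have e0 := taylor_two hg hg₁ ha hs has hm _ hb
  have e1 := taylor_one hg₁ ha hs has hm _ hb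
  have hs0 : (s : ℂ) ≠ 0 := by exact_mod_cast hs.ne'
  simp only [add_sub_cancel_left] at e0 e1
  have key : (g (a + s) - g a) / s - (g₁ (a + s) + g₁ a) / 2
      = (g (a + s) - (g a + s * g₁ a + (s : ℂ) ^ 2 / 2 * g₂ a)) / s
        - (g₁ (a + s) - (g₁ a + s * g₂ a)) / 2 := by
    field_simp; ring
  rw [key]
  refine (norm_sub_le _ _).trans ?_
  rw [norm_div, norm_div, Complex.norm_real, Real.norm_of_nonneg hs.le, Complex.norm_ofNat]
  have : ‖g (a + s) - (g a + s * g₁ a + (s : ℂ) ^ 2 / 2 * g₂ a)‖ / s ≤ m * s := by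
    rw [div_le_iff₀ hs]; exact e0
  linarith

lemma sq_le_of_le_mul {x m s c d I : ℝ} (hx0 : 0 ≤ x) (hx : x ≤ c * m * s) (hm : m ^ 2 = s * I)
    (hI : 0 ≤ I) (hs : 0 < s) (hcd : c ^ 2 ≤ d) : x ^ 2 ≤ d * s ^ 3 * I := by
  calc x ^ 2 ≤ (c * m * s) ^ 2 := pow_le_pow_left₀ hx0 hx 2
    _ = c ^ 2 * (s ^ 3 * I) := by rw [mul_pow, mul_pow, hm]; ring
    _ ≤ d * (s ^ 3 * I) := mul_le_mul_of_nonneg_right hcd (by positivity)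
    _ = _ := by ring

lemma IsPrimitive.norm_sub_le_sqrt {T : ℝ} {u v : ℝ → ℂ} (h : IsPrimitive T u v)
    (hv2 : IntegrableOn (fun x => ‖v x‖ ^ 2) (Ioo 0 T)) {a s : ℝ} (ha : 0 ≤ a)
    (has : a + s ≤ T) :
    ∀ t ∈ Icc a (a + s), ‖u t - u a‖ ≤ Real.sqrt (s * ∫ x in a..a + s, ‖v x‖ ^ 2) := by
  intro t ht
  refine Real.le_sqrt_of_sq_le ?_
  simpa using h.norm_sub_sq_le hv2 ha ht.1 ht.2 has

lemma integral_norm_sq_nonneg (v : ℝ → ℂ) {a s : ℝ} (hs : 0 < s) :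
    0 ≤ ∫ x in a..a + s, ‖v x‖ ^ 2 :=
  intervalIntegral.integral_nonneg (by linarith) fun x _ => by positivity

section Errors

variable {T : ℝ} {g g₁ g₂ g₃ g₄ : ℝ → ℂ}
  (hg : ∀ t ∈ Icc 0 T, HasDerivWithinAt g (g₁ t) (Icc 0 T) t)
  (hg₁ : ∀ t ∈ Icc 0 T, HasDerivWithinAt g₁ (g₂ t) (Icc 0 T) t)
include hg hg₁

lemma sq_norm_trapezoid_le (h₃ : IsPrimitive T g₂ g₃)
    (hv2 : IntegrableOn (fun x => ‖g₃ x‖ ^ 2) (Ioo 0 T)) {a s : ℝ} (ha : 0 ≤ a) (hs : 0 < s)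
    (has : a + s ≤ T) :
    ‖(g (a + s) - g a) / s - (g₁ (a + s) + g₁ a) / 2‖ ^ 2
      ≤ 4 * s ^ 3 * ∫ x in a..a + s, ‖g₃ x‖ ^ 2 := by
  have hI := integral_norm_sq_nonneg g₃ hs (a := a)
  exact sq_le_of_le_mul (norm_nonneg _)
    (norm_trapezoid_le hg hg₁ ha hs has (h₃.norm_sub_le_sqrt hv2 ha has))
    (Real.sq_sqrt (by positivity)) hI hs (by norm_num)

lemma sq_norm_corrected_trapezoid_le (h₃ : IsPrimitive T g₂ g₃)
    (hv2 : IntegrableOn (fun x => ‖g₃ x‖ ^ 2) (Ioo 0 T)) {a s : ℝ} (ha : 0 ≤ a) (hs : 0 < s)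
    (has : a + s ≤ T) :
    ‖((g (a + s) - (s : ℂ) ^ 2 / 12 * g₂ (a + s)) - (g a - (s : ℂ) ^ 2 / 12 * g₂ a)) / s
      - (g₁ (a + s) + g₁ a) / 2‖ ^ 2 ≤ 4 * s ^ 3 * ∫ x in a..a + s, ‖g₃ x‖ ^ 2 := by
  have hI := integral_norm_sq_nonneg g₃ hs (a := a)
  have hm := h₃.norm_sub_le_sqrt hv2 ha has
  refine sq_le_of_le_mul (c := 19 / 12) (norm_nonneg _) ?_
    (Real.sq_sqrt (by positivity : 0 ≤ s * ∫ x in a..a + s, ‖g₃ x‖ ^ 2)) hI hs (by norm_num)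
  have e0 := norm_trapezoid_le hg hg₁ ha hs has hm
  have e1 := hm (a + s) ⟨by linarith, le_rfl⟩
  have hs0 : (s : ℂ) ≠ 0 := by exact_mod_cast hs.ne'
  have key : ((g (a + s) - (s : ℂ) ^ 2 / 12 * g₂ (a + s)) - (g a - (s : ℂ) ^ 2 / 12 * g₂ a)) / s
      - (g₁ (a + s) + g₁ a) / 2 = ((g (a + s) - g a) / s - (g₁ (a + s) + g₁ a) / 2)
        - (s : ℂ) / 12 * (g₂ (a + s) - g₂ a) := by
    field_simp; ring
  rw [key]
  refine (norm_sub_le _ _).trans ?_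
  rw [norm_mul, norm_div, Complex.norm_real, Real.norm_of_nonneg hs.le, Complex.norm_ofNat]
  nlinarith

lemma sq_norm_velocity_le (hg₂ : ∀ t ∈ Icc 0 T, HasDerivWithinAt g₂ (g₃ t) (Icc 0 T) t)
    (h₄ : IsPrimitive T g₃ g₄) (hv2 : IntegrableOn (fun x => ‖g₄ x‖ ^ 2) (Ioo 0 T)) {a s : ℝ}
    (ha : 0 ≤ a) (hs : 0 < s) (has : a + s ≤ T) :
    ‖((g (a + s) - g a) / s - 1 / 2 * ((g₁ (a + s) - (s : ℂ) ^ 2 / 12 * g₃ (a + s))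
      + (g₁ a - (s : ℂ) ^ 2 / 12 * g₃ a))) / s‖ ^ 2
      ≤ 4 * s ^ 3 * ∫ x in a..a + s, ‖g₄ x‖ ^ 2 := by
  have hI := integral_norm_sq_nonneg g₄ hs (a := a)
  have hm := h₄.norm_sub_le_sqrt hv2 ha has
  set m := Real.sqrt (s * ∫ x in a..a + s, ‖g₄ x‖ ^ 2)
  refine sq_le_of_le_mul (c := 37 / 24) (norm_nonneg _) ?_
    (Real.sq_sqrt (by positivity : 0 ≤ s * ∫ x in a..a + s, ‖g₄ x‖ ^ 2)) hI hs (by norm_num)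
  have hb : a + s ∈ Icc a (a + s) := ⟨by linarith, le_rfl⟩
  have e0 := taylor_three hg hg₁ hg₂ ha hs has hm _ hb
  have e1 := taylor_two hg₁ hg₂ ha hs has hm _ hb
  have e3 := hm _ hb
  have hs0 : (s : ℂ) ≠ 0 := by exact_mod_cast hs.ne'
  simp only [add_sub_cancel_left] at e0 e1
  have key : ((g (a + s) - g a) / s - 1 / 2 * ((g₁ (a + s) - (s : ℂ) ^ 2 / 12 * g₃ (a + s))
      + (g₁ a - (s : ℂ) ^ 2 / 12 * g₃ a))) / s
      = (g (a + s) - (g a + s * g₁ a + (s : ℂ) ^ 2 / 2 * g₂ a + (s : ℂ) ^ 3 / 6 * g₃ a)) / s / s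
        - (g₁ (a + s) - (g₁ a + s * g₂ a + (s : ℂ) ^ 2 / 2 * g₃ a)) / 2 / s
        + (s : ℂ) / 24 * (g₃ (a + s) - g₃ a) := by
    field_simp; ring
  rw [key]
  refine (norm_add_le _ _).trans ((add_le_add (norm_sub_le _ _) le_rfl).trans ?_)
  simp only [norm_div, norm_mul, Complex.norm_real, Real.norm_of_nonneg hs.le, Complex.norm_ofNat]
  have a1 : ‖g (a + s) - (g a + s * g₁ a + (s : ℂ) ^ 2 / 2 * g₂ a + (s : ℂ) ^ 3 / 6 * g₃ a)‖ / s / s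
      ≤ m * s := by
    rw [div_le_iff₀ hs, div_le_iff₀ hs]; exact e0
  have a2 : ‖g₁ (a + s) - (g₁ a + s * g₂ a + (s : ℂ) ^ 2 / 2 * g₃ a)‖ / 2 / s ≤ m * s / 2 := by
    rw [div_le_iff₀ hs]; linarith
  have a3 : s / 24 * ‖g₃ (a + s) - g₃ a‖ ≤ s / 24 * m := by gcongr
  linarith

omit hg₁ in
lemma sq_norm_increment_le (h₂ : IsPrimitive T g₁ g₂)
    (hv2 : IntegrableOn (fun x => ‖g₂ x‖ ^ 2) (Ioo 0 T)) {a s : ℝ} (ha : 0 ≤ a) (hs : 0 < s)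
    (has : a + s ≤ T) :
    ‖g (a + s) - g a - s * g₁ a‖ ^ 2 ≤ s ^ 3 * ∫ x in a..a + s, ‖g₂ x‖ ^ 2 := by
  have hI := integral_norm_sq_nonneg g₂ hs (a := a)
  have := taylor_one hg ha hs has (h₂.norm_sub_le_sqrt hv2 ha has) _ ⟨by linarith, le_rfl⟩
  simp only [add_sub_cancel_left, ← sub_sub] at this
  simpa using sq_le_of_le_mul (c := 1) (d := 1) (norm_nonneg _) (this.trans_eq (by ring))
    (Real.sq_sqrt (by positivity)) hI hs (by norm_num)

omit hg₁ in
lemma sq_norm_second_difference_le (h₂ : IsPrimitive T g₁ g₂)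
    (hv2 : IntegrableOn (fun x => ‖g₂ x‖ ^ 2) (Ioo 0 T)) {a s : ℝ} (ha : 0 ≤ a) (hs : 0 < s)
    (has : a + s + s ≤ T) :
    ‖g (a + s + s) - 2 * g (a + s) + g a‖ ^ 2
      ≤ 6 * s ^ 3 * ((∫ x in a..a + s, ‖g₂ x‖ ^ 2) + ∫ x in a + s..a + s + s, ‖g₂ x‖ ^ 2) := by
  have e1 := sq_norm_increment_le hg h₂ hv2 ha hs (by linarith)
  have e2 := sq_norm_increment_le hg h₂ hv2 (a := a + s) (by linarith) hs has
  have e3 := h₂.norm_sub_sq_le hv2 ha (by linarith : a ≤ a + s) le_rfl (by linarith)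
  simp only [add_sub_cancel_left] at e3
  have key : g (a + s + s) - 2 * g (a + s) + g a = (g (a + s + s) - g (a + s) - s * g₁ (a + s))
      - (g (a + s) - g a - s * g₁ a) + s * (g₁ (a + s) - g₁ a) := by ring
  have I2 := integral_norm_sq_nonneg g₂ hs (a := a + s)
  have e4 : ‖(s : ℂ) * (g₁ (a + s) - g₁ a)‖ ^ 2 ≤ s ^ 3 * ∫ x in a..a + s, ‖g₂ x‖ ^ 2 := by
    rw [norm_mul, Complex.norm_real, Real.norm_of_nonneg hs.le, mul_pow]
    calc s ^ 2 * ‖g₁ (a + s) - g₁ a‖ ^ 2 ≤ s ^ 2 * (s * ∫ x in a..a + s, ‖g₂ x‖ ^ 2) := by gcongr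
      _ = _ := by ring
  have tri : ∀ x y z : ℂ, ‖x - y + z‖ ^ 2 ≤ 3 * (‖x‖ ^ 2 + ‖y‖ ^ 2 + ‖z‖ ^ 2) := by
    intro x y z
    have h := (norm_add_le (x - y) z).trans (add_le_add (norm_sub_le x y) le_rfl)
    refine (pow_le_pow_left₀ (norm_nonneg _) h 2).trans ?_
    nlinarith [sq_nonneg (‖x‖ - ‖y‖), sq_nonneg (‖x‖ - ‖z‖), sq_nonneg (‖y‖ - ‖z‖)]
  rw [key]
  refine (tri _ _ _).trans ?_
  nlinarith [mul_nonneg (by positivity : 0 ≤ s ^ 3) I2]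

end Errors

/-! ### Characters -/

lemma char_zero (L : ℝ) (p : ℝ × ℝ) : char L 0 0 p = 1 := by simp [char]

lemma char_add (L : ℝ) (k l k' l' : ℤ) (p : ℝ × ℝ) :
    char L (k + k') (l + l') p = char L k l p * char L k' l' p := by
  rw [char, char, char, ← Complex.exp_add]; congr 1; push_cast; ring

lemma char_eq_exp_ofReal (L : ℝ) (k l : ℤ) (p : ℝ × ℝ) :
    char L k l p = Complex.exp (((2 * Real.pi / L * (k * p.1 + l * p.2) : ℝ) : ℂ) * Complex.I) := by
  rw [char]; congr 1; push_cast; ring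

lemma norm_char (L : ℝ) (k l : ℤ) (p : ℝ × ℝ) : ‖char L k l p‖ = 1 := by
  rw [char_eq_exp_ofReal, Complex.norm_exp_ofReal_mul_I]

lemma conj_char (L : ℝ) (k l : ℤ) (p : ℝ × ℝ) :
    (starRingEnd ℂ) (char L k l p) = char L (-k) (-l) p := by
  rw [char_eq_exp_ofReal, char_eq_exp_ofReal, ← Complex.exp_conj]
  congr 1
  simp only [map_mul, Complex.conj_ofReal, Complex.conj_I]
  push_cast; ring

lemma char_translate (L : ℝ) (k l : ℤ) (x y a b : ℝ) :
    char L k l (x + a, y + b) = char L k l (x, y) * char L k l (a, b) := by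
  rw [char, char, char, ← Complex.exp_add]; congr 1; push_cast; ring

lemma continuous_char (L : ℝ) (k l : ℤ) : Continuous (char L k l) := by
  unfold char; fun_prop

lemma char_period_left {L : ℝ} (hL : L ≠ 0) (k l : ℤ) : char L k l (L, 0) = 1 := by
  rw [char, Complex.exp_eq_one_iff]
  refine ⟨k, ?_⟩
  have : (L : ℂ) ≠ 0 := by exact_mod_cast hL
  push_cast; field_simp; ring

lemma char_period_right {L : ℝ} (hL : L ≠ 0) (k l : ℤ) : char L k l (0, L) = 1 := by
  rw [char, Complex.exp_eq_one_iff]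
  refine ⟨l, ?_⟩
  have : (L : ℂ) ≠ 0 := by exact_mod_cast hL
  push_cast; field_simp; ring

/-- Lebesgue measure on the square is a product. -/
lemma restrict_square (L : ℝ) : (volume.restrict (square L) : Measure (ℝ × ℝ))
    = (volume.restrict (Ioo 0 L)).prod (volume.restrict (Ioo 0 L)) := by
  rw [square, Measure.volume_eq_prod, Measure.prod_restrict]

instance isFiniteMeasure_square (L : ℝ) :
    IsFiniteMeasure (volume.restrict (square L) : Measure (ℝ × ℝ)) := by
  rw [restrict_square]; infer_instance

lemma integral_exp_Ioo {L : ℝ} (hL : 0 < L) (k : ℤ) :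
    ∫ x in Ioo 0 L, Complex.exp (2 * Real.pi * Complex.I / L * (k * x))
      = if k = 0 then (L : ℂ) else 0 := by
  rw [← integral_Ioc_eq_integral_Ioo, ← intervalIntegral.integral_of_le hL.le]
  have hL0 : (L : ℂ) ≠ 0 := by exact_mod_cast hL.ne'
  split_ifs with hk
  · simp [hk]
  · have hc : (2 * Real.pi * Complex.I / L * k : ℂ) ≠ 0 := by
      have : (Real.pi : ℂ) ≠ 0 := by exact_mod_cast Real.pi_ne_zero
      have hk' : (k : ℂ) ≠ 0 := by exact_mod_cast hk
      simp [hL0, this, hk', Complex.I_ne_zero]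
    simp_rw [← mul_assoc]
    rw [integral_exp_mul_complex hc]
    have : Complex.exp (2 * Real.pi * Complex.I / L * k * L) = 1 := by
      rw [Complex.exp_eq_one_iff]; exact ⟨k, by field_simp⟩
    rw [this]; simp

lemma integral_char {L : ℝ} (hL : 0 < L) (k l : ℤ) :
    ∫ p in square L, char L k l p = if k = 0 ∧ l = 0 then (L : ℂ) ^ 2 else 0 := by
  have h : ∀ p : ℝ × ℝ, char L k l p = Complex.exp (2 * Real.pi * Complex.I / L * (k * p.1))
      * Complex.exp (2 * Real.pi * Complex.I / L * (l * p.2)) := by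
    intro p; rw [char, ← Complex.exp_add]; congr 1; ring
  simp_rw [h]
  rw [restrict_square, integral_prod_mul (fun x : ℝ => Complex.exp (2 * Real.pi * Complex.I / L * (k * x)))
    (fun x : ℝ => Complex.exp (2 * Real.pi * Complex.I / L * (l * x))),
    integral_exp_Ioo hL, integral_exp_Ioo hL]
  by_cases hk : k = 0 <;> by_cases hl : l = 0 <;> simp [hk, hl, sq]

/-! ### Fourier coefficients of square integrable functions -/

lemma memLp_char (L : ℝ) (ξ : ℤ × ℤ) : MemLp (char L ξ.1 ξ.2) 2 (volume.restrict (square L)) :=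
  MemLp.of_bound (continuous_char L ξ.1 ξ.2).aestronglyMeasurable 1
    (Filter.Eventually.of_forall fun p => (norm_char L ξ.1 ξ.2 p).le)

/-- The normalised characters in complex `L²`. -/
def charLp (L : ℝ) (ξ : ℤ × ℤ) : Lp ℂ 2 (volume.restrict (square L)) :=
  ((1 / L : ℝ) : ℂ) • (memLp_char L ξ).toLp

lemma charLp_coeFn (L : ℝ) (ξ : ℤ × ℤ) :
    charLp L ξ =ᵐ[volume.restrict (square L)] fun p => ((1 / L : ℝ) : ℂ) * char L ξ.1 ξ.2 p := by
  filter_upwards [Lp.coeFn_smul ((1 / L : ℝ) : ℂ) (memLp_char L ξ).toLp,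
    (memLp_char L ξ).coeFn_toLp] with p h1 h2
  rw [charLp, h1, Pi.smul_apply, h2, smul_eq_mul]

lemma orthonormal_charLp {L : ℝ} (hL : 0 < L) : Orthonormal ℂ (charLp L) := by
  rw [orthonormal_iff_ite]
  intro ξ η
  have h : inner ℂ (charLp L ξ) (charLp L η) = ∫ p in square L,
      ((1 / L : ℝ) : ℂ) ^ 2 * char L (η.1 - ξ.1) (η.2 - ξ.2) p := by
    rw [L2.inner_def]
    refine integral_congr_ae ?_
    filter_upwards [charLp_coeFn L ξ, charLp_coeFn L η] with p h1 h2
    rw [h1, h2, RCLike.inner_apply, map_mul, conj_char, Complex.conj_ofReal, sub_eq_add_neg,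
      sub_eq_add_neg, char_add]
    ring
  rw [h, integral_const_mul, integral_char hL]
  have hL0 : (L : ℂ) ≠ 0 := by exact_mod_cast hL.ne'
  have hiff : (η.1 - ξ.1 = 0 ∧ η.2 - ξ.2 = 0) ↔ ξ = η := by
    rw [Prod.ext_iff, sub_eq_zero, sub_eq_zero]; constructor <;> rintro ⟨h1, h2⟩ <;> exact ⟨h1.symm, h2.symm⟩
  simp only [hiff]
  split_ifs
  · push_cast; field_simp
  · simp

/-- The inclusion of real `L²` into complex `L²`. -/
def toComplex (L : ℝ) : L2 L →L[ℝ] Lp ℂ 2 (volume.restrict (square L)) :=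
  Complex.ofRealCLM.compLpL 2 (volume.restrict (square L))

lemma toComplex_coeFn (L : ℝ) (f : L2 L) :
    toComplex L f =ᵐ[volume.restrict (square L)] fun p => (f p : ℂ) :=
  Complex.ofRealCLM.coeFn_compLpL f

lemma norm_toComplex (L : ℝ) (f : L2 L) : ‖toComplex L f‖ = ‖f‖ := by
  have h : ∀ᵐ p ∂volume.restrict (square L), ‖toComplex L f p‖ = ‖f p‖ := by
    filter_upwards [toComplex_coeFn L f] with p hp
    rw [hp, Complex.norm_real]
  exact le_antisymm (Lp.norm_le_norm_of_ae_le (h.mono fun p hp => hp.le))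
    (Lp.norm_le_norm_of_ae_le (h.mono fun p hp => hp.ge))

/-- The Fourier coefficient as a continuous linear functional. -/
def fourierCLM (L : ℝ) (ξ : ℤ × ℤ) : L2 L →L[ℝ] ℂ :=
  (((1 / L : ℝ) : ℂ) • (innerSL ℂ (charLp L ξ))).restrictScalars ℝ ∘L toComplex L

lemma fourierCLM_eq_inner (L : ℝ) (ξ : ℤ × ℤ) (f : L2 L) :
    fourierCLM L ξ f = ((1 / L : ℝ) : ℂ) * inner ℂ (charLp L ξ) (toComplex L f) := rfl

lemma fourierCLM_apply (L : ℝ) (ξ : ℤ × ℤ) (f : L2 L) :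
    fourierCLM L ξ f = fourierCoeff L f ξ.1 ξ.2 := by
  have h : inner ℂ (charLp L ξ) (toComplex L f) = ∫ p in square L,
      ((1 / L : ℝ) : ℂ) * ((f p : ℂ) * char L (-ξ.1) (-ξ.2) p) := by
    rw [L2.inner_def]
    refine integral_congr_ae ?_
    filter_upwards [charLp_coeFn L ξ, toComplex_coeFn L f] with p h1 h2
    rw [h1, h2, RCLike.inner_apply, map_mul, conj_char, Complex.conj_ofReal]
    ring
  rw [fourierCLM_eq_inner, h, integral_const_mul, fourierCoeff]
  push_cast; ring

/-- Bessel's inequality. -/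
lemma sum_sq_fourierCoeff_le {L : ℝ} (hL : 0 < L) (f : L2 L) (S : Finset (ℤ × ℤ)) :
    ∑ ξ ∈ S, ‖fourierCoeff L f ξ.1 ξ.2‖ ^ 2 ≤ L⁻¹ ^ 2 * ‖f‖ ^ 2 := by
  have h := (orthonormal_charLp hL).sum_inner_products_le (toComplex L f) (s := S)
  rw [norm_toComplex] at h
  refine le_trans (le_of_eq ?_) (mul_le_mul_of_nonneg_left h (by positivity : 0 ≤ L⁻¹ ^ 2))
  rw [Finset.mul_sum]
  refine Finset.sum_congr rfl fun ξ _ => ?_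
  rw [← fourierCLM_apply, fourierCLM_eq_inner, norm_mul, mul_pow, Complex.norm_real, one_div,
    Real.norm_of_nonneg (by positivity)]

/-! ### Completeness of the characters -/

lemma ae_eq_zero_of_fourier_one {L : ℝ} (hL : 0 < L) {f : ℝ → ℂ}
    (hf : MemLp f 2 (volume.restrict (Ioo 0 L)))
    (h : ∀ k : ℤ, ∫ x in Ioo 0 L, f x * Complex.exp (2 * Real.pi * Complex.I / L * (k * x)) = 0) :
    ∀ᵐ x ∂volume.restrict (Ioo 0 L), f x = 0 := by
  have hf' : MemLp f 2 (volume.restrict (Ioc 0 L)) := by rwa [← restrict_Ioo_eq_restrict_Ioc]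
  have hs := hasSum_sq_fourierCoeffOn hL hf'
  have h0 : ∀ i : ℤ, fourierCoeffOn hL f i = 0 := by
    intro i
    rw [fourierCoeffOn_eq_integral, intervalIntegral.integral_of_le hL.le,
      integral_Ioc_eq_integral_Ioo]
    have : ∫ x in Ioo 0 L, (fourier (-i) (x : AddCircle (L - 0))) • f x
        = ∫ x in Ioo 0 L, f x * Complex.exp (2 * Real.pi * Complex.I / L * ((-i : ℤ) * x)) := by
      refine integral_congr_ae (Filter.Eventually.of_forall fun x => ?_)
      simp only [fourier_coe_apply, smul_eq_mul]
      rw [mul_comm]; congr 2; push_cast; ring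
    rw [this, h, smul_zero]
  simp only [h0, norm_zero, ne_eq, OfNat.ofNat_ne_zero, not_false_eq_true, zero_pow] at hs
  have h1 := hs.unique hasSum_zero
  rw [sub_zero, smul_eq_mul, mul_eq_zero, or_iff_right (inv_ne_zero hL.ne'),
    intervalIntegral.integral_of_le hL.le, integral_Ioc_eq_integral_Ioo] at h1
  have h2 := (integral_eq_zero_iff_of_nonneg (fun x => by positivity)
    ((memLp_two_iff_integrable_sq_norm hf.1).1 hf)).1 h1
  filter_upwards [h2] with x hx
  simpa using hx

lemma ae_eq_zero_of_fourier_two {L : ℝ} (hL : 0 < L) {g : ℝ × ℝ → ℂ}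
    (hg : MemLp g 2 (volume.restrict (square L)))
    (h : ∀ k l : ℤ, ∫ p in square L, g p * char L k l p = 0) :
    ∀ᵐ p ∂volume.restrict (square L), g p = 0 := by
  have hsq : Integrable (fun p => ‖g p‖ ^ 2) (volume.restrict (square L)) :=
    (memLp_two_iff_integrable_sq_norm hg.1).1 hg
  have hint : Integrable g (volume.restrict (square L)) := hg.integrable (by norm_num)
  rw [restrict_square] at *
  set μ := (volume.restrict (Ioo 0 L) : Measure ℝ)
  have hex : ∀ (l : ℤ), Continuous fun y : ℝ => Complex.exp (2 * Real.pi * Complex.I / L * (l * y)) := by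
    intro l; fun_prop
  have hexn : ∀ (l : ℤ) (y : ℝ), ‖Complex.exp (2 * Real.pi * Complex.I / L * (l * y))‖ = 1 := by
    intro l y
    have := norm_char L 0 l (0, y)
    simpa [char] using this
  have hgl : ∀ l : ℤ, Integrable (fun p : ℝ × ℝ =>
      g p * Complex.exp (2 * Real.pi * Complex.I / L * (l * p.2))) (μ.prod μ) := by
    intro l
    refine hint.mul_bdd (c := 1) ((hex l).comp continuous_snd).aestronglyMeasurable
      (Filter.Eventually.of_forall fun p => (hexn l p.2).le)
  have hslice : ∀ᵐ x ∂μ, MemLp (fun y => g (x, y)) 2 μ := by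
    filter_upwards [hsq.prod_right_ae, hint.prod_right_ae] with x hx1 hx2
    exact (memLp_two_iff_integrable_sq_norm hx2.1).2 hx1
  have hF : ∀ l : ℤ, ∀ᵐ x ∂μ,
      ∫ y, g (x, y) * Complex.exp (2 * Real.pi * Complex.I / L * (l * y)) ∂μ = 0 := by
    intro l
    refine ae_eq_zero_of_fourier_one hL ?_ ?_
    · rw [memLp_two_iff_integrable_sq_norm (hgl l).integral_prod_left.1]
      refine (hsq.integral_prod_left.const_mul L).mono' ((hgl l).integral_prod_left.1.norm.pow 2) ?_
      filter_upwards [hslice] with x hx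
      have hx1 : IntegrableOn (fun y => g (x, y)) (Ioo 0 L) := hx.integrable (by norm_num)
      have hx2 : IntegrableOn (fun y => ‖g (x, y)‖ ^ 2) (Ioo 0 L) :=
        (memLp_two_iff_integrable_sq_norm hx.1).1 hx
      have := sq_integral_norm_le hL.le
        (intervalIntegrable_of_mem hx1 ⟨le_rfl, hL.le⟩ ⟨hL.le, le_rfl⟩)
        (intervalIntegrable_of_mem hx2 ⟨le_rfl, hL.le⟩ ⟨hL.le, le_rfl⟩)
      rw [intervalIntegral.integral_of_le hL.le, intervalIntegral.integral_of_le hL.le,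
        integral_Ioc_eq_integral_Ioo, integral_Ioc_eq_integral_Ioo, sub_zero] at this
      rw [Real.norm_of_nonneg (by positivity)]
      refine le_trans (pow_le_pow_left₀ (norm_nonneg _) ?_ 2) this
      refine (norm_integral_le_integral_norm _).trans (le_of_eq ?_)
      simp_rw [norm_mul, hexn, mul_one]
      rfl
    · intro k
      rw [← h k l, integral_prod _ ?_]
      · refine integral_congr_ae (Filter.Eventually.of_forall fun x => ?_)
        simp only
        rw [← integral_mul_const]
        refine integral_congr_ae (Filter.Eventually.of_forall fun y => ?_)
        simp only [char]
        rw [mul_assoc, ← Complex.exp_add]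
        congr 2; ring
      · exact hint.mul_bdd (c := 1) (continuous_char L k l).aestronglyMeasurable
          (Filter.Eventually.of_forall fun p => (norm_char L k l p).le)
  have hz : ∀ᵐ x ∂μ, ∫ y, ‖g (x, y)‖ ^ 2 ∂μ = 0 := by
    filter_upwards [ae_all_iff.2 hF, hslice] with x hx1 hx2
    have := ae_eq_zero_of_fourier_one hL hx2 hx1
    rw [integral_eq_zero_of_ae]
    filter_upwards [this] with y hy
    simp [hy]
  have h0 : ∫ p, ‖g p‖ ^ 2 ∂(μ.prod μ) = 0 := by
    rw [integral_prod _ hsq]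
    exact integral_eq_zero_of_ae hz
  have h2 := (integral_eq_zero_iff_of_nonneg (fun x => by positivity) hsq).1 h0
  filter_upwards [h2] with x hx
  simpa using hx

/-- A square integrable function with absolutely summable Fourier coefficients is the sum of its
Fourier series. -/
lemma ae_eq_tsum_fourier {L : ℝ} (hL : 0 < L) (f : L2 L)
    (hs : Summable fun ξ : ℤ × ℤ => ‖fourierCoeff L f ξ.1 ξ.2‖) :
    ∀ᵐ p ∂volume.restrict (square L),
      (f p : ℂ) = ∑' ξ : ℤ × ℤ, fourierCoeff L f ξ.1 ξ.2 * char L ξ.1 ξ.2 p := by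
  set a : ℤ × ℤ → ℂ := fun ξ => fourierCoeff L f ξ.1 ξ.2
  set u : ℝ × ℝ → ℂ := fun p => ∑' ξ, a ξ * char L ξ.1 ξ.2 p
  have hbd : ∀ ξ p, ‖a ξ * char L ξ.1 ξ.2 p‖ ≤ ‖a ξ‖ := fun ξ p => by rw [norm_mul, norm_char, mul_one]
  have hu : Continuous u := continuous_tsum
    (fun ξ => continuous_const.mul (continuous_char L ξ.1 ξ.2)) hs hbd
  have hub : ∀ p, ‖u p‖ ≤ ∑' ξ, ‖a ξ‖ := fun p => tsum_of_norm_bounded hs.hasSum (hbd · p)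
  have huL : MemLp u 2 (volume.restrict (square L)) :=
    MemLp.of_bound hu.aestronglyMeasurable _ (Filter.Eventually.of_forall hub)
  have hfL : MemLp (fun p => (f p : ℂ)) 2 (volume.restrict (square L)) := (Lp.memLp f).ofReal
  have key := ae_eq_zero_of_fourier_two hL (hfL.sub huL) ?_
  · filter_upwards [key] with p hp using sub_eq_zero.1 hp
  intro k l
  have hL0 : (L : ℂ) ≠ 0 := by exact_mod_cast hL.ne'
  have i1 : Integrable (fun p => (f p : ℂ) * char L k l p) (volume.restrict (square L)) :=
    (hfL.integrable (by norm_num)).mul_bdd (c := 1) (continuous_char L k l).aestronglyMeasurable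
      (Filter.Eventually.of_forall fun p => (norm_char L k l p).le)
  have i2 : Integrable (fun p => u p * char L k l p) (volume.restrict (square L)) :=
    (huL.integrable (by norm_num)).mul_bdd (c := 1) (continuous_char L k l).aestronglyMeasurable
      (Filter.Eventually.of_forall fun p => (norm_char L k l p).le)
  have e1 : ∫ p in square L, (f p : ℂ) * char L k l p = (L : ℂ) ^ 2 * a (-k, -l) := by
    simp only [a, fourierCoeff, neg_neg]; field_simp
  have e2 : ∫ p in square L, u p * char L k l p = (L : ℂ) ^ 2 * a (-k, -l) := by
    have hF : ∀ ξ : ℤ × ℤ, Integrable (fun p => a ξ * char L (ξ.1 + k) (ξ.2 + l) p)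
        (volume.restrict (square L)) := fun ξ =>
      ((memLp_char L (ξ.1 + k, ξ.2 + l)).integrable (by norm_num)).const_mul _
    have hn : Summable fun ξ : ℤ × ℤ => ∫ p in square L, ‖a ξ * char L (ξ.1 + k) (ξ.2 + l) p‖ := by
      simp_rw [norm_mul, norm_char, mul_one]
      simp only [integral_const, smul_eq_mul]
      exact hs.mul_left _
    have := integral_tsum_of_summable_integral_norm hF hn
    have e3 : ∀ p, u p * char L k l p = ∑' ξ, a ξ * char L (ξ.1 + k) (ξ.2 + l) p := by
      intro p
      simp only [u, ← tsum_mul_right, char_add, mul_assoc]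
    simp_rw [e3, ← this, integral_const_mul, integral_char hL]
    rw [tsum_eq_single (-k, -l)]
    · simp [mul_comm]
    · intro ξ hξ
      rw [if_neg, mul_zero]
      rintro ⟨h1, h2⟩
      exact hξ (Prod.ext (by simp; omega) (by simp; omega))
  simp only [Pi.sub_apply, sub_mul]
  rw [integral_sub i1 i2, e1, e2, sub_self]

/-! ### Fourier coefficients of weak derivatives -/

/-- The Fourier coefficient of a function. -/
def fnCoeff (L : ℝ) (f : ℝ × ℝ → ℝ) (ξ : ℤ × ℤ) : ℂ :=
  (1 / (L : ℂ) ^ 2) * ∫ p in square L, (f p : ℂ) * char L (-ξ.1) (-ξ.2) p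

lemma fourierCoeff_eq_fnCoeff (L : ℝ) (f : L2 L) (ξ : ℤ × ℤ) :
    fourierCoeff L f ξ.1 ξ.2 = fnCoeff L f ξ := rfl

/-- The symbol of `∂ₓ` on the mode `k`. -/
def derivSymbol (L : ℝ) (k : ℤ) : ℂ := 2 * Real.pi * Complex.I / L * k

lemma hasDerivAt_char_left (L : ℝ) (k l : ℤ) (z : ℂ) (x y : ℝ) :
    HasDerivAt (fun x : ℝ => (z * char L k l (x, y)).re)
      ((z * derivSymbol L k * char L k l (x, y)).re) x := by
  have h1 : HasDerivAt (fun x : ℝ => 2 * Real.pi * Complex.I / L * (k * (x : ℂ) + l * y))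
      (2 * Real.pi * Complex.I / L * k) x := by
    have := (((hasDerivAt_id x).ofReal_comp.const_mul (k : ℂ)).add_const ((l : ℂ) * y)).const_mul
      (2 * Real.pi * Complex.I / L : ℂ)
    simpa using this
  have h2 := (h1.cexp).const_mul z
  have h3 := Complex.reCLM.hasFDerivAt.comp_hasDerivAt x h2
  refine h3.congr_deriv ?_
  simp only [Complex.reCLM_apply, char, derivSymbol]
  congr 1; ring

lemma hasDerivAt_char_right (L : ℝ) (k l : ℤ) (z : ℂ) (x y : ℝ) :
    HasDerivAt (fun y : ℝ => (z * char L k l (x, y)).re)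
      ((z * derivSymbol L l * char L k l (x, y)).re) y := by
  have h := hasDerivAt_char_left L l k z y x
  have e : ∀ x y, char L l k (y, x) = char L k l (x, y) := by
    intro x y; simp only [char]; congr 1; ring
  simpa only [e] using h

lemma iteratedDeriv_char_left (L : ℝ) (k l : ℤ) (y : ℝ) (n : ℕ) (z : ℂ) (x : ℝ) :
    iteratedDeriv n (fun x : ℝ => (z * char L k l (x, y)).re) x
      = (z * derivSymbol L k ^ n * char L k l (x, y)).re := by
  induction n generalizing z with
  | zero => simp
  | succ n ih =>
    rw [iteratedDeriv_succ', funext fun x => (hasDerivAt_char_left L k l z x y).deriv, ih, pow_succ']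
    congr 1; ring

lemma iteratedDeriv_char_right (L : ℝ) (k l : ℤ) (x : ℝ) (n : ℕ) (z : ℂ) (y : ℝ) :
    iteratedDeriv n (fun y : ℝ => (z * char L k l (x, y)).re) y
      = (z * derivSymbol L l ^ n * char L k l (x, y)).re := by
  induction n generalizing z with
  | zero => simp
  | succ n ih =>
    rw [iteratedDeriv_succ', funext fun y => (hasDerivAt_char_right L k l z x y).deriv, ih, pow_succ']
    congr 1; ring

lemma partialDeriv_char (L : ℝ) (k l : ℤ) (a b : ℕ) (z : ℂ) (p : ℝ × ℝ) :
    partialDeriv a b (fun p => (z * char L k l p).re) p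
      = (z * derivSymbol L l ^ b * derivSymbol L k ^ a * char L k l p).re := by
  simp only [partialDeriv, iteratedDeriv_char_right, iteratedDeriv_char_left]

lemma isPeriodicTest_char {L : ℝ} (hL : 0 < L) (k l : ℤ) (z : ℂ) :
    IsPeriodicTest L (fun p => (z * char L k l p).re) := by
  refine ⟨?_, fun x y => ⟨?_, ?_⟩⟩
  · refine Complex.reCLM.contDiff.comp (contDiff_const.mul ?_)
    unfold char
    refine Complex.contDiff_exp.comp (contDiff_const.mul ?_)
    exact (contDiff_const.mul (Complex.ofRealCLM.contDiff.comp contDiff_fst)).add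
      (contDiff_const.mul (Complex.ofRealCLM.contDiff.comp contDiff_snd))
  · have := char_translate L k l x y L 0
    rw [add_zero, char_period_left hL.ne', mul_one] at this
    simp only [this]
  · have := char_translate L k l x y 0 L
    rw [add_zero, char_period_right hL.ne', mul_one] at this
    simp only [this]

lemma integrable_mul_char {L : ℝ} {f : ℝ × ℝ → ℝ} (hf : IntegrableOn f (square L)) (k l : ℤ) :
    IntegrableOn (fun p => (f p : ℂ) * char L k l p) (square L) :=
  (Integrable.ofReal hf).mul_bdd (c := 1) (continuous_char L k l).aestronglyMeasurable
    (Filter.Eventually.of_forall fun p => (norm_char L k l p).le)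

lemma integral_mul_re_char {L : ℝ} (hL : 0 < L) {f : ℝ × ℝ → ℝ} (hf : IntegrableOn f (square L))
    (ξ : ℤ × ℤ) (z : ℂ) :
    ∫ p in square L, f p * (z * char L (-ξ.1) (-ξ.2) p).re
      = (z * ((L : ℂ) ^ 2 * fnCoeff L f ξ)).re := by
  have hL0 : (L : ℂ) ≠ 0 := by exact_mod_cast hL.ne'
  have h : (L : ℂ) ^ 2 * fnCoeff L f ξ = ∫ p in square L, (f p : ℂ) * char L (-ξ.1) (-ξ.2) p := by
    rw [fnCoeff]; field_simp
  rw [h, ← integral_const_mul]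
  have h2 := integral_re (𝕜 := ℂ) ((integrable_mul_char hf (-ξ.1) (-ξ.2)).const_mul z)
  simp only [RCLike.re_to_complex] at h2
  rw [← h2]
  refine integral_congr_ae (Filter.Eventually.of_forall fun p => ?_)
  simp only
  rw [← Complex.re_ofReal_mul]
  congr 1; ring

lemma eq_of_re_mul_eq {A B : ℂ} (h : ∀ z : ℂ, (z * A).re = (z * B).re) : A = B := by
  have h1 := h 1
  have h2 := h Complex.I
  apply Complex.ext
  · simpa using h1
  · simpa using h2

lemma derivSymbol_neg (L : ℝ) (k : ℤ) : derivSymbol L (-k) = -derivSymbol L k := by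
  simp [derivSymbol]

lemma fourierCoeff_of_hasWeakPartial {L : ℝ} (hL : 0 < L) {a b : ℕ} {f g : L2 L}
    (h : HasWeakPartial L a b f g) (ξ : ℤ × ℤ) :
    fourierCoeff L g ξ.1 ξ.2
      = derivSymbol L ξ.1 ^ a * derivSymbol L ξ.2 ^ b * fourierCoeff L f ξ.1 ξ.2 := by
  have hf : IntegrableOn f (square L) := (Lp.memLp f).integrable (by norm_num)
  have hg : IntegrableOn g (square L) := (Lp.memLp g).integrable (by norm_num)
  have hL0 : (L : ℂ) ≠ 0 := by exact_mod_cast hL.ne'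
  have hs : ∀ n : ℕ, ((-1 : ℂ) ^ n) * (-1) ^ n = 1 := fun n => by
    rw [← mul_pow]; norm_num
  rw [fourierCoeff_eq_fnCoeff, fourierCoeff_eq_fnCoeff]
  have key : (-1 : ℂ) ^ (a + b) * ((L : ℂ) ^ 2 * fnCoeff L g ξ)
      = derivSymbol L (-ξ.2) ^ b * derivSymbol L (-ξ.1) ^ a * ((L : ℂ) ^ 2 * fnCoeff L f ξ) := by
    refine eq_of_re_mul_eq fun z => ?_
    have h1 := h _ (isPeriodicTest_char hL (-ξ.1) (-ξ.2) z)
    simp only [partialDeriv_char] at h1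
    rw [integral_mul_re_char hL hf, integral_mul_re_char hL hg] at h1
    rw [← mul_assoc z, ← mul_assoc z, ← mul_assoc z, h1]
    have : ((-1 : ℝ) ^ (a + b) : ℝ) * (z * ((L : ℂ) ^ 2 * fnCoeff L g ξ)).re
        = (((-1 : ℝ) ^ (a + b) : ℝ) * (z * ((L : ℂ) ^ 2 * fnCoeff L g ξ)) : ℂ).re :=
      (Complex.re_ofReal_mul _ _).symm
    rw [this]; congr 1; push_cast; ring
  rw [derivSymbol_neg, derivSymbol_neg, neg_pow (derivSymbol L ξ.2),
    neg_pow (derivSymbol L ξ.1)] at key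
  have h3 := congrArg (fun x => (-1 : ℂ) ^ (a + b) * x) key
  simp only [← mul_assoc, hs, one_mul] at h3
  have e : (-1 : ℂ) ^ (a + b) * (-1) ^ b * derivSymbol L ξ.2 ^ b * (-1) ^ a * derivSymbol L ξ.1 ^ a
      = derivSymbol L ξ.1 ^ a * derivSymbol L ξ.2 ^ b := by
    rw [pow_add]; linear_combination (derivSymbol L ξ.1 ^ a * derivSymbol L ξ.2 ^ b)
      * ((-1 : ℂ) ^ b * (-1) ^ b * hs a + hs b)
  rw [e] at h3
  have hL2 : (L : ℂ) ^ 2 ≠ 0 := pow_ne_zero 2 hL0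
  refine mul_left_cancel₀ hL2 (h3.trans ?_)
  ring

/-- The symbol of the Laplacian. -/
def lapSymbol (L : ℝ) (ξ : ℤ × ℤ) : ℝ := -((2 * Real.pi / L) ^ 2 * ((ξ.1 : ℝ) ^ 2 + (ξ.2 : ℝ) ^ 2))

lemma derivSymbol_sq (L : ℝ) (k : ℤ) :
    derivSymbol L k ^ 2 = -(((2 * Real.pi / L) ^ 2 * (k : ℝ) ^ 2 : ℝ) : ℂ) := by
  have : derivSymbol L k = ((2 * Real.pi / L * k : ℝ) : ℂ) * Complex.I := by
    simp only [derivSymbol]; push_cast; ring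
  rw [this, mul_pow, Complex.I_sq]; push_cast; ring

lemma fnCoeff_of_hasWeakLaplacian {L : ℝ} (hL : 0 < L) {f g : ℝ × ℝ → ℝ}
    (h : HasWeakLaplacian L f g) (ξ : ℤ × ℤ) :
    fnCoeff L g ξ = (lapSymbol L ξ : ℂ) * fnCoeff L f ξ := by
  obtain ⟨hf, hg, h⟩ := h
  have hL0 : (L : ℂ) ≠ 0 := by exact_mod_cast hL.ne'
  have key : (L : ℂ) ^ 2 * fnCoeff L g ξ
      = (lapSymbol L ξ : ℂ) * ((L : ℂ) ^ 2 * fnCoeff L f ξ) := by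
    refine eq_of_re_mul_eq fun z => ?_
    have h1 := h _ (isPeriodicTest_char hL (-ξ.1) (-ξ.2) z)
    have h2 : ∀ p, partialDeriv 2 0 (fun p => (z * char L (-ξ.1) (-ξ.2) p).re) p
        + partialDeriv 0 2 (fun p => (z * char L (-ξ.1) (-ξ.2) p).re) p
        = (z * lapSymbol L ξ * char L (-ξ.1) (-ξ.2) p).re := by
      intro p
      rw [partialDeriv_char, partialDeriv_char, ← Complex.add_re]
      congr 1
      rw [derivSymbol_sq, derivSymbol_sq, lapSymbol]
      push_cast; ring
    simp only [h2] at h1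
    rw [integral_mul_re_char hL hf, integral_mul_re_char hL hg] at h1
    rw [← h1]; congr 1; ring
  refine mul_left_cancel₀ (pow_ne_zero 2 hL0) (key.trans ?_)
  ring

/-! ### Fourier description of the Sobolev norms -/

/-- The weight `1 + |ξ|²`. -/
def wt (ξ : ℤ × ℤ) : ℝ := 1 + (ξ.1 : ℝ) ^ 2 + (ξ.2 : ℝ) ^ 2

lemma one_le_wt (ξ : ℤ × ℤ) : 1 ≤ wt ξ := by
  unfold wt; nlinarith [sq_nonneg (ξ.1 : ℝ), sq_nonneg (ξ.2 : ℝ)]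

lemma wt_pos (ξ : ℤ × ℤ) : 0 < wt ξ := zero_lt_one.trans_le (one_le_wt ξ)

lemma norm_derivSymbol (L : ℝ) (hL : 0 < L) (k : ℤ) :
    ‖derivSymbol L k‖ ^ 2 = (2 * Real.pi / L) ^ 2 * (k : ℝ) ^ 2 := by
  rw [← norm_pow, derivSymbol_sq, norm_neg, Complex.norm_real, Real.norm_of_nonneg (by positivity)]

lemma sobolevNorm_sq (L : ℝ) (r : ℕ) (f : L2 L) : sobolevNorm L r f ^ 2
    = ∑ a ∈ Finset.range (r + 1), ∑ b ∈ Finset.range (r + 1 - a),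
      (⨅ g : L2 L, ⨅ _ : HasWeakPartial L a b f g, ‖g‖ₑ) ^ 2 := by
  rw [sobolevNorm, ← ENNReal.rpow_natCast, ← ENNReal.rpow_mul]
  norm_num

lemma sum_sq_derivSymbol_le {L : ℝ} (hL : 0 < L) {a b r : ℕ} (hab : a + b ≤ r) (f : L2 L)
    (S : Finset (ℤ × ℤ)) :
    ENNReal.ofReal (L ^ 2 * ∑ ξ ∈ S,
        ‖derivSymbol L ξ.1 ^ a * derivSymbol L ξ.2 ^ b * fourierCoeff L f ξ.1 ξ.2‖ ^ 2)
      ≤ sobolevNorm L r f ^ 2 := by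
  rw [sobolevNorm_sq]
  set X := L ^ 2 * ∑ ξ ∈ S,
        ‖derivSymbol L ξ.1 ^ a * derivSymbol L ξ.2 ^ b * fourierCoeff L f ξ.1 ξ.2‖ ^ 2
  have hX : 0 ≤ X := by positivity
  have h1 : ENNReal.ofReal X ≤ (⨅ g : L2 L, ⨅ _ : HasWeakPartial L a b f g, ‖g‖ₑ) ^ 2 := by
    rw [← Real.sq_sqrt hX, ENNReal.ofReal_pow (Real.sqrt_nonneg _)]
    refine pow_le_pow_left₀ (zero_le) (le_iInf₂ fun g hg => ?_) 2
    rw [← ofReal_norm]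
    refine ENNReal.ofReal_le_ofReal (Real.sqrt_le_iff.2 ⟨norm_nonneg _, ?_⟩)
    have h2 := sum_sq_fourierCoeff_le hL g S
    simp only [fourierCoeff_of_hasWeakPartial hL hg] at h2
    calc X ≤ L ^ 2 * (L⁻¹ ^ 2 * ‖g‖ ^ 2) := mul_le_mul_of_nonneg_left h2 (by positivity)
      _ = ‖g‖ ^ 2 := by field_simp
  refine h1.trans ?_
  refine le_trans ?_ (Finset.single_le_sum (f := fun a => ∑ b ∈ Finset.range (r + 1 - a),
      (⨅ g : L2 L, ⨅ _ : HasWeakPartial L a b f g, ‖g‖ₑ) ^ 2) (fun _ _ => zero_le)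
      (Finset.mem_range.2 (by omega : a < r + 1)))
  exact Finset.single_le_sum (f := fun b =>
      (⨅ g : L2 L, ⨅ _ : HasWeakPartial L a b f g, ‖g‖ₑ) ^ 2) (fun _ _ => zero_le)
      (Finset.mem_range.2 (by omega : b < r + 1 - a))

lemma wt_pow_le (r : ℕ) (ξ : ℤ × ℤ) :
    wt ξ ^ r ≤ 3 ^ r * (1 + ((ξ.1 : ℝ) ^ 2) ^ r + ((ξ.2 : ℝ) ^ 2) ^ r) := by
  have hx := sq_nonneg (ξ.1 : ℝ)
  have hy := sq_nonneg (ξ.2 : ℝ)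
  have hxr := pow_nonneg hx r
  have hyr := pow_nonneg hy r
  obtain ⟨m, hm0, h1, h2, h3, hm⟩ : ∃ m : ℝ, 0 ≤ m ∧ 1 ≤ m ∧ (ξ.1 : ℝ) ^ 2 ≤ m ∧ (ξ.2 : ℝ) ^ 2 ≤ m ∧
      m ^ r ≤ 1 + ((ξ.1 : ℝ) ^ 2) ^ r + ((ξ.2 : ℝ) ^ 2) ^ r := by
    refine ⟨max 1 (max ((ξ.1 : ℝ) ^ 2) ((ξ.2 : ℝ) ^ 2)), by positivity, le_max_left _ _,
      (le_max_left _ _).trans (le_max_right _ _), (le_max_right _ _).trans (le_max_right _ _), ?_⟩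
    rcases max_choice (1 : ℝ) (max ((ξ.1 : ℝ) ^ 2) ((ξ.2 : ℝ) ^ 2)) with h | h <;> rw [h]
    · rw [one_pow]; linarith
    · rcases max_choice ((ξ.1 : ℝ) ^ 2) ((ξ.2 : ℝ) ^ 2) with h | h <;> rw [h] <;> linarith
  calc wt ξ ^ r ≤ (3 * m) ^ r := pow_le_pow_left₀ (wt_pos ξ).le (by unfold wt; linarith) r
    _ = 3 ^ r * m ^ r := mul_pow _ _ _
    _ ≤ _ := by gcongr

/-- The constant in the Fourier description of the Sobolev norm. -/
def sobConst (L : ℝ) (r : ℕ) : ℝ := L⁻¹ ^ 2 * (3 ^ r * (1 + 2 * ((L / (2 * Real.pi)) ^ 2) ^ r))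

lemma sobConst_pos {L : ℝ} (hL : 0 < L) (r : ℕ) : 0 < sobConst L r := by
  unfold sobConst; positivity

lemma sum_wt_le {L : ℝ} (hL : 0 < L) (r : ℕ) (f : L2 L) (S : Finset (ℤ × ℤ)) :
    ENNReal.ofReal (∑ ξ ∈ S, wt ξ ^ r * ‖fourierCoeff L f ξ.1 ξ.2‖ ^ 2)
      ≤ ENNReal.ofReal (sobConst L r) * sobolevNorm L r f ^ 2 := by
  rcases eq_or_ne (sobolevNorm L r f ^ 2) ⊤ with htop | htop
  · rw [htop, ENNReal.mul_top (by simpa using sobConst_pos hL r)]; exact le_top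
  have h0 := sum_sq_derivSymbol_le hL (a := 0) (b := 0) (r := r) (by omega) f S
  have h1 := sum_sq_derivSymbol_le hL (a := r) (b := 0) (r := r) (by omega) f S
  have h2 := sum_sq_derivSymbol_le hL (a := 0) (b := r) (r := r) (by omega) f S
  rw [← ENNReal.ofReal_toReal htop, ← ENNReal.ofReal_mul (sobConst_pos hL r).le]
  rw [ENNReal.ofReal_le_iff_le_toReal htop] at h0 h1 h2
  set Y := (sobolevNorm L r f ^ 2).toReal
  refine ENNReal.ofReal_le_ofReal ?_
  simp only [pow_zero, one_mul, mul_one, norm_mul, mul_pow, norm_pow, ← pow_mul] at h0 h1 h2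
  simp only [mul_comm r 2, pow_mul, norm_derivSymbol L hL, mul_pow _ _ r] at h1 h2
  have hc : 0 < ((2 * Real.pi / L) ^ 2) ^ r := by positivity
  have hinv : ((L / (2 * Real.pi)) ^ 2) ^ r * ((2 * Real.pi / L) ^ 2) ^ r = 1 := by
    rw [← mul_pow, ← mul_pow]
    have : L / (2 * Real.pi) * (2 * Real.pi / L) = 1 := by
      have := Real.pi_ne_zero; field_simp
    rw [this]; simp
  simp only [mul_assoc, ← Finset.mul_sum] at h1 h2
  set X0 := ∑ ξ ∈ S, ‖fourierCoeff L f ξ.1 ξ.2‖ ^ 2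
  set X1 := ∑ ξ ∈ S, ((ξ.1 : ℝ) ^ 2) ^ r * ‖fourierCoeff L f ξ.1 ξ.2‖ ^ 2
  set X2 := ∑ ξ ∈ S, ((ξ.2 : ℝ) ^ 2) ^ r * ‖fourierCoeff L f ξ.1 ξ.2‖ ^ 2
  have e : ∑ ξ ∈ S, wt ξ ^ r * ‖fourierCoeff L f ξ.1 ξ.2‖ ^ 2 ≤ 3 ^ r * (X0 + X1 + X2) := by
    simp only [X0, X1, X2, ← Finset.sum_add_distrib, Finset.mul_sum]
    refine Finset.sum_le_sum fun ξ _ => ?_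
    refine (mul_le_mul_of_nonneg_right (wt_pow_le r ξ) (by positivity)).trans (le_of_eq ?_)
    ring
  refine e.trans ?_
  have hLi : L⁻¹ ^ 2 * L ^ 2 = 1 := by field_simp
  have b0 : X0 ≤ L⁻¹ ^ 2 * Y := by
    have := mul_le_mul_of_nonneg_left h0 (by positivity : 0 ≤ L⁻¹ ^ 2)
    rwa [← mul_assoc, hLi, one_mul] at this
  set d := ((L / (2 * Real.pi)) ^ 2) ^ r
  have hd : 0 ≤ d := by positivity
  have b : ∀ X, L ^ 2 * (((2 * Real.pi / L) ^ 2) ^ r * X) ≤ Y → X ≤ L⁻¹ ^ 2 * d * Y := by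
    intro X hX
    have := mul_le_mul_of_nonneg_left hX (by positivity : 0 ≤ L⁻¹ ^ 2 * d)
    refine le_trans (le_of_eq ?_) this
    linear_combination (-X) * (hLi * (d * ((2 * Real.pi / L) ^ 2) ^ r) + hinv)
  have b1 := b X1 h1
  have b2 := b X2 h2
  calc 3 ^ r * (X0 + X1 + X2) ≤ 3 ^ r * (L⁻¹ ^ 2 * Y + L⁻¹ ^ 2 * d * Y + L⁻¹ ^ 2 * d * Y) := by gcongr
    _ = sobConst L r * Y := by simp only [sobConst, d]; ring

lemma sobolevNorm_mono (L : ℝ) {r r' : ℕ} (h : r ≤ r') (f : L2 L) :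
    sobolevNorm L r f ≤ sobolevNorm L r' f := by
  refine ENNReal.rpow_le_rpow ?_ (by norm_num)
  refine (Finset.sum_le_sum fun a _ => Finset.sum_le_sum_of_subset
    (Finset.range_mono (by omega : r + 1 - a ≤ r' + 1 - a))).trans ?_
  exact Finset.sum_le_sum_of_subset (Finset.range_mono (by omega))

lemma bochnerSobolevNorm_mono (L T : ℝ) (m : ℕ) (p : ℝ≥0∞) {r r' : ℕ} (h : r ≤ r')
    (u : ℝ → L2 L) : bochnerSobolevNorm L T m p r u ≤ bochnerSobolevNorm L T m p r' u := by
  refine Finset.sum_le_sum fun j _ => iInf₂_mono fun v _ => ?_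
  exact eLpNorm_mono_enorm fun t => sobolevNorm_mono L h (v t)

/-! ### Trigonometric polynomials and the discrete Laplacian -/

/-- The trigonometric polynomial with coefficients `c i` at the frequencies `φ i`. -/
def trig {ι : Type*} (L : ℝ) (s : Finset ι) (φ : ι → ℤ × ℤ) (c : ι → ℂ) (p : ℝ × ℝ) : ℂ :=
  ∑ i ∈ s, c i * char L (φ i).1 (φ i).2 p

/-- The symbol of the discrete Laplacian. -/
def dlapSymbol (L h : ℝ) (ξ : ℤ × ℤ) : ℝ :=
  (2 * Real.cos (2 * Real.pi / L * (ξ.1 * h)) + 2 * Real.cos (2 * Real.pi / L * (ξ.2 * h)) - 4)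
    / h ^ 2

lemma char_axis_left (L h : ℝ) (k l : ℤ) :
    char L k l (h, 0) + char L k l (-h, 0) = 2 * (Real.cos (2 * Real.pi / L * (k * h)) : ℂ) := by
  rw [char_eq_exp_ofReal, char_eq_exp_ofReal, Complex.ofReal_cos, Complex.two_cos]
  congr 1 <;> congr 1 <;> push_cast <;> ring

lemma char_axis_right (L h : ℝ) (k l : ℤ) :
    char L k l (0, h) + char L k l (0, -h) = 2 * (Real.cos (2 * Real.pi / L * (l * h)) : ℂ) := by
  rw [char_eq_exp_ofReal, char_eq_exp_ofReal, Complex.ofReal_cos, Complex.two_cos]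
  congr 1 <;> congr 1 <;> push_cast <;> ring

lemma discreteLaplacian_char (L h : ℝ) (k l : ℤ) (p : ℝ × ℝ) :
    discreteLaplacian h (char L k l) p = (dlapSymbol L h (k, l) : ℂ) * char L k l p := by
  have e1 := char_translate L k l p.1 p.2 h 0
  have e2 := char_translate L k l p.1 p.2 (-h) 0
  have e3 := char_translate L k l p.1 p.2 0 h
  have e4 := char_translate L k l p.1 p.2 0 (-h)
  simp only [add_zero, ← sub_eq_add_neg] at e1 e2 e3 e4
  have a1 := char_axis_left L h k l
  have a2 := char_axis_right L h k l
  rw [discreteLaplacian, e1, e2, e3, e4, dlapSymbol]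
  push_cast at a1 a2 ⊢
  rw [← a1, ← a2]
  ring

lemma discreteLaplacian_trig {ι : Type*} (L h : ℝ) (s : Finset ι) (φ : ι → ℤ × ℤ) (c : ι → ℂ) :
    discreteLaplacian h (trig L s φ c) = trig L s φ fun i => (dlapSymbol L h (φ i) : ℂ) * c i := by
  ext p
  have h1 : discreteLaplacian h (trig L s φ c) p
      = ∑ i ∈ s, c i * discreteLaplacian h (char L (φ i).1 (φ i).2) p := by
    simp only [discreteLaplacian, trig, Finset.mul_sum, ← Finset.sum_add_distrib,
      ← Finset.sum_sub_distrib, Finset.sum_div]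
    refine Finset.sum_congr rfl fun i _ => ?_
    ring
  rw [h1, trig]
  refine Finset.sum_congr rfl fun i _ => ?_
  rw [discreteLaplacian_char]
  ring

lemma trig_add {ι : Type*} (L : ℝ) (s : Finset ι) (φ : ι → ℤ × ℤ) (c d : ι → ℂ) :
    trig L s φ c + trig L s φ d = trig L s φ (fun i => c i + d i) := by
  ext p; simp only [Pi.add_apply, trig, ← Finset.sum_add_distrib, add_mul]

lemma trig_sub {ι : Type*} (L : ℝ) (s : Finset ι) (φ : ι → ℤ × ℤ) (c d : ι → ℂ) :
    trig L s φ c - trig L s φ d = trig L s φ (fun i => c i - d i) := by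
  ext p; simp only [Pi.sub_apply, trig, ← Finset.sum_sub_distrib, sub_mul]

lemma smul_trig {ι : Type*} (L : ℝ) (s : Finset ι) (φ : ι → ℤ × ℤ) (z : ℂ) (c : ι → ℂ) :
    z • trig L s φ c = trig L s φ (fun i => z * c i) := by
  ext p; simp only [Pi.smul_apply, trig, smul_eq_mul, Finset.mul_sum, mul_assoc]

lemma discreteLaplacian_add (h : ℝ) (f g : ℝ × ℝ → ℂ) :
    discreteLaplacian h (f + g) = discreteLaplacian h f + discreteLaplacian h g := by
  ext p; simp only [discreteLaplacian, Pi.add_apply]; ring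

lemma discreteLaplacian_smul (h : ℝ) (z : ℂ) (f : ℝ × ℝ → ℂ) :
    discreteLaplacian h (z • f) = z • discreteLaplacian h f := by
  ext p; simp only [discreteLaplacian, Pi.smul_apply, smul_eq_mul]; ring

/-- Sum of three frequencies. -/
def sum3 (τ : (ℤ × ℤ) × (ℤ × ℤ) × (ℤ × ℤ)) : ℤ × ℤ := τ.1 + (τ.2.1 + τ.2.2)

lemma char_add' (L : ℝ) (ξ η : ℤ × ℤ) (p : ℝ × ℝ) :
    char L (ξ + η).1 (ξ + η).2 p = char L ξ.1 ξ.2 p * char L η.1 η.2 p := char_add ..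

lemma trig_mul_mul (L : ℝ) (S : Finset (ℤ × ℤ)) (x y z : ℤ × ℤ → ℂ) (p : ℝ × ℝ) :
    trig L S id x p * (trig L S id y p * trig L S id z p)
      = trig L (S ×ˢ S ×ˢ S) sum3 (fun τ => x τ.1 * (y τ.2.1 * z τ.2.2)) p := by
  simp only [trig, Finset.sum_product, Finset.sum_mul_sum, id]
  refine Finset.sum_congr rfl fun ξ _ => ?_
  refine Finset.sum_congr rfl fun η _ => ?_
  rw [Finset.mul_sum]
  refine Finset.sum_congr rfl fun ζ _ => ?_
  rw [sum3, char_add', char_add']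
  ring

/-! ### Symbol estimates -/

lemma abs_cos_taylor (x : ℝ) : |Real.cos x - 1 + x ^ 2 / 2| ≤ x ^ 4 / 2 := by
  rcases le_or_gt |x| 1 with hx | hx
  · have := Real.cos_bound hx
    rw [show Real.cos x - 1 + x ^ 2 / 2 = Real.cos x - (1 - x ^ 2 / 2) by ring]
    have h4 : |x| ^ 4 = x ^ 4 := by rw [← abs_pow, abs_of_nonneg (by positivity)]
    rw [h4] at this
    nlinarith [(by positivity : 0 ≤ x ^ 4)]
  · have h1 := Real.one_sub_sq_div_two_le_cos (x := x)
    have h2 := Real.cos_le_one x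
    have h3 : 1 ≤ x ^ 2 := by rw [← sq_abs]; nlinarith
    rw [abs_of_nonneg (by linarith)]
    nlinarith

lemma abs_lapSymbol_le (L : ℝ) (ξ : ℤ × ℤ) : |lapSymbol L ξ| ≤ (2 * Real.pi / L) ^ 2 * wt ξ := by
  rw [lapSymbol, abs_neg, abs_of_nonneg (by positivity), wt]
  gcongr
  linarith

lemma abs_dlapSymbol_le_lapSymbol {h : ℝ} (hh : 0 < h) (L : ℝ) (ξ : ℤ × ℤ) :
    |dlapSymbol L h ξ| ≤ |lapSymbol L ξ| := by
  rw [dlapSymbol, lapSymbol, abs_neg, abs_div, abs_of_nonneg (by positivity : 0 ≤ h ^ 2),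
    abs_of_nonneg (by positivity : 0 ≤ (2 * Real.pi / L) ^ 2 * ((ξ.1 : ℝ) ^ 2 + (ξ.2 : ℝ) ^ 2)),
    div_le_iff₀ (by positivity)]
  have a1 := Real.one_sub_sq_div_two_le_cos (x := 2 * Real.pi / L * (ξ.1 * h))
  have a2 := Real.one_sub_sq_div_two_le_cos (x := 2 * Real.pi / L * (ξ.2 * h))
  have b1 := Real.cos_le_one (2 * Real.pi / L * (ξ.1 * h))
  have b2 := Real.cos_le_one (2 * Real.pi / L * (ξ.2 * h))
  rw [abs_of_nonpos (by linarith)]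
  nlinarith

lemma abs_dlapSymbol_le {h : ℝ} (hh : 0 < h) (L : ℝ) (ξ : ℤ × ℤ) :
    |dlapSymbol L h ξ| ≤ (2 * Real.pi / L) ^ 2 * wt ξ :=
  (abs_dlapSymbol_le_lapSymbol hh L ξ).trans (abs_lapSymbol_le L ξ)

lemma abs_dlapSymbol_sub_le {h : ℝ} (hh : 0 < h) (L : ℝ) (ξ : ℤ × ℤ) :
    |dlapSymbol L h ξ - lapSymbol L ξ| ≤ (2 * Real.pi / L) ^ 4 * h ^ 2 * wt ξ ^ 2 := by
  have a1 := abs_cos_taylor (2 * Real.pi / L * (ξ.1 * h))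
  have a2 := abs_cos_taylor (2 * Real.pi / L * (ξ.2 * h))
  have key : dlapSymbol L h ξ - lapSymbol L ξ = (2 * (Real.cos (2 * Real.pi / L * (ξ.1 * h)) - 1
      + (2 * Real.pi / L * (ξ.1 * h)) ^ 2 / 2) + 2 * (Real.cos (2 * Real.pi / L * (ξ.2 * h)) - 1
      + (2 * Real.pi / L * (ξ.2 * h)) ^ 2 / 2)) / h ^ 2 := by
    rw [dlapSymbol, lapSymbol]; field_simp; ring
  rw [key, abs_div, abs_of_nonneg (by positivity : 0 ≤ h ^ 2), div_le_iff₀ (by positivity)]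
  refine (abs_add_le _ _).trans ?_
  rw [abs_mul, abs_mul, abs_two]
  have hw : (ξ.1 : ℝ) ^ 4 + (ξ.2 : ℝ) ^ 4 ≤ wt ξ ^ 2 := by
    unfold wt; nlinarith [sq_nonneg (ξ.1 : ℝ), sq_nonneg (ξ.2 : ℝ),
      mul_nonneg (sq_nonneg (ξ.1 : ℝ)) (sq_nonneg (ξ.2 : ℝ))]
  calc _ ≤ 2 * ((2 * Real.pi / L * (ξ.1 * h)) ^ 4 / 2) + 2 * ((2 * Real.pi / L * (ξ.2 * h)) ^ 4 / 2) := by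
        gcongr
    _ = (2 * Real.pi / L) ^ 4 * h ^ 4 * ((ξ.1 : ℝ) ^ 4 + (ξ.2 : ℝ) ^ 4) := by ring
    _ ≤ (2 * Real.pi / L) ^ 4 * h ^ 4 * wt ξ ^ 2 := by gcongr
    _ = _ := by ring

lemma abs_dlapSymbol_pow_two_sub_le {h : ℝ} (hh : 0 < h) (L : ℝ) (ξ : ℤ × ℤ) :
    |dlapSymbol L h ξ ^ 2 - lapSymbol L ξ ^ 2|
      ≤ 2 * (2 * Real.pi / L) ^ 6 * h ^ 2 * wt ξ ^ 3 := by
  have e0 := abs_dlapSymbol_sub_le hh L ξ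
  have e1 := abs_dlapSymbol_le hh L ξ
  have e2 := abs_lapSymbol_le L ξ
  have hw := wt_pos ξ
  rw [show dlapSymbol L h ξ ^ 2 - lapSymbol L ξ ^ 2
    = (dlapSymbol L h ξ - lapSymbol L ξ) * (dlapSymbol L h ξ + lapSymbol L ξ) by ring, abs_mul]
  calc _ ≤ ((2 * Real.pi / L) ^ 4 * h ^ 2 * wt ξ ^ 2)
        * ((2 * Real.pi / L) ^ 2 * wt ξ + (2 * Real.pi / L) ^ 2 * wt ξ) := by
        gcongr
        exact (abs_add_le _ _).trans (add_le_add e1 e2)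
    _ = _ := by ring

lemma abs_dlapSymbol_pow_three_sub_le {h : ℝ} (hh : 0 < h) (L : ℝ) (ξ : ℤ × ℤ) :
    |dlapSymbol L h ξ ^ 3 - lapSymbol L ξ ^ 3|
      ≤ 3 * (2 * Real.pi / L) ^ 8 * h ^ 2 * wt ξ ^ 4 := by
  have e0 := abs_dlapSymbol_sub_le hh L ξ
  have e1 := abs_dlapSymbol_le hh L ξ
  have e2 := abs_lapSymbol_le L ξ
  have hw := wt_pos ξ
  rw [show dlapSymbol L h ξ ^ 3 - lapSymbol L ξ ^ 3 = (dlapSymbol L h ξ - lapSymbol L ξ)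
    * (dlapSymbol L h ξ * dlapSymbol L h ξ + dlapSymbol L h ξ * lapSymbol L ξ
      + lapSymbol L ξ * lapSymbol L ξ) by ring, abs_mul]
  set M := (2 * Real.pi / L) ^ 2 * wt ξ
  have hM : 0 ≤ M := (abs_nonneg _).trans e1
  calc _ ≤ ((2 * Real.pi / L) ^ 4 * h ^ 2 * wt ξ ^ 2) * (M * M + M * M + M * M) := by
        gcongr
        refine (abs_add_le _ _).trans (add_le_add ((abs_add_le _ _).trans (add_le_add ?_ ?_)) ?_)
        all_goals rw [abs_mul]; gcongr
    _ = _ := by simp only [M]; ring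

lemma wt_sum3_le (τ : (ℤ × ℤ) × (ℤ × ℤ) × (ℤ × ℤ)) :
    wt (sum3 τ) ≤ 3 * (wt τ.1 + wt τ.2.1 + wt τ.2.2) := by
  have tri : ∀ a b c : ℝ, (a + (b + c)) ^ 2 ≤ 3 * (a ^ 2 + b ^ 2 + c ^ 2) := by
    intro a b c
    nlinarith [sq_nonneg (a - b), sq_nonneg (b - c), sq_nonneg (a - c)]
  simp only [wt, sum3, Prod.fst_add, Prod.snd_add, Int.cast_add]
  linarith [tri τ.1.1 τ.2.1.1 τ.2.2.1, tri τ.1.2 τ.2.1.2 τ.2.2.2]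

lemma wt_sum3_sq_le (τ : (ℤ × ℤ) × (ℤ × ℤ) × (ℤ × ℤ)) :
    wt (sum3 τ) ^ 2 ≤ 27 * (wt τ.1 ^ 2 + wt τ.2.1 ^ 2 + wt τ.2.2 ^ 2) := by
  have h := pow_le_pow_left₀ (wt_pos _).le (wt_sum3_le τ) 2
  nlinarith [sq_nonneg (wt τ.1 - wt τ.2.1), sq_nonneg (wt τ.2.1 - wt τ.2.2),
    sq_nonneg (wt τ.1 - wt τ.2.2)]

/-! ### The discrete norm of a trigonometric polynomial -/

/-- The grid sum of a character. -/
def gridSum (L h : ℝ) (N : ℕ) (ξ : ℤ × ℤ) : ℂ :=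
  ∑ i ∈ Finset.range N, ∑ j ∈ Finset.range N, char L ξ.1 ξ.2 (i * h, j * h)

lemma sum_exp_range {N : ℕ} (hN : 0 < N) (k : ℤ) :
    ∑ i ∈ Finset.range N, Complex.exp (2 * Real.pi * Complex.I * (k / N)) ^ i
      = if (N : ℤ) ∣ k then (N : ℂ) else 0 := by
  have hN0 : (N : ℂ) ≠ 0 := by exact_mod_cast hN.ne'
  have hpi := Complex.two_pi_I_ne_zero
  have hone : Complex.exp (2 * Real.pi * Complex.I * (k / N)) = 1 ↔ (N : ℤ) ∣ k := by
    rw [Complex.exp_eq_one_iff]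
    constructor
    · rintro ⟨n, hn⟩
      refine ⟨n, ?_⟩
      rw [mul_comm (n : ℂ)] at hn
      have := mul_left_cancel₀ hpi hn
      rw [div_eq_iff hN0] at this
      have h2 : (k : ℂ) = ((N * n : ℤ) : ℂ) := by rw [this]; push_cast; ring
      exact_mod_cast h2
    · rintro ⟨n, hn⟩
      refine ⟨n, ?_⟩
      rw [hn]; push_cast; field_simp
  split_ifs with h
  · rw [hone.2 h]; simp
  · have h1 := mul_neg_geom_sum (Complex.exp (2 * Real.pi * Complex.I * (k / N))) N
    have h2 : Complex.exp (2 * Real.pi * Complex.I * (k / N)) ^ N = 1 := by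
      rw [← Complex.exp_nat_mul, Complex.exp_eq_one_iff]
      exact ⟨k, by field_simp⟩
    rw [h2, sub_self, mul_eq_zero] at h1
    rcases h1 with h1 | h1
    · exact absurd (hone.1 (sub_eq_zero.1 h1).symm) h
    · exact h1

lemma gridSum_eq {L : ℝ} (hL : 0 < L) {N : ℕ} (hN : 0 < N) (ξ : ℤ × ℤ) :
    gridSum L (L / N) N ξ = (((if (N : ℤ) ∣ ξ.1 ∧ (N : ℤ) ∣ ξ.2 then (N : ℝ) ^ 2 else 0 : ℝ)) : ℂ) := by
  have hN0 : (N : ℂ) ≠ 0 := by exact_mod_cast hN.ne'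
  have hL0 : (L : ℂ) ≠ 0 := by exact_mod_cast hL.ne'
  have h : ∀ i j : ℕ, char L ξ.1 ξ.2 (i * (L / N), j * (L / N))
      = Complex.exp (2 * Real.pi * Complex.I * (ξ.1 / N)) ^ i
        * Complex.exp (2 * Real.pi * Complex.I * (ξ.2 / N)) ^ j := by
    intro i j
    rw [← Complex.exp_nat_mul, ← Complex.exp_nat_mul, ← Complex.exp_add, char]
    congr 1; push_cast; field_simp
  simp only [gridSum, h, ← Finset.mul_sum, ← Finset.sum_mul, sum_exp_range hN]
  by_cases h1 : (N : ℤ) ∣ ξ.1 <;> by_cases h2 : (N : ℤ) ∣ ξ.2 <;> simp [h1, h2, sq]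

lemma gridNorm_sq (h : ℝ) (N : ℕ) (o : ℝ × ℝ) (g : ℝ × ℝ → ℂ) :
    gridNorm h N o g ^ 2 = h ^ 2 * ∑ i ∈ Finset.range N, ∑ j ∈ Finset.range N,
      ‖g (o.1 + i * h, o.2 + j * h)‖ ^ 2 :=
  Real.sq_sqrt (by positivity)

lemma norm_sq_trig {ι : Type*} (L : ℝ) (s : Finset ι) (φ : ι → ℤ × ℤ) (c : ι → ℂ) (p : ℝ × ℝ) :
    ((‖trig L s φ c p‖ ^ 2 : ℝ) : ℂ) = ∑ i ∈ s, ∑ j ∈ s, c i * (starRingEnd ℂ) (c j)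
      * char L (φ i - φ j).1 (φ i - φ j).2 p := by
  push_cast
  rw [← Complex.mul_conj', trig, map_sum, Finset.sum_mul_sum]
  refine Finset.sum_congr rfl fun i _ => Finset.sum_congr rfl fun j _ => ?_
  rw [map_mul, conj_char, sub_eq_add_neg, char_add']
  simp only [Prod.fst_neg, Prod.snd_neg]
  ring

lemma gridNorm_trig_sq {ι : Type*} (L h : ℝ) (N : ℕ) (o : ℝ × ℝ) (s : Finset ι) (φ : ι → ℤ × ℤ)
    (c : ι → ℂ) :
    ((gridNorm h N o (trig L s φ c) ^ 2 : ℝ) : ℂ)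
      = (h : ℂ) ^ 2 * ∑ i ∈ s, ∑ j ∈ s, c i * (starRingEnd ℂ) (c j)
        * char L (φ i - φ j).1 (φ i - φ j).2 o * gridSum L h N (φ i - φ j) := by
  rw [gridNorm_sq]
  simp only [Complex.ofReal_mul, Complex.ofReal_sum, Complex.ofReal_pow]
  congr 1
  have : ∀ (ξ : ℤ × ℤ) (a b : ℕ), char L ξ.1 ξ.2 (o.1 + a * h, o.2 + b * h)
      = char L ξ.1 ξ.2 o * char L ξ.1 ξ.2 (a * h, b * h) := fun ξ a b => char_translate ..
  simp only [gridSum, Finset.mul_sum]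
  have e := norm_sq_trig L s φ c
  simp only [Complex.ofReal_pow] at e
  simp only [e, this]
  calc _ = ∑ a ∈ Finset.range N, ∑ i ∈ s, ∑ b ∈ Finset.range N, ∑ j ∈ s, _ :=
        Finset.sum_congr rfl fun a _ => Finset.sum_comm
    _ = _ := by
        rw [Finset.sum_comm]
        refine Finset.sum_congr rfl fun i _ => ?_
        rw [Finset.sum_congr rfl fun a _ => Finset.sum_comm, Finset.sum_comm]
        refine Finset.sum_congr rfl fun j _ => Finset.sum_congr rfl fun a _ =>
          Finset.sum_congr rfl fun b _ => ?_
        ring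

/-- The discrete norm of a trigonometric polynomial is at most that, on the vertex-centered grid,
of one whose coefficients dominate. -/
lemma gridNorm_trig_le {ι : Type*} {L : ℝ} (hL : 0 < L) {N : ℕ} (hN : 0 < N) (o : ℝ × ℝ)
    (s : Finset ι) (φ : ι → ℤ × ℤ) (c : ι → ℂ) (d : ι → ℝ) (hcd : ∀ i ∈ s, ‖c i‖ ≤ d i) :
    gridNorm (L / N) N o (trig L s φ c) ^ 2
      ≤ gridNorm (L / N) N 0 (trig L s φ fun i => (d i : ℂ)) ^ 2 := by
  set G : ℤ × ℤ → ℝ := fun ξ => if (N : ℤ) ∣ ξ.1 ∧ (N : ℤ) ∣ ξ.2 then (N : ℝ) ^ 2 else 0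
  have hG : ∀ ξ, 0 ≤ G ξ := fun ξ => by simp only [G]; split_ifs <;> positivity
  have h1 := gridNorm_trig_sq L (L / N) N o s φ c
  have h2 := gridNorm_trig_sq L (L / N) N 0 s φ fun i => (d i : ℂ)
  simp only [gridSum_eq hL hN] at h1 h2
  change _ = _ * ∑ i ∈ s, ∑ j ∈ s, _ * ((G (φ i - φ j) : ℝ) : ℂ) at h1 h2
  have h0 : ∀ k l, char L k l 0 = 1 := fun k l => by simp [char]
  simp only [h0, mul_one, Complex.conj_ofReal] at h2
  have h2' : gridNorm (L / N) N 0 (trig L s φ fun i => (d i : ℂ)) ^ 2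
      = (L / N) ^ 2 * ∑ i ∈ s, ∑ j ∈ s, d i * d j * G (φ i - φ j) := by exact_mod_cast h2
  rw [h2']
  have h3 : gridNorm (L / N) N o (trig L s φ c) ^ 2
      = ‖((gridNorm (L / N) N o (trig L s φ c) ^ 2 : ℝ) : ℂ)‖ := by
    rw [Complex.norm_real, Real.norm_of_nonneg (by positivity)]
  rw [h3, h1, norm_mul, norm_pow, Complex.norm_real, Real.norm_of_nonneg (by positivity)]
  refine mul_le_mul_of_nonneg_left ?_ (by positivity)
  refine (norm_sum_le _ _).trans (Finset.sum_le_sum fun i hi => ?_)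
  refine (norm_sum_le _ _).trans (Finset.sum_le_sum fun j hj => ?_)
  rw [norm_mul, norm_mul, norm_mul, norm_char, mul_one, Complex.norm_real,
    Real.norm_of_nonneg (hG _), RCLike.norm_conj]
  have := hcd i hi
  have := hcd j hj
  have := hG (φ i - φ j)
  have := (norm_nonneg _).trans (hcd i hi)
  gcongr

/-- Frequencies that are pairwise distinct on the grid. -/
def Separated (N : ℕ) (S : Finset (ℤ × ℤ)) : Prop :=
  ∀ ξ ∈ S, ∀ η ∈ S, (N : ℤ) ∣ (ξ - η).1 → (N : ℤ) ∣ (ξ - η).2 → ξ = η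

/-- Discrete Parseval identity. -/
lemma gridNorm_trig_id_sq {L : ℝ} (hL : 0 < L) {N : ℕ} (hN : 0 < N) (o : ℝ × ℝ)
    {S : Finset (ℤ × ℤ)} (hS : Separated N S) (c : ℤ × ℤ → ℂ) :
    gridNorm (L / N) N o (trig L S id c) ^ 2 = L ^ 2 * ∑ ξ ∈ S, ‖c ξ‖ ^ 2 := by
  have h1 := gridNorm_trig_sq L (L / N) N o S id c
  simp only [gridSum_eq hL hN, id] at h1
  have h2 : ∀ ξ ∈ S, ∑ η ∈ S, c ξ * (starRingEnd ℂ) (c η) * char L (ξ - η).1 (ξ - η).2 o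
      * (((if (N : ℤ) ∣ (ξ - η).1 ∧ (N : ℤ) ∣ (ξ - η).2 then (N : ℝ) ^ 2 else 0 : ℝ)) : ℂ)
      = (N : ℂ) ^ 2 * (‖c ξ‖ : ℂ) ^ 2 := by
    intro ξ hξ
    rw [Finset.sum_eq_single ξ]
    · rw [sub_self, Prod.fst_zero, Prod.snd_zero, char_zero, ← Complex.mul_conj']
      simp; ring
    · intro η hη hne
      rw [if_neg]
      · simp
      · rintro ⟨a, b⟩; exact hne (hS ξ hξ η hη a b).symm
    · exact fun h => absurd hξ h
  rw [Finset.sum_congr rfl h2, ← Finset.mul_sum] at h1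
  have hN0 : (N : ℂ) ≠ 0 := by exact_mod_cast hN.ne'
  have h3 : ((gridNorm (L / N) N o (trig L S id c) ^ 2 : ℝ) : ℂ)
      = ((L ^ 2 * ∑ ξ ∈ S, ‖c ξ‖ ^ 2 : ℝ) : ℂ) := by
    rw [h1]; push_cast; field_simp
  exact_mod_cast h3

lemma gridNorm_congr_le {h : ℝ} {N : ℕ} {o : ℝ × ℝ} {f g : ℝ × ℝ → ℂ} {K : ℝ}
    (hfg : ∀ p, ‖f p‖ ^ 2 ≤ K * ‖g p‖ ^ 2) :
    gridNorm h N o f ^ 2 ≤ K * gridNorm h N o g ^ 2 := by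
  rw [gridNorm_sq, gridNorm_sq, mul_left_comm]
  refine mul_le_mul_of_nonneg_left ?_ (sq_nonneg h)
  rw [Finset.mul_sum]
  refine Finset.sum_le_sum fun i _ => ?_
  rw [Finset.mul_sum]
  exact Finset.sum_le_sum fun j _ => hfg _

lemma gridNorm_add_sq_le (h : ℝ) (N : ℕ) (o : ℝ × ℝ) (f g : ℝ × ℝ → ℂ) :
    gridNorm h N o (f + g) ^ 2 ≤ 2 * gridNorm h N o f ^ 2 + 2 * gridNorm h N o g ^ 2 := by
  simp only [gridNorm_sq]
  rw [mul_left_comm, mul_left_comm 2, ← mul_add]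
  refine mul_le_mul_of_nonneg_left ?_ (by positivity)
  rw [Finset.mul_sum, Finset.mul_sum, ← Finset.sum_add_distrib]
  refine Finset.sum_le_sum fun i _ => ?_
  rw [Finset.mul_sum, Finset.mul_sum, ← Finset.sum_add_distrib]
  refine Finset.sum_le_sum fun j _ => ?_
  refine (pow_le_pow_left₀ (norm_nonneg _) (norm_add_le _ _) 2).trans ?_
  nlinarith [sq_nonneg (‖f (o.1 + i * h, o.2 + j * h)‖ - ‖g (o.1 + i * h, o.2 + j * h)‖)]

lemma gridNorm_smul_sq (h : ℝ) (N : ℕ) (o : ℝ × ℝ) (z : ℂ) (f : ℝ × ℝ → ℂ) :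
    gridNorm h N o (z • f) ^ 2 = ‖z‖ ^ 2 * gridNorm h N o f ^ 2 := by
  simp only [gridNorm_sq, Pi.smul_apply, smul_eq_mul, norm_mul, mul_pow, ← Finset.mul_sum]
  ring

lemma norm_trig_le {ι : Type*} (L : ℝ) (s : Finset ι) (φ : ι → ℤ × ℤ) (c : ι → ℂ) (p : ℝ × ℝ) :
    ‖trig L s φ c p‖ ≤ ∑ i ∈ s, ‖c i‖ := by
  refine (norm_sum_le _ _).trans (Finset.sum_le_sum fun i _ => ?_)
  rw [norm_mul, norm_char, mul_one]

/-- The discrete norm of a product of three trigonometric polynomials. -/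
lemma gridNorm_mul_mul_sq_le {L : ℝ} (hL : 0 < L) {N : ℕ} (hN : 0 < N) (o : ℝ × ℝ)
    {S : Finset (ℤ × ℤ)} (hS : Separated N S) (x y z : ℤ × ℤ → ℂ) :
    gridNorm (L / N) N o (fun p => trig L S id x p * (trig L S id y p * trig L S id z p)) ^ 2
      ≤ (∑ ξ ∈ S, ‖y ξ‖) ^ 2 * (∑ ξ ∈ S, ‖z ξ‖) ^ 2 * (L ^ 2 * ∑ ξ ∈ S, ‖x ξ‖ ^ 2) := by
  rw [← gridNorm_trig_id_sq hL hN o hS x]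
  refine gridNorm_congr_le fun p => ?_
  rw [norm_mul, norm_mul, mul_pow, mul_pow, mul_comm]
  have h1 := norm_trig_le L S id y p
  have h2 := norm_trig_le L S id z p
  gcongr

/-- Trilinear estimate for the discrete norm. -/
lemma gridNorm_trilinear_sq_le {L : ℝ} (hL : 0 < L) {N : ℕ} (hN : 0 < N) (o : ℝ × ℝ)
    {S : Finset (ℤ × ℤ)} (hS : Separated N S) {x y z m : ℤ × ℤ → ℝ} (hx : ∀ ξ, 0 ≤ x ξ)
    (hy : ∀ ξ, 0 ≤ y ξ) (hz : ∀ ξ, 0 ≤ z ξ) (hm : ∀ ξ, 0 ≤ m ξ)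
    {c : (ℤ × ℤ) × (ℤ × ℤ) × (ℤ × ℤ) → ℂ} {K : ℝ}
    (hc : ∀ τ ∈ S ×ˢ S ×ˢ S, ‖c τ‖ ≤ K * (m τ.1 + m τ.2.1 + m τ.2.2)
      * (x τ.1 * (y τ.2.1 * z τ.2.2)))
    {Nx Ny Nz Mx My Mz : ℝ} (hNx : ∑ ξ ∈ S, x ξ ≤ Nx) (hNy : ∑ ξ ∈ S, y ξ ≤ Ny)
    (hNz : ∑ ξ ∈ S, z ξ ≤ Nz) (hMx : ∑ ξ ∈ S, (m ξ * x ξ) ^ 2 ≤ Mx)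
    (hMy : ∑ ξ ∈ S, (m ξ * y ξ) ^ 2 ≤ My) (hMz : ∑ ξ ∈ S, (m ξ * z ξ) ^ 2 ≤ Mz) :
    gridNorm (L / N) N o (trig L (S ×ˢ S ×ˢ S) sum3 c) ^ 2
      ≤ 4 * K ^ 2 * L ^ 2 * (Mx * Ny ^ 2 * Nz ^ 2 + Nx ^ 2 * My * Nz ^ 2 + Nx ^ 2 * Ny ^ 2 * Mz) := by
  refine (gridNorm_trig_le hL hN o _ _ c _ hc).trans ?_
  have e : trig L (S ×ˢ S ×ˢ S) sum3 (fun τ => ((K * (m τ.1 + m τ.2.1 + m τ.2.2)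
      * (x τ.1 * (y τ.2.1 * z τ.2.2)) : ℝ) : ℂ))
      = (K : ℂ) • ((fun p => trig L S id (fun ξ => ((m ξ * x ξ : ℝ) : ℂ)) p
          * (trig L S id (fun ξ => ((y ξ : ℝ) : ℂ)) p * trig L S id (fun ξ => ((z ξ : ℝ) : ℂ)) p))
        + ((fun p => trig L S id (fun ξ => ((m ξ * y ξ : ℝ) : ℂ)) p
          * (trig L S id (fun ξ => ((x ξ : ℝ) : ℂ)) p * trig L S id (fun ξ => ((z ξ : ℝ) : ℂ)) p))
        + (fun p => trig L S id (fun ξ => ((m ξ * z ξ : ℝ) : ℂ)) p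
          * (trig L S id (fun ξ => ((x ξ : ℝ) : ℂ)) p
            * trig L S id (fun ξ => ((y ξ : ℝ) : ℂ)) p)))) := by
    ext p
    have a1 := trig_mul_mul L S (fun ξ => ((m ξ * x ξ : ℝ) : ℂ)) (fun ξ => ((y ξ : ℝ) : ℂ))
      (fun ξ => ((z ξ : ℝ) : ℂ)) p
    have a2 := trig_mul_mul L S (fun ξ => ((x ξ : ℝ) : ℂ)) (fun ξ => ((m ξ * y ξ : ℝ) : ℂ))
      (fun ξ => ((z ξ : ℝ) : ℂ)) p
    have a3 := trig_mul_mul L S (fun ξ => ((x ξ : ℝ) : ℂ)) (fun ξ => ((y ξ : ℝ) : ℂ))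
      (fun ξ => ((m ξ * z ξ : ℝ) : ℂ)) p
    simp only [Pi.smul_apply, Pi.add_apply, smul_eq_mul]
    rw [a1, mul_left_comm (trig L S id (fun ξ => ((m ξ * y ξ : ℝ) : ℂ)) p), a2,
      mul_left_comm (trig L S id (fun ξ => ((m ξ * z ξ : ℝ) : ℂ)) p),
      mul_comm (trig L S id (fun ξ => ((m ξ * z ξ : ℝ) : ℂ)) p), a3]
    simp only [trig, ← Finset.sum_add_distrib, Finset.mul_sum]
    refine Finset.sum_congr rfl fun τ _ => ?_
    push_cast; ring
  rw [e, gridNorm_smul_sq, Complex.norm_real, Real.norm_eq_abs, sq_abs]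
  have n1 := gridNorm_add_sq_le (L / N) N 0
    (fun p => trig L S id (fun ξ => ((m ξ * x ξ : ℝ) : ℂ)) p
      * (trig L S id (fun ξ => ((y ξ : ℝ) : ℂ)) p * trig L S id (fun ξ => ((z ξ : ℝ) : ℂ)) p))
    ((fun p => trig L S id (fun ξ => ((m ξ * y ξ : ℝ) : ℂ)) p
      * (trig L S id (fun ξ => ((x ξ : ℝ) : ℂ)) p * trig L S id (fun ξ => ((z ξ : ℝ) : ℂ)) p))
    + (fun p => trig L S id (fun ξ => ((m ξ * z ξ : ℝ) : ℂ)) p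
      * (trig L S id (fun ξ => ((x ξ : ℝ) : ℂ)) p * trig L S id (fun ξ => ((y ξ : ℝ) : ℂ)) p)))
  have n2 := gridNorm_add_sq_le (L / N) N 0
    (fun p => trig L S id (fun ξ => ((m ξ * y ξ : ℝ) : ℂ)) p
      * (trig L S id (fun ξ => ((x ξ : ℝ) : ℂ)) p * trig L S id (fun ξ => ((z ξ : ℝ) : ℂ)) p))
    (fun p => trig L S id (fun ξ => ((m ξ * z ξ : ℝ) : ℂ)) p
      * (trig L S id (fun ξ => ((x ξ : ℝ) : ℂ)) p * trig L S id (fun ξ => ((y ξ : ℝ) : ℂ)) p))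
  have b1 := gridNorm_mul_mul_sq_le hL hN 0 hS (fun ξ => ((m ξ * x ξ : ℝ) : ℂ))
    (fun ξ => ((y ξ : ℝ) : ℂ)) (fun ξ => ((z ξ : ℝ) : ℂ))
  have b2 := gridNorm_mul_mul_sq_le hL hN 0 hS (fun ξ => ((m ξ * y ξ : ℝ) : ℂ))
    (fun ξ => ((x ξ : ℝ) : ℂ)) (fun ξ => ((z ξ : ℝ) : ℂ))
  have b3 := gridNorm_mul_mul_sq_le hL hN 0 hS (fun ξ => ((m ξ * z ξ : ℝ) : ℂ))
    (fun ξ => ((x ξ : ℝ) : ℂ)) (fun ξ => ((y ξ : ℝ) : ℂ))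
  simp only [Complex.norm_real, Real.norm_of_nonneg (hx _), Real.norm_of_nonneg (hy _),
    Real.norm_of_nonneg (hz _), Real.norm_of_nonneg (mul_nonneg (hm _) (hx _)),
    Real.norm_of_nonneg (mul_nonneg (hm _) (hy _)),
    Real.norm_of_nonneg (mul_nonneg (hm _) (hz _))] at b1 b2 b3
  have px : 0 ≤ ∑ ξ ∈ S, x ξ := Finset.sum_nonneg fun ξ _ => hx ξ
  have py : 0 ≤ ∑ ξ ∈ S, y ξ := Finset.sum_nonneg fun ξ _ => hy ξ
  have pz : 0 ≤ ∑ ξ ∈ S, z ξ := Finset.sum_nonneg fun ξ _ => hz ξ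
  have c1 := b1.trans (by gcongr : _ ≤ Ny ^ 2 * Nz ^ 2 * (L ^ 2 * Mx))
  have c2 := b2.trans (by gcongr : _ ≤ Nx ^ 2 * Nz ^ 2 * (L ^ 2 * My))
  have c3 := b3.trans (by gcongr : _ ≤ Nx ^ 2 * Ny ^ 2 * (L ^ 2 * Mz))
  have hpos : 0 ≤ Ny ^ 2 * Nz ^ 2 * (L ^ 2 * Mx) := le_trans (sq_nonneg _) c1
  calc _ ≤ K ^ 2 * (4 * (Ny ^ 2 * Nz ^ 2 * (L ^ 2 * Mx)) + 4 * (Nx ^ 2 * Nz ^ 2 * (L ^ 2 * My))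
        + 4 * (Nx ^ 2 * Ny ^ 2 * (L ^ 2 * Mz))) := by
        refine mul_le_mul_of_nonneg_left ?_ (sq_nonneg K)
        linarith
    _ = _ := by ring

/-! ### Summability of the weights -/

lemma summable_wt : Summable fun ξ : ℤ × ℤ => (wt ξ ^ 2)⁻¹ := by
  have h1 : Summable fun k : ℤ => (1 + (k : ℝ) ^ 2)⁻¹ := by
    refine Summable.of_norm_bounded_eventually (g := fun k : ℤ => 1 / (k : ℝ) ^ 2)
      (Real.summable_one_div_int_pow.2 (by norm_num)) ?_
    filter_upwards [(Set.finite_singleton (0 : ℤ)).compl_mem_cofinite] with k hk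
    have hk0 : (k : ℝ) ≠ 0 := by exact_mod_cast hk
    rw [Real.norm_of_nonneg (by positivity), one_div]
    gcongr
    linarith
  have h2 := h1.mul_of_nonneg h1 (fun k => by positivity) (fun k => by positivity)
  refine Summable.of_nonneg_of_le (fun ξ => by have := wt_pos ξ; positivity) (fun ξ => ?_) h2
  rw [← mul_inv]
  gcongr
  unfold wt
  nlinarith [sq_nonneg (ξ.1 : ℝ), sq_nonneg (ξ.2 : ℝ),
      mul_nonneg (sq_nonneg (ξ.1 : ℝ)) (sq_nonneg (ξ.2 : ℝ))]

/-- The sum of the inverse squared weights. -/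
def wtSum : ℝ := ∑' ξ : ℤ × ℤ, (wt ξ ^ 2)⁻¹

lemma wtSum_nonneg : 0 ≤ wtSum := tsum_nonneg fun ξ => by have := wt_pos ξ; positivity

lemma sq_sum_le_wtSum (S : Finset (ℤ × ℤ)) {x : ℤ × ℤ → ℝ} :
    (∑ ξ ∈ S, x ξ) ^ 2 ≤ wtSum * ∑ ξ ∈ S, wt ξ ^ 2 * x ξ ^ 2 := by
  have h := Finset.sum_mul_sq_le_sq_mul_sq S (fun ξ => (wt ξ)⁻¹) (fun ξ => wt ξ * x ξ)
  have e1 : ∀ ξ, (wt ξ)⁻¹ * (wt ξ * x ξ) = x ξ := fun ξ => by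
    have := (wt_pos ξ).ne'; field_simp
  simp only [e1, mul_pow, inv_pow] at h
  refine h.trans ?_
  gcongr
  exact summable_wt.sum_le_tsum S fun ξ _ => by have := wt_pos ξ; positivity

/-! ### Modes of the solution -/

lemma HasWeakTimeDeriv.coeff {L T : ℝ} {j : ℕ} {u v : ℝ → L2 L} (h : HasWeakTimeDeriv L T j u v)
    (ξ : ℤ × ℤ) : HasWeakDerivOn T j (fun t => fourierCoeff L (u t) ξ.1 ξ.2)
      (fun t => fourierCoeff L (v t) ξ.1 ξ.2) := by
  obtain ⟨hu, hv, h⟩ := h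
  simp only [← fourierCLM_apply]
  refine ⟨(fourierCLM L ξ).integrable_comp hu, (fourierCLM L ξ).integrable_comp hv, fun η hη => ?_⟩
  have h1 := congrArg (fourierCLM L ξ) (h η hη.1 hη.2.1 hη.2.2)
  have hd : ∀ j, IsTest T (iteratedDeriv j η) := by
    intro j
    induction j with
    | zero => simpa using hη
    | succ n ih => rw [iteratedDeriv_succ]; exact ih.deriv
  rw [map_smul, ← ContinuousLinearMap.integral_comp_comm _ ((hd j).integrableOn_smul hu),
    ← ContinuousLinearMap.integral_comp_comm _ (hη.integrableOn_smul hv)] at h1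
  simpa only [map_smul] using h1

lemma exists_hasWeakTimeDeriv {L T : ℝ} {m r j : ℕ} {p : ℝ≥0∞} {u : ℝ → L2 L}
    (h : bochnerSobolevNorm L T m p r u < ⊤) (hj : j ≤ m) : ∃ v, HasWeakTimeDeriv L T j u v := by
  by_contra hcon
  push Not at hcon
  have h1 := ENNReal.sum_lt_top.1 h j (Finset.mem_range.2 (by omega))
  simp [hcon] at h1

lemma le_mul_iInf_sq {ι : Sort*} {P : ι → Prop} {y : ι → ℝ≥0∞} {X c : ℝ≥0∞} (hc : c ≠ 0)
    (hc' : c ≠ ⊤) (h : ∀ i, P i → X ≤ c * y i ^ 2) : X ≤ c * (⨅ i, ⨅ _ : P i, y i) ^ 2 := by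
  have h1 : (X / c) ^ (2 : ℝ)⁻¹ ≤ ⨅ i, ⨅ _ : P i, y i := by
    refine le_iInf₂ fun i hi => ?_
    rw [ENNReal.rpow_inv_le_iff (by norm_num), ENNReal.rpow_two]
    exact ENNReal.div_le_of_le_mul' (h i hi)
  rw [ENNReal.rpow_inv_le_iff (by norm_num), ENNReal.rpow_two] at h1
  rw [mul_comm]
  exact (ENNReal.div_le_iff hc hc').1 h1

lemma bochnerNorm_two_sq (L T : ℝ) (r : ℕ) (v : ℝ → L2 L) :
    bochnerNorm L T 2 r v ^ 2 = ∫⁻ t in Ioo 0 T, sobolevNorm L r (v t) ^ 2 := by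
  rw [bochnerNorm, eLpNorm_eq_lintegral_rpow_enorm_toReal (by norm_num) (by norm_num)]
  rw [← ENNReal.rpow_two, ← ENNReal.rpow_mul]
  simp

lemma lintegral_modes_le {L T : ℝ} (hL : 0 < L) {Φ : ℝ → L2 L} {m r j : ℕ} (hj : j ≤ m)
    {g : ℤ × ℤ → ℝ → ℂ} (hg : ∀ v, HasWeakTimeDeriv L T j Φ v → ∀ ξ : ℤ × ℤ,
      ∀ᵐ t ∂volume.restrict (Ioo 0 T), fourierCoeff L (v t) ξ.1 ξ.2 = g ξ t)
    (S : Finset (ℤ × ℤ)) :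
    ∫⁻ t in Ioo 0 T, ENNReal.ofReal (∑ ξ ∈ S, wt ξ ^ r * ‖g ξ t‖ ^ 2)
      ≤ ENNReal.ofReal (sobConst L r) * bochnerSobolevNorm L T m 2 r Φ ^ 2 := by
  refine (le_mul_iInf_sq (P := fun v => HasWeakTimeDeriv L T j Φ v)
    (y := fun v => bochnerNorm L T 2 r v) (by simpa using sobConst_pos hL r)
    ENNReal.ofReal_ne_top fun v hv => ?_).trans ?_
  · rw [bochnerNorm_two_sq, ← lintegral_const_mul' _ _ ENNReal.ofReal_ne_top]
    refine lintegral_mono_ae ?_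
    filter_upwards [ae_all_iff.2 (hg v hv)] with t ht
    simp only [← ht]
    exact sum_wt_le hL r (v t) S
  · gcongr
    exact Finset.single_le_sum (f := fun j => ⨅ v : ℝ → L2 L, ⨅ _ : HasWeakTimeDeriv L T j Φ v,
      bochnerNorm L T 2 r v) (fun _ _ => zero_le) (Finset.mem_range.2 (by omega))

lemma integral_modes_le {L T : ℝ} (hL : 0 < L) {Φ : ℝ → L2 L} {m r j : ℕ} (hj : j ≤ m)
    {g : ℤ × ℤ → ℝ → ℂ} (hg : ∀ v, HasWeakTimeDeriv L T j Φ v → ∀ ξ : ℤ × ℤ,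
      ∀ᵐ t ∂volume.restrict (Ioo 0 T), fourierCoeff L (v t) ξ.1 ξ.2 = g ξ t)
    (hgm : ∀ ξ, AEStronglyMeasurable (g ξ) (volume.restrict (Ioo 0 T)))
    (hfin : bochnerSobolevNorm L T m 2 r Φ < ⊤) (S : Finset (ℤ × ℤ)) :
    IntegrableOn (fun t => ∑ ξ ∈ S, wt ξ ^ r * ‖g ξ t‖ ^ 2) (Ioo 0 T) ∧
    ∫ t in Ioo 0 T, ∑ ξ ∈ S, wt ξ ^ r * ‖g ξ t‖ ^ 2
      ≤ sobConst L r * (bochnerSobolevNorm L T m 2 r Φ).toReal ^ 2 := by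
  have h := lintegral_modes_le (r := r) hL hj hg S
  have h0 : ∀ t, 0 ≤ ∑ ξ ∈ S, wt ξ ^ r * ‖g ξ t‖ ^ 2 := fun t =>
    Finset.sum_nonneg fun ξ _ => by have := wt_pos ξ; positivity
  have hm : AEStronglyMeasurable (fun t => ∑ ξ ∈ S, wt ξ ^ r * ‖g ξ t‖ ^ 2)
      (volume.restrict (Ioo 0 T)) :=
    Finset.aestronglyMeasurable_fun_sum S fun ξ _ => ((hgm ξ).norm.pow 2).const_mul _
  have htop : ENNReal.ofReal (sobConst L r) * bochnerSobolevNorm L T m 2 r Φ ^ 2 ≠ ⊤ :=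
    ENNReal.mul_ne_top ENNReal.ofReal_ne_top (ENNReal.pow_ne_top hfin.ne)
  constructor
  · refine ⟨hm, ?_⟩
    rw [hasFiniteIntegral_iff_ofReal (Filter.Eventually.of_forall h0)]
    exact h.trans_lt htop.lt_top
  · rw [integral_eq_lintegral_of_nonneg_ae (Filter.Eventually.of_forall h0) hm]
    refine (ENNReal.toReal_mono htop h).trans (le_of_eq ?_)
    rw [ENNReal.toReal_mul, ENNReal.toReal_ofReal (sobConst_pos hL r).le, ENNReal.toReal_pow]

lemma le_of_ae_le_of_continuousOn {T : ℝ} (hT : 0 < T) {X : ℝ → ℝ} {b : ℝ}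
    (hX : ContinuousOn X (Icc 0 T)) (h : ∀ᵐ t ∂volume.restrict (Ioo 0 T), X t ≤ b) :
    ∀ t ∈ Icc 0 T, X t ≤ b := by
  have heq : EqOn (fun t => max (X t) b) (fun _ => b) (Icc 0 T) := by
    refine Measure.eqOn_Icc_of_ae_eq volume hT.ne ?_ (hX.sup continuousOn_const)
      continuousOn_const
    rw [Filter.EventuallyEq, restrict_Ioo_eq_restrict_Icc.symm]
    filter_upwards [h] with t ht using max_eq_right ht
  intro t ht
  exact (le_max_left _ _).trans (heq ht).le

lemma sup_modes_le {L T : ℝ} (hL : 0 < L) (hT : 0 < T) {Φ : ℝ → L2 L} {r : ℕ}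
    {g : ℤ × ℤ → ℝ → ℂ} (hg : ∀ v, HasWeakTimeDeriv L T 0 Φ v → ∀ ξ : ℤ × ℤ,
      ∀ᵐ t ∂volume.restrict (Ioo 0 T), fourierCoeff L (v t) ξ.1 ξ.2 = g ξ t)
    (hgc : ∀ ξ, ContinuousOn (g ξ) (Icc 0 T))
    (hfin : bochnerSobolevNorm L T 0 ⊤ r Φ < ⊤) (S : Finset (ℤ × ℤ)) :
    ∀ t ∈ Icc 0 T, ∑ ξ ∈ S, wt ξ ^ r * ‖g ξ t‖ ^ 2
      ≤ sobConst L r * (bochnerSobolevNorm L T 0 ⊤ r Φ).toReal ^ 2 := by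
  have hc : ContinuousOn (fun t => ∑ ξ ∈ S, wt ξ ^ r * ‖g ξ t‖ ^ 2) (Icc 0 T) :=
    continuousOn_finsetSum S fun ξ _ => continuousOn_const.mul ((hgc ξ).norm.pow 2)
  intro t ht
  have h : ENNReal.ofReal (∑ ξ ∈ S, wt ξ ^ r * ‖g ξ t‖ ^ 2)
      ≤ ENNReal.ofReal (sobConst L r) * bochnerSobolevNorm L T 0 ⊤ r Φ ^ 2 := by
    refine (le_mul_iInf_sq (P := fun v => HasWeakTimeDeriv L T 0 Φ v)
      (y := fun v => bochnerNorm L T ⊤ r v) (by simpa using sobConst_pos hL r)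
      ENNReal.ofReal_ne_top fun v hv => ?_).trans ?_
    · rcases eq_or_ne (bochnerNorm L T ⊤ r v) ⊤ with htop | htop
      · rw [htop]; simp [ENNReal.mul_top, sobConst_pos hL r]
      have htop' : ENNReal.ofReal (sobConst L r) * bochnerNorm L T ⊤ r v ^ 2 ≠ ⊤ :=
        ENNReal.mul_ne_top ENNReal.ofReal_ne_top (ENNReal.pow_ne_top htop)
      rw [ENNReal.ofReal_le_iff_le_toReal htop']
      refine le_of_ae_le_of_continuousOn hT hc ?_ t ht
      have hess : ∀ᵐ t ∂volume.restrict (Ioo 0 T), sobolevNorm L r (v t) ≤ bochnerNorm L T ⊤ r v := by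
        have := ae_le_eLpNormEssSup (f := fun t => sobolevNorm L r (v t))
          (μ := volume.restrict (Ioo 0 T))
        simpa [bochnerNorm, eLpNorm_exponent_top] using this
      filter_upwards [ae_all_iff.2 (hg v hv), hess] with t ht1 ht2
      rw [← ENNReal.ofReal_le_iff_le_toReal htop']
      simp only [← ht1]
      refine (sum_wt_le hL r (v t) S).trans ?_
      gcongr
    · simp [bochnerSobolevNorm]
  have htop : ENNReal.ofReal (sobConst L r) * bochnerSobolevNorm L T 0 ⊤ r Φ ^ 2 ≠ ⊤ :=
    ENNReal.mul_ne_top ENNReal.ofReal_ne_top (ENNReal.pow_ne_top hfin.ne)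
  rw [ENNReal.ofReal_le_iff_le_toReal htop, ENNReal.toReal_mul,
    ENNReal.toReal_ofReal (sobConst_pos hL r).le, ENNReal.toReal_pow] at h
  exact h

/-! ### The equation for the modes -/

/-- The function with Fourier coefficients `a`. -/
def synth (L : ℝ) (a : ℤ × ℤ → ℂ) (p : ℝ × ℝ) : ℂ := ∑' ξ : ℤ × ℤ, a ξ * char L ξ.1 ξ.2 p

/-- The Fourier coefficient of the cube of the function with Fourier coefficients `a`. -/
def cubeCoeff (L : ℝ) (a : ℤ × ℤ → ℂ) (ζ : ℤ × ℤ) : ℂ :=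
  (1 / (L : ℂ) ^ 2) * ∫ p in square L, synth L a p ^ 3 * char L (-ζ.1) (-ζ.2) p

lemma norm_le_of_sum_wt_le {a : ℤ × ℤ → ℂ} {E : ℝ} (hE : 0 ≤ E)
    (h : ∀ S : Finset (ℤ × ℤ), ∑ ξ ∈ S, wt ξ ^ 4 * ‖a ξ‖ ^ 2 ≤ E ^ 2) (ξ : ℤ × ℤ) :
    ‖a ξ‖ ≤ E * (wt ξ ^ 2)⁻¹ := by
  have h1 := h {ξ}
  rw [Finset.sum_singleton] at h1
  have hw := wt_pos ξ
  have h2 : (wt ξ ^ 2 * ‖a ξ‖) ^ 2 ≤ E ^ 2 := by rw [mul_pow, ← pow_mul]; exact h1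
  rw [← div_eq_mul_inv, le_div_iff₀ (by positivity), mul_comm]
  exact (pow_le_pow_iff_left₀ (by positivity) hE (by norm_num)).1 h2

lemma continuousOn_cubeCoeff {L T E : ℝ} {f : ℤ × ℤ → ℝ → ℂ}
    (hf : ∀ ξ, ContinuousOn (f ξ) (Icc 0 T))
    (hE : ∀ t ∈ Icc 0 T, ∀ ξ, ‖f ξ t‖ ≤ E * (wt ξ ^ 2)⁻¹) (ζ : ℤ × ℤ) :
    ContinuousOn (fun t => cubeCoeff L (fun ξ => f ξ t) ζ) (Icc 0 T) := by
  have hs : Summable fun ξ : ℤ × ℤ => E * (wt ξ ^ 2)⁻¹ := summable_wt.mul_left E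
  have hb : ∀ t ∈ Icc 0 T, ∀ ξ p, ‖f ξ t * char L ξ.1 ξ.2 p‖ ≤ E * (wt ξ ^ 2)⁻¹ := by
    intro t ht ξ p; rw [norm_mul, norm_char, mul_one]; exact hE t ht ξ
  have hbu : ∀ t ∈ Icc 0 T, ∀ p, ‖synth L (fun ξ => f ξ t) p‖ ≤ ∑' ξ : ℤ × ℤ, E * (wt ξ ^ 2)⁻¹ :=
    fun t ht p => tsum_of_norm_bounded hs.hasSum (hb t ht · p)
  refine continuousOn_const.mul ?_
  refine continuousOn_of_dominated (bound := fun _ => (∑' ξ : ℤ × ℤ, E * (wt ξ ^ 2)⁻¹) ^ 3) ?_ ?_ ?_ ?_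
  · intro t ht
    have : Continuous (synth L fun ξ => f ξ t) := continuous_tsum
      (fun ξ => continuous_const.mul (continuous_char L ξ.1 ξ.2)) hs (hb t ht)
    exact ((this.pow 3).mul (continuous_char L _ _)).aestronglyMeasurable
  · intro t ht
    refine Filter.Eventually.of_forall fun p => ?_
    rw [norm_mul, norm_char, mul_one, norm_pow]
    exact pow_le_pow_left₀ (norm_nonneg _) (hbu t ht p) 3
  · exact integrable_const _
  · refine Filter.Eventually.of_forall fun p => ?_
    refine ContinuousOn.mul (ContinuousOn.pow ?_ 3) continuousOn_const
    exact continuousOn_tsum (fun ξ => (hf ξ).mul continuousOn_const) hs fun ξ t ht => hb t ht ξ p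

lemma fnCoeff_cube {L : ℝ} (hL : 0 < L) (f : L2 L) {E : ℝ}
    (h : ∀ ξ : ℤ × ℤ, ‖fourierCoeff L f ξ.1 ξ.2‖ ≤ E * (wt ξ ^ 2)⁻¹) (ζ : ℤ × ℤ) :
    fnCoeff L (fun p => f p ^ 3) ζ = cubeCoeff L (fun ξ => fourierCoeff L f ξ.1 ξ.2) ζ := by
  rw [fnCoeff, cubeCoeff]
  congr 1
  refine integral_congr_ae ?_
  have hs : Summable fun ξ : ℤ × ℤ => ‖fourierCoeff L f ξ.1 ξ.2‖ :=
    Summable.of_nonneg_of_le (fun _ => norm_nonneg _) h (summable_wt.mul_left E)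
  filter_upwards [ae_eq_tsum_fourier hL f hs] with p hp
  simp only [synth, ← hp]
  push_cast; ring

lemma fnCoeff_add {L : ℝ} {f g : ℝ × ℝ → ℝ} (hf : IntegrableOn f (square L))
    (hg : IntegrableOn g (square L)) (ξ : ℤ × ℤ) :
    fnCoeff L (fun p => f p + g p) ξ = fnCoeff L f ξ + fnCoeff L g ξ := by
  simp only [fnCoeff, Complex.ofReal_add, add_mul]
  rw [integral_add (integrable_mul_char hf _ _) (integrable_mul_char hg _ _), mul_add]

lemma fnCoeff_const_mul (L c : ℝ) (f : ℝ × ℝ → ℝ) (ξ : ℤ × ℤ) :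
    fnCoeff L (fun p => c * f p) ξ = c * fnCoeff L f ξ := by
  simp only [fnCoeff, Complex.ofReal_mul, mul_assoc, integral_const_mul]
  ring

lemma coeff_equation {α β L : ℝ} (hL : 0 < L) {φ φt φtt lap bilap : L2 L}
    (h1 : HasWeakLaplacian L φ lap) (h2 : HasWeakLaplacian L lap bilap)
    (h3 : HasWeakLaplacian L (fun p => φ p ^ 3 + α * φ p + 2 * lap p + bilap p)
        (fun p => β * φtt p + φt p)) (ξ : ℤ × ℤ) :
    β * fourierCoeff L φtt ξ.1 ξ.2 + fourierCoeff L φt ξ.1 ξ.2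
      = lapSymbol L ξ * (fnCoeff L (fun p => φ p ^ 3) ξ + α * fourierCoeff L φ ξ.1 ξ.2
        + 2 * (lapSymbol L ξ * fourierCoeff L φ ξ.1 ξ.2)
        + lapSymbol L ξ * (lapSymbol L ξ * fourierCoeff L φ ξ.1 ξ.2)) := by
  have hi : ∀ f : L2 L, IntegrableOn f (square L) := fun f => (Lp.memLp f).integrable (by norm_num)
  have i1 := (hi φ).const_mul α
  have i2 := (hi lap).const_mul 2
  have i3 : IntegrableOn (fun p => φ p ^ 3) (square L) := by
    have := ((h3.1.sub (hi bilap)).sub i2).sub i1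
    refine this.congr (Filter.Eventually.of_forall fun p => ?_)
    simp only [Pi.sub_apply]; ring
  have i4 : IntegrableOn (fun p => φ p ^ 3 + α * φ p) (square L) := i3.add i1
  have i5 : IntegrableOn (fun p => φ p ^ 3 + α * φ p + 2 * lap p) (square L) := i4.add i2
  have e := fnCoeff_of_hasWeakLaplacian hL h3 ξ
  rw [fnCoeff_add ((hi φtt).const_mul β) (hi φt), fnCoeff_const_mul,
    fnCoeff_add i5 (hi bilap), fnCoeff_add i4 i2, fnCoeff_add i3 i1,
    fnCoeff_const_mul, fnCoeff_const_mul, fnCoeff_of_hasWeakLaplacian hL h2 ξ,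
    fnCoeff_of_hasWeakLaplacian hL h1 ξ] at e
  simp only [fourierCoeff_eq_fnCoeff]
  rw [e]; push_cast; ring

/-- The modes of a regular solution, their time derivatives, and the bounds they satisfy. -/
structure IsModes (α β L T : ℝ) (f f₁ f₂ f₃ f₄ : ℤ × ℤ → ℝ → ℂ) (A D E F G : ℝ) : Prop where
  prim₁ : ∀ ξ, IsPrimitive T (f ξ) (f₁ ξ)
  prim₂ : ∀ ξ, IsPrimitive T (f₁ ξ) (f₂ ξ)
  prim₃ : ∀ ξ, IsPrimitive T (f₂ ξ) (f₃ ξ)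
  prim₄ : ∀ ξ, IsPrimitive T (f₃ ξ) (f₄ ξ)
  sq₂ : ∀ ξ, IntegrableOn (fun t => ‖f₂ ξ t‖ ^ 2) (Ioo 0 T)
  sq₃ : ∀ ξ, IntegrableOn (fun t => ‖f₃ ξ t‖ ^ 2) (Ioo 0 T)
  sq₄ : ∀ ξ, IntegrableOn (fun t => ‖f₄ ξ t‖ ^ 2) (Ioo 0 T)
  bound₃ : ∀ S : Finset (ℤ × ℤ), ∫ t in Ioo 0 T, ∑ ξ ∈ S, ‖f₃ ξ t‖ ^ 2 ≤ A ^ 2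
  bound₄ : ∀ S : Finset (ℤ × ℤ), ∫ t in Ioo 0 T, ∑ ξ ∈ S, ‖f₄ ξ t‖ ^ 2 ≤ A ^ 2
  boundD : ∀ S : Finset (ℤ × ℤ), ∫ t in Ioo 0 T, ∑ ξ ∈ S, wt ξ ^ 6 * ‖f₂ ξ t‖ ^ 2 ≤ D ^ 2
  boundF : ∀ S : Finset (ℤ × ℤ), ∫ t in Ioo 0 T, ∑ ξ ∈ S, wt ξ ^ 2 * ‖f₂ ξ t‖ ^ 2 ≤ F ^ 2
  boundE : ∀ t ∈ Icc 0 T, ∀ S : Finset (ℤ × ℤ), ∑ ξ ∈ S, wt ξ ^ 4 * ‖f ξ t‖ ^ 2 ≤ E ^ 2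
  boundG : ∀ t ∈ Icc 0 T, ∀ S : Finset (ℤ × ℤ), ∑ ξ ∈ S, wt ξ ^ 8 * ‖f ξ t‖ ^ 2 ≤ G ^ 2
  equation : ∀ t ∈ Icc 0 T, ∀ ξ, β * f₂ ξ t + f₁ ξ t
    = lapSymbol L ξ * (cubeCoeff L (fun ξ => f ξ t) ξ + α * f ξ t + 2 * (lapSymbol L ξ * f ξ t)
      + lapSymbol L ξ * (lapSymbol L ξ * f ξ t))

lemma exists_isModes {α β L T : ℝ} (hL : 0 < L) (hT : 0 < T) {Φ : ℝ → L2 L}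
    (hΦ : ContinuousOn Φ (Icc 0 T)) (hsol : IsSolution α β L T Φ) (hreg : IsRegular L T Φ) :
    ∃ f₁ f₂ f₃ f₄ : ℤ × ℤ → ℝ → ℂ,
      IsModes α β L T (fun ξ t => fourierCoeff L (Φ t) ξ.1 ξ.2) f₁ f₂ f₃ f₄
        (√(sobConst L 0) * (bochnerSobolevNorm L T 4 2 0 Φ).toReal)
        (√(sobConst L 6) * (bochnerSobolevNorm L T 2 2 6 Φ).toReal)
        (√(sobConst L 4) * (bochnerSobolevNorm L T 0 ⊤ 4 Φ).toReal)
        (√(sobConst L 2) * (bochnerSobolevNorm L T 2 2 2 Φ).toReal)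
        (√(sobConst L 8) * (bochnerSobolevNorm L T 0 ⊤ 8 Φ).toReal) := by
  obtain ⟨hA, hG, -, hD⟩ := hreg
  have hF : bochnerSobolevNorm L T 2 2 2 Φ < ⊤ :=
    (bochnerSobolevNorm_mono L T 2 2 (by norm_num) Φ).trans_lt hD
  have hE : bochnerSobolevNorm L T 0 ⊤ 4 Φ < ⊤ :=
    (bochnerSobolevNorm_mono L T 0 ⊤ (by norm_num) Φ).trans_lt hG
  obtain ⟨v₁, hv₁⟩ := exists_hasWeakTimeDeriv hA (j := 1) (by norm_num)
  obtain ⟨v₂, hv₂⟩ := exists_hasWeakTimeDeriv hA (j := 2) (by norm_num)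
  obtain ⟨v₃, hv₃⟩ := exists_hasWeakTimeDeriv hA (j := 3) (by norm_num)
  obtain ⟨v₄, hv₄⟩ := exists_hasWeakTimeDeriv hA (j := 4) (by norm_num)
  set f : ℤ × ℤ → ℝ → ℂ := fun ξ t => fourierCoeff L (Φ t) ξ.1 ξ.2 with hfdef
  have hfc : ∀ ξ, ContinuousOn (f ξ) (Icc 0 T) := fun ξ => by
    simp only [hfdef, ← fourierCLM_apply]
    exact (fourierCLM L ξ).continuous.comp_continuousOn hΦ
  have hchain := fun ξ : ℤ × ℤ => exists_isPrimitive_chain hT (hfc ξ) (hv₁.coeff ξ) (hv₂.coeff ξ)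
    (hv₃.coeff ξ) (hv₄.coeff ξ)
  choose f₁ f₂ f₃ p₁ p₂ p₃ p₄ e₁ e₂ e₃ using hchain
  have hu : ∀ j (g : ℤ × ℤ → ℝ → ℂ) (w : ℝ → L2 L), HasWeakTimeDeriv L T j Φ w →
      (∀ ξ : ℤ × ℤ, ∀ᵐ t ∂volume.restrict (Ioo 0 T), fourierCoeff L (w t) ξ.1 ξ.2 = g ξ t) →
      ∀ v, HasWeakTimeDeriv L T j Φ v → ∀ ξ : ℤ × ℤ,
        ∀ᵐ t ∂volume.restrict (Ioo 0 T), fourierCoeff L (v t) ξ.1 ξ.2 = g ξ t := by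
    intro j g w hw hwg v hv ξ
    filter_upwards [(hv.coeff ξ).ae_unique (hw.coeff ξ), hwg ξ] with t h1 h2
    rw [h1, h2]
  have u₀ := hu 0 f Φ ⟨hv₁.1, hv₁.1, fun η _ _ _ => by simp⟩
    (fun ξ => Filter.Eventually.of_forall fun t => rfl)
  have u₁ := hu 1 f₁ v₁ hv₁ e₁
  have u₂ := hu 2 f₂ v₂ hv₂ e₂
  have u₃ := hu 3 f₃ v₃ hv₃ e₃
  have u₄ := hu 4 (fun ξ t => fourierCoeff L (v₄ t) ξ.1 ξ.2) v₄ hv₄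
    (fun ξ => Filter.Eventually.of_forall fun t => rfl)
  have m₂ : ∀ ξ, AEStronglyMeasurable (f₂ ξ) (volume.restrict (Ioo 0 T)) := fun ξ => (p₂ ξ).1.1
  have m₃ : ∀ ξ, AEStronglyMeasurable (f₃ ξ) (volume.restrict (Ioo 0 T)) := fun ξ => (p₃ ξ).1.1
  have m₄ : ∀ ξ : ℤ × ℤ, AEStronglyMeasurable (fun t => fourierCoeff L (v₄ t) ξ.1 ξ.2)
    (volume.restrict (Ioo 0 T)) := fun ξ => (p₄ ξ).1.1
  have sqb : ∀ (r : ℕ) (X : ℝ), sobConst L r * X ^ 2 = (√(sobConst L r) * X) ^ 2 := fun r X => by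
    rw [mul_pow, Real.sq_sqrt (sobConst_pos hL r).le]
  have bE := fun S => sup_modes_le hL hT u₀ hfc hE S
  simp only [sqb] at bE
  have hdecay : ∀ t ∈ Icc 0 T, ∀ ξ, ‖f ξ t‖
      ≤ √(sobConst L 4) * (bochnerSobolevNorm L T 0 ⊤ 4 Φ).toReal * (wt ξ ^ 2)⁻¹ :=
    fun t ht => norm_le_of_sum_wt_le (by positivity) fun S => bE S t ht
  refine ⟨f₁, f₂, f₃, fun ξ t => fourierCoeff L (v₄ t) ξ.1 ξ.2,
    ⟨p₁, p₂, p₃, p₄, ?_, ?_, ?_, ?_, ?_, ?_, ?_, fun t ht S => bE S t ht, ?_, ?_⟩⟩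
  · exact fun ξ => (((p₃ ξ).continuousOn hT).norm.pow 2).integrableOn_Icc.mono_set
      Ioo_subset_Icc_self
  · exact fun ξ => (((p₄ ξ).continuousOn hT).norm.pow 2).integrableOn_Icc.mono_set
      Ioo_subset_Icc_self
  · intro ξ
    simpa using (integral_modes_le (r := 0) hL (by norm_num) u₄ m₄ hA {ξ}).1
  · intro S
    rw [← sqb]
    simpa using (integral_modes_le (r := 0) hL (by norm_num) u₃ m₃ hA S).2
  · intro S
    rw [← sqb]
    simpa using (integral_modes_le (r := 0) hL (by norm_num) u₄ m₄ hA S).2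
  · intro S
    rw [← sqb]
    exact (integral_modes_le hL (by norm_num) u₂ m₂ hD S).2
  · intro S
    rw [← sqb]
    exact (integral_modes_le hL (by norm_num) u₂ m₂ hF S).2
  · intro t ht S
    rw [← sqb]
    exact sup_modes_le hL hT u₀ hfc hG S t ht
  · intro t ht ξ
    obtain ⟨Φt, Φtt, h1, h2, heq⟩ := hsol
    have c1 : ContinuousOn (fun t => (β : ℂ) * f₂ ξ t + f₁ ξ t) (Icc 0 T) :=
      (continuousOn_const.mul ((p₃ ξ).continuousOn hT)).add ((p₂ ξ).continuousOn hT)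
    have c2 : ContinuousOn (fun t => (lapSymbol L ξ : ℂ) * (cubeCoeff L (fun ξ => f ξ t) ξ
        + α * f ξ t + 2 * (lapSymbol L ξ * f ξ t)
        + lapSymbol L ξ * (lapSymbol L ξ * f ξ t))) (Icc 0 T) := by
      have := continuousOn_cubeCoeff (L := L) hfc hdecay ξ
      have := hfc ξ
      fun_prop
    refine Measure.eqOn_Icc_of_ae_eq volume hT.ne ?_ c1 c2 ht
    rw [Filter.EventuallyEq, restrict_Ioo_eq_restrict_Icc.symm]
    filter_upwards [u₁ _ h1 ξ, u₂ _ h2 ξ, heq, ae_restrict_mem measurableSet_Ioo]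
      with t e1 e2 ⟨lap, bilap, l1, l2, l3⟩ htI
    rw [← e1, ← e2, coeff_equation hL l1 l2 l3,
      fnCoeff_cube hL (Φ t) (hdecay t (Ioo_subset_Icc_self htI))]

/-! ### The box of modes -/

/-- The modes of the Fourier projection. -/
def box (N : ℕ) : Finset (ℤ × ℤ) :=
  Finset.Icc (-((N : ℤ) / 2) + 1) ((N : ℤ) / 2) ×ˢ Finset.Icc (-((N : ℤ) / 2) + 1) ((N : ℤ) / 2)

lemma proj_eq_trig (L : ℝ) (N : ℕ) (Φ : ℝ → L2 L) (t : ℝ) :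
    proj L N Φ t = trig L (box N) id fun ξ => fourierCoeff L (Φ t) ξ.1 ξ.2 := by
  ext p
  rw [trig, box, Finset.sum_product]
  rfl

lemma separated_box (N : ℕ) : Separated N (box N) := by
  intro ξ hξ η hη h1 h2
  simp only [box, Finset.mem_product, Finset.mem_Icc] at hξ hη
  rw [Prod.fst_sub] at h1
  rw [Prod.snd_sub] at h2
  have e1 := Int.eq_zero_of_abs_lt_dvd h1 (by rw [abs_lt]; omega)
  have e2 := Int.eq_zero_of_abs_lt_dvd h2 (by rw [abs_lt]; omega)
  exact Prod.ext (by omega) (by omega)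

lemma exists_separated (S : Finset (ℤ × ℤ)) : ∃ N : ℕ, 0 < N ∧ Separated N S := by
  set R : ℕ := ∑ ξ ∈ S, (ξ.1.natAbs + ξ.2.natAbs)
  have hR : ∀ ξ ∈ S, ξ.1.natAbs + ξ.2.natAbs ≤ R := fun ξ hξ =>
    Finset.single_le_sum (f := fun ξ : ℤ × ℤ => ξ.1.natAbs + ξ.2.natAbs)
      (fun _ _ => Nat.zero_le _) hξ
  refine ⟨2 * R + 1, by omega, fun ξ hξ η hη h1 h2 => ?_⟩
  have a := hR ξ hξ
  have b := hR η hη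
  rw [Prod.fst_sub] at h1
  rw [Prod.snd_sub] at h2
  have e1 := Int.eq_zero_of_abs_lt_dvd h1 (by rw [abs_lt]; push_cast; omega)
  have e2 := Int.eq_zero_of_abs_lt_dvd h2 (by rw [abs_lt]; push_cast; omega)
  exact Prod.ext (by omega) (by omega)

lemma sq_le_wt_of_notMem_box {N : ℕ} (hN : Even N) {ξ : ℤ × ℤ} (hξ : ξ ∉ box N) :
    (N : ℝ) ^ 2 ≤ 4 * wt ξ := by
  obtain ⟨n, hn⟩ := hN
  have hn2 : (N : ℤ) / 2 = n := by omega
  have key : ∀ k : ℤ, ¬(-(n : ℤ) + 1 ≤ k ∧ k ≤ n) → (N : ℝ) ^ 2 ≤ 4 * (k : ℝ) ^ 2 := by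
    intro k hk
    have h1 : (N : ℤ) ≤ |2 * k| := by
      rw [le_abs]; omega
    have h2 : (N : ℝ) ≤ |2 * (k : ℝ)| := by exact_mod_cast h1
    have h3 := pow_le_pow_left₀ (Nat.cast_nonneg N) h2 2
    rw [sq_abs] at h3
    linarith
  simp only [box, Finset.mem_product, Finset.mem_Icc, hn2] at hξ
  unfold wt
  rcases not_and_or.1 hξ with h | h
  · linarith [key _ h, sq_nonneg (ξ.2 : ℝ)]
  · linarith [key _ h, sq_nonneg (ξ.1 : ℝ)]

lemma one_le_of_notMem_box {L : ℝ} (hL : 0 < L) {N : ℕ} (hN0 : 0 < N) (hN : Even N) {ξ : ℤ × ℤ}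
    (hξ : ξ ∉ box N) : 1 ≤ 4 / L ^ 2 * (L / N) ^ 2 * wt ξ := by
  have h := sq_le_wt_of_notMem_box hN hξ
  have hNr : (0 : ℝ) < N := by exact_mod_cast hN0
  have : 4 / L ^ 2 * (L / N) ^ 2 * wt ξ = 4 * wt ξ / (N : ℝ) ^ 2 := by field_simp
  rw [this, le_div_iff₀ (by positivity), one_mul]
  exact h

/-! ### Space truncation error of the cubic term -/

/-- The coefficients of the cube of a trigonometric polynomial. -/
def cubeSum (S : Finset (ℤ × ℤ)) (a : ℤ × ℤ → ℂ) (ζ : ℤ × ℤ) : ℂ :=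
  ∑ τ ∈ S ×ˢ S ×ˢ S with sum3 τ = ζ, a τ.1 * (a τ.2.1 * a τ.2.2)

lemma trig_cubeSum (L : ℝ) (B S : Finset (ℤ × ℤ)) (a g : ℤ × ℤ → ℂ) :
    trig L B id (fun ζ => g ζ * cubeSum S a ζ) = trig L (S ×ˢ S ×ˢ S) sum3
      (fun τ => if sum3 τ ∈ B then g (sum3 τ) * (a τ.1 * (a τ.2.1 * a τ.2.2)) else 0) := by
  ext p
  simp only [trig, cubeSum, Finset.sum_filter, Finset.mul_sum, Finset.sum_mul, id]
  rw [Finset.sum_comm]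
  refine Finset.sum_congr rfl fun τ _ => ?_
  have : ∀ ζ ∈ B, (g ζ * if sum3 τ = ζ then a τ.1 * (a τ.2.1 * a τ.2.2) else 0)
      * char L ζ.1 ζ.2 p = if sum3 τ = ζ then
        g (sum3 τ) * (a τ.1 * (a τ.2.1 * a τ.2.2)) * char L (sum3 τ).1 (sum3 τ).2 p else 0 := by
    intro ζ _
    split_ifs with h
    · rw [h]
    · simp
  rw [Finset.sum_congr rfl this, Finset.sum_ite_eq, ite_mul, zero_mul]

lemma cubeSum_eq_integral {L : ℝ} (hL : 0 < L) (S : Finset (ℤ × ℤ)) (a : ℤ × ℤ → ℂ) (ζ : ℤ × ℤ) :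
    cubeSum S a ζ = (1 / (L : ℂ) ^ 2) * ∫ p in square L,
      trig L S id a p ^ 3 * char L (-ζ.1) (-ζ.2) p := by
  have hL0 : (L : ℂ) ≠ 0 := by exact_mod_cast hL.ne'
  have h1 : ∀ p, trig L S id a p ^ 3 * char L (-ζ.1) (-ζ.2) p
      = ∑ τ ∈ S ×ˢ S ×ˢ S, a τ.1 * (a τ.2.1 * a τ.2.2)
        * char L ((sum3 τ).1 + -ζ.1) ((sum3 τ).2 + -ζ.2) p := by
    intro p
    rw [show trig L S id a p ^ 3 = trig L S id a p * (trig L S id a p * trig L S id a p) by ring,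
      trig_mul_mul, trig, Finset.sum_mul]
    refine Finset.sum_congr rfl fun τ _ => ?_
    rw [char_add, mul_assoc]
  simp_rw [h1]
  rw [integral_finsetSum _ fun τ _ =>
    ((memLp_char L ((sum3 τ).1 + -ζ.1, (sum3 τ).2 + -ζ.2)).integrable (by norm_num)).const_mul _]
  simp only [integral_const_mul, integral_char hL, cubeSum, Finset.sum_filter, Finset.mul_sum]
  refine Finset.sum_congr rfl fun τ _ => ?_
  have : ((sum3 τ).1 + -ζ.1 = 0 ∧ (sum3 τ).2 + -ζ.2 = 0) ↔ sum3 τ = ζ := by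
    rw [Prod.ext_iff, ← sub_eq_add_neg, ← sub_eq_add_neg, sub_eq_zero, sub_eq_zero]
  simp only [this]
  split_ifs
  · field_simp
  · simp

lemma tendsto_cubeSum {L : ℝ} (hL : 0 < L) {a : ℤ × ℤ → ℂ} (ha : Summable fun ξ => ‖a ξ‖)
    (ζ : ℤ × ℤ) :
    Filter.Tendsto (fun S => cubeSum S a ζ) Filter.atTop (nhds (cubeCoeff L a ζ)) := by
  simp only [cubeSum_eq_integral hL, cubeCoeff]
  refine Filter.Tendsto.const_mul _ ?_
  refine tendsto_integral_filter_of_dominated_convergence (fun _ => (∑' ξ, ‖a ξ‖) ^ 3) ?_ ?_ ?_ ?_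
  · refine Filter.Eventually.of_forall fun S => ?_
    have : Continuous (trig L S id a) :=
      continuous_finsetSum S fun ξ _ => continuous_const.mul (continuous_char L _ _)
    exact ((this.pow 3).mul (continuous_char L _ _)).aestronglyMeasurable
  · refine Filter.Eventually.of_forall fun S => Filter.Eventually.of_forall fun p => ?_
    rw [norm_mul, norm_char, mul_one, norm_pow]
    exact pow_le_pow_left₀ (norm_nonneg _) ((norm_trig_le L S id a p).trans
      (ha.sum_le_tsum S fun _ _ => norm_nonneg _)) 3
  · exact integrable_const _
  · refine Filter.Eventually.of_forall fun p => ?_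
    have hs : Summable fun ξ : ℤ × ℤ => a ξ * char L ξ.1 ξ.2 p :=
      Summable.of_norm (by simpa only [norm_mul, norm_char, mul_one] using ha)
    exact (hs.hasSum.pow 3).mul_const _

/-- The constant in the estimate of the cubic truncation error. -/
def cubeConst (L : ℝ) : ℝ := 27 * (2 * Real.pi / L) ^ 4 + 108 * (2 * Real.pi / L) ^ 2 / L ^ 2

lemma gridNorm_cubic_trig_sq_le {L : ℝ} (hL : 0 < L) {N : ℕ} (hN : 0 < N) (o : ℝ × ℝ)
    {S : Finset (ℤ × ℤ)} (hS : Separated N S) {a : ℤ × ℤ → ℂ} {E K : ℝ}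
    (ha : ∑ ξ ∈ S, wt ξ ^ 4 * ‖a ξ‖ ^ 2 ≤ E ^ 2) {c : (ℤ × ℤ) × (ℤ × ℤ) × (ℤ × ℤ) → ℂ}
    (hc : ∀ τ ∈ S ×ˢ S ×ˢ S, ‖c τ‖ ≤ K * (wt τ.1 ^ 2 + wt τ.2.1 ^ 2 + wt τ.2.2 ^ 2)
      * (‖a τ.1‖ * (‖a τ.2.1‖ * ‖a τ.2.2‖))) :
    gridNorm (L / N) N o (trig L (S ×ˢ S ×ˢ S) sum3 c) ^ 2
      ≤ 12 * K ^ 2 * L ^ 2 * wtSum ^ 2 * E ^ 6 := by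
  have h2 : ∑ ξ ∈ S, wt ξ ^ 2 * ‖a ξ‖ ^ 2 ≤ E ^ 2 := by
    refine (Finset.sum_le_sum fun ξ _ => ?_).trans ha
    have := one_le_wt ξ
    gcongr
    norm_num
  have h1 : ∑ ξ ∈ S, ‖a ξ‖ ≤ √(wtSum * E ^ 2) := by
    refine Real.le_sqrt_of_sq_le ((sq_sum_le_wtSum S).trans ?_)
    exact mul_le_mul_of_nonneg_left h2 wtSum_nonneg
  have h3 : ∑ ξ ∈ S, (wt ξ ^ 2 * ‖a ξ‖) ^ 2 ≤ E ^ 2 := by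
    simpa only [mul_pow, ← pow_mul] using ha
  have := gridNorm_trilinear_sq_le hL hN o hS (fun ξ => norm_nonneg (a ξ))
    (fun ξ => norm_nonneg (a ξ)) (fun ξ => norm_nonneg (a ξ)) (fun ξ => sq_nonneg (wt ξ)) hc
    h1 h1 h1 h3 h3 h3
  refine this.trans (le_of_eq ?_)
  rw [Real.sq_sqrt (mul_nonneg wtSum_nonneg (sq_nonneg E))]
  ring

lemma gridNorm_cube_sub_sq_le {L : ℝ} (hL : 0 < L) {N : ℕ} (hN : 0 < N) (hNe : Even N)
    (o : ℝ × ℝ) {a : ℤ × ℤ → ℂ} {E : ℝ} (hE : 0 ≤ E)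
    (ha : ∀ S : Finset (ℤ × ℤ), ∑ ξ ∈ S, wt ξ ^ 4 * ‖a ξ‖ ^ 2 ≤ E ^ 2) :
    gridNorm (L / N) N o (discreteLaplacian (L / N) (fun p => trig L (box N) id a p ^ 3)
      - trig L (box N) id fun ξ => (lapSymbol L ξ : ℂ) * cubeCoeff L a ξ) ^ 2
      ≤ 48 * cubeConst L ^ 2 * L ^ 2 * wtSum ^ 2 * (L / N) ^ 4 * E ^ 6 := by
  have hNr : (0 : ℝ) < N := by exact_mod_cast hN
  have hh : 0 < L / N := by positivity
  set h := L / N with hdef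
  set B := box N
  have hw : ∀ ξ, 0 < wt ξ := wt_pos
  set κ := (2 * Real.pi / L) ^ 2 with hκ
  have hκ0 : 0 ≤ κ := by positivity
  have hκ2 : κ ^ 2 = (2 * Real.pi / L) ^ 4 := by rw [hκ, ← pow_mul]
  have hKc : cubeConst L * h ^ 2 = 27 * κ ^ 2 * h ^ 2 + 27 * κ * (4 / L ^ 2 * h ^ 2) := by
    rw [cubeConst, hκ2]; ring
  -- the part of the cube treated by consistency of the discrete Laplacian
  have hd1 : ∀ τ ∈ B ×ˢ B ×ˢ B,
      ‖((dlapSymbol L h (sum3 τ) - if sum3 τ ∈ B then lapSymbol L (sum3 τ) else 0 : ℝ) : ℂ)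
        * (a τ.1 * (a τ.2.1 * a τ.2.2))‖
      ≤ cubeConst L * h ^ 2 * (wt τ.1 ^ 2 + wt τ.2.1 ^ 2 + wt τ.2.2 ^ 2)
        * (‖a τ.1‖ * (‖a τ.2.1‖ * ‖a τ.2.2‖)) := by
    intro τ _
    rw [norm_mul, norm_mul, norm_mul, Complex.norm_real, Real.norm_eq_abs]
    refine mul_le_mul_of_nonneg_right ?_ (by positivity)
    have hs := wt_sum3_sq_le τ
    set Q := wt τ.1 ^ 2 + wt τ.2.1 ^ 2 + wt τ.2.2 ^ 2
    have hQ : 0 ≤ Q := by positivity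
    rw [hKc]
    split_ifs with hB
    · calc _ ≤ κ ^ 2 * h ^ 2 * wt (sum3 τ) ^ 2 := by
            rw [hκ2]; exact abs_dlapSymbol_sub_le hh L _
        _ ≤ κ ^ 2 * h ^ 2 * (27 * Q) := by gcongr
        _ ≤ _ := by
            have : 0 ≤ 27 * κ * (4 / L ^ 2 * h ^ 2) * Q := by positivity
            linarith
    · have h1 := one_le_of_notMem_box hL hN hNe hB
      rw [sub_zero]
      calc _ ≤ κ * wt (sum3 τ) := abs_dlapSymbol_le hh L _
        _ ≤ κ * wt (sum3 τ) * (4 / L ^ 2 * h ^ 2 * wt (sum3 τ)) :=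
            le_mul_of_one_le_right (mul_nonneg hκ0 (hw _).le) h1
        _ = κ * (4 / L ^ 2 * h ^ 2) * wt (sum3 τ) ^ 2 := by ring
        _ ≤ κ * (4 / L ^ 2 * h ^ 2) * (27 * Q) := by gcongr
        _ ≤ _ := by
            have : 0 ≤ 27 * κ ^ 2 * h ^ 2 * Q := by positivity
            linarith
  have b1 := gridNorm_cubic_trig_sq_le hL hN o (separated_box N) (ha B) hd1
  -- the tail of the Fourier series
  have b2 : ∀ S : Finset (ℤ × ℤ), B ⊆ S →
      gridNorm h N o (trig L B id fun ξ => (lapSymbol L ξ : ℂ) * (cubeSum S a ξ - cubeSum B a ξ)) ^ 2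
        ≤ 12 * (cubeConst L * h ^ 2) ^ 2 * L ^ 2 * wtSum ^ 2 * E ^ 6 := by
    intro S hBS
    obtain ⟨N', hN', hsep⟩ := exists_separated S
    have hsepB : Separated N' B := fun ξ hξ η hη => hsep ξ (hBS hξ) η (hBS hη)
    rw [gridNorm_trig_id_sq hL hN o (separated_box N), ← gridNorm_trig_id_sq hL hN' 0 hsepB]
    have hBS3 : B ×ˢ B ×ˢ B ⊆ S ×ˢ S ×ˢ S :=
      Finset.product_subset_product hBS (Finset.product_subset_product hBS hBS)
    have e : (trig L B id fun ξ => (lapSymbol L ξ : ℂ) * (cubeSum S a ξ - cubeSum B a ξ))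
        = trig L (S ×ˢ S ×ˢ S) sum3 (fun τ => if sum3 τ ∈ B ∧ τ ∉ B ×ˢ B ×ˢ B then
          (lapSymbol L (sum3 τ) : ℂ) * (a τ.1 * (a τ.2.1 * a τ.2.2)) else 0) := by
      simp only [mul_sub]
      rw [← trig_sub, trig_cubeSum, trig_cubeSum]
      ext p
      have hsub : trig L (B ×ˢ B ×ˢ B) sum3 (fun τ => if sum3 τ ∈ B then
          (lapSymbol L (sum3 τ) : ℂ) * (a τ.1 * (a τ.2.1 * a τ.2.2)) else 0) p
          = ∑ τ ∈ S ×ˢ S ×ˢ S, if τ ∈ B ×ˢ B ×ˢ B then (if sum3 τ ∈ B then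
          (lapSymbol L (sum3 τ) : ℂ) * (a τ.1 * (a τ.2.1 * a τ.2.2)) else 0)
            * char L (sum3 τ).1 (sum3 τ).2 p else 0 := by
        rw [← Finset.sum_filter, Finset.filter_mem_eq_inter, Finset.inter_eq_right.2 hBS3, trig]
      rw [Pi.sub_apply, hsub, trig, trig, ← Finset.sum_sub_distrib]
      refine Finset.sum_congr rfl fun τ _ => ?_
      by_cases h1 : sum3 τ ∈ B <;> by_cases h2 : τ ∈ B ×ˢ B ×ˢ B <;> simp only [h1, h2] <;> simp
    rw [e]
    refine gridNorm_cubic_trig_sq_le hL hN' 0 hsep (ha S) fun τ _ => ?_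
    split_ifs with hτ
    · rw [norm_mul, norm_mul, norm_mul, Complex.norm_real, Real.norm_eq_abs]
      refine mul_le_mul_of_nonneg_right ?_ (by positivity)
      have hW : 1 ≤ 4 / L ^ 2 * h ^ 2 * (wt τ.1 + wt τ.2.1 + wt τ.2.2) := by
        have hpos : 0 ≤ 4 / L ^ 2 * h ^ 2 := by positivity
        have hle : ∀ x, x ≤ wt τ.1 + wt τ.2.1 + wt τ.2.2 → 1 ≤ 4 / L ^ 2 * h ^ 2 * x →
            1 ≤ 4 / L ^ 2 * h ^ 2 * (wt τ.1 + wt τ.2.1 + wt τ.2.2) := fun x hx h1 =>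
          h1.trans (mul_le_mul_of_nonneg_left hx hpos)
        have hout : τ.1 ∉ B ∨ τ.2.1 ∉ B ∨ τ.2.2 ∉ B := by
          by_contra hcon
          push Not at hcon
          exact hτ.2 (Finset.mem_product.2 ⟨hcon.1, Finset.mem_product.2 hcon.2⟩)
        have w1 := hw τ.1
        have w2 := hw τ.2.1
        have w3 := hw τ.2.2
        rcases hout with h1 | h1 | h1
        · exact hle _ (by linarith) (one_le_of_notMem_box hL hN hNe h1)
        · exact hle _ (by linarith) (one_le_of_notMem_box hL hN hNe h1)
        · exact hle _ (by linarith) (one_le_of_notMem_box hL hN hNe h1)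
      set W := wt τ.1 + wt τ.2.1 + wt τ.2.2
      have hW0 : 0 ≤ W := by have := hw τ.1; have := hw τ.2.1; have := hw τ.2.2; positivity
      have hW2 : W ^ 2 ≤ 3 * (wt τ.1 ^ 2 + wt τ.2.1 ^ 2 + wt τ.2.2 ^ 2) := by
        simp only [W]
        nlinarith [sq_nonneg (wt τ.1 - wt τ.2.1), sq_nonneg (wt τ.2.1 - wt τ.2.2),
          sq_nonneg (wt τ.1 - wt τ.2.2)]
      set Q := wt τ.1 ^ 2 + wt τ.2.1 ^ 2 + wt τ.2.2 ^ 2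
      have hQ : 0 ≤ Q := by positivity
      rw [hKc]
      calc _ ≤ κ * wt (sum3 τ) := abs_lapSymbol_le L _
        _ ≤ κ * (3 * W) := mul_le_mul_of_nonneg_left (wt_sum3_le τ) hκ0
        _ ≤ κ * (3 * W) * (4 / L ^ 2 * h ^ 2 * W) := le_mul_of_one_le_right (by positivity) hW
        _ = 3 * κ * (4 / L ^ 2 * h ^ 2) * W ^ 2 := by ring
        _ ≤ 3 * κ * (4 / L ^ 2 * h ^ 2) * (3 * Q) := by gcongr
        _ ≤ _ := by
            have h1 : 0 ≤ 27 * κ ^ 2 * h ^ 2 * Q := by positivity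
            have h2 : 0 ≤ 18 * κ * (4 / L ^ 2 * h ^ 2) * Q := by positivity
            linarith
    · rw [norm_zero]
      unfold cubeConst
      positivity
  have hsum : Summable fun ξ => ‖a ξ‖ := Summable.of_nonneg_of_le (fun _ => norm_nonneg _)
    (norm_le_of_sum_wt_le hE ha) (summable_wt.mul_left E)
  have b3 : gridNorm h N o (trig L B id fun ξ => (lapSymbol L ξ : ℂ)
      * (cubeCoeff L a ξ - cubeSum B a ξ)) ^ 2
        ≤ 12 * (cubeConst L * h ^ 2) ^ 2 * L ^ 2 * wtSum ^ 2 * E ^ 6 := by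
    have ht : Filter.Tendsto (fun S => gridNorm h N o (trig L B id fun ξ => (lapSymbol L ξ : ℂ)
        * (cubeSum S a ξ - cubeSum B a ξ)) ^ 2) Filter.atTop (nhds (gridNorm h N o (trig L B id
          fun ξ => (lapSymbol L ξ : ℂ) * (cubeCoeff L a ξ - cubeSum B a ξ)) ^ 2)) := by
      have hP : ∀ c, gridNorm h N o (trig L B id c) ^ 2 = L ^ 2 * ∑ ξ ∈ B, ‖c ξ‖ ^ 2 :=
        gridNorm_trig_id_sq hL hN o (separated_box N)
      simp only [hP]
      refine Filter.Tendsto.const_mul _ (tendsto_finsetSum _ fun ξ _ => ?_)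
      exact (((tendsto_cubeSum hL hsum ξ).sub_const _).const_mul _).norm.pow 2
    refine le_of_tendsto ht ?_
    filter_upwards [Filter.eventually_ge_atTop B] with S hS using b2 S hS
  have e : discreteLaplacian h (fun p => trig L B id a p ^ 3)
      - (trig L B id fun ξ => (lapSymbol L ξ : ℂ) * cubeCoeff L a ξ)
      = trig L (B ×ˢ B ×ˢ B) sum3 (fun τ => ((dlapSymbol L h (sum3 τ)
          - if sum3 τ ∈ B then lapSymbol L (sum3 τ) else 0 : ℝ) : ℂ)
          * (a τ.1 * (a τ.2.1 * a τ.2.2)))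
        + (-1 : ℂ) • trig L B id fun ξ => (lapSymbol L ξ : ℂ)
          * (cubeCoeff L a ξ - cubeSum B a ξ) := by
    have e1 : (fun p => trig L B id a p ^ 3) = trig L (B ×ˢ B ×ˢ B) sum3
        (fun τ => a τ.1 * (a τ.2.1 * a τ.2.2)) := by
      ext p; rw [← trig_mul_mul]; ring
    have e2 : (fun τ : (ℤ × ℤ) × (ℤ × ℤ) × (ℤ × ℤ) => ((dlapSymbol L h (sum3 τ)
          - if sum3 τ ∈ B then lapSymbol L (sum3 τ) else 0 : ℝ) : ℂ)
          * (a τ.1 * (a τ.2.1 * a τ.2.2))) = fun τ => (dlapSymbol L h (sum3 τ) : ℂ)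
          * (a τ.1 * (a τ.2.1 * a τ.2.2)) - if sum3 τ ∈ B then
            (lapSymbol L (sum3 τ) : ℂ) * (a τ.1 * (a τ.2.1 * a τ.2.2)) else 0 := by
      ext τ; split_ifs <;> push_cast <;> ring
    have e3 := trig_cubeSum L B B a fun ξ => (lapSymbol L ξ : ℂ)
    rw [e1, discreteLaplacian_trig, e2, ← trig_sub, ← e3]
    simp only [mul_sub]
    rw [← trig_sub]
    ext p
    simp only [Pi.sub_apply, Pi.add_apply, Pi.smul_apply, smul_eq_mul]
    ring
  rw [e]
  refine (gridNorm_add_sq_le _ _ _ _ _).trans ?_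
  rw [gridNorm_smul_sq, norm_neg, norm_one, one_pow, one_mul]
  refine (add_le_add (mul_le_mul_of_nonneg_left b1 (by norm_num))
    (mul_le_mul_of_nonneg_left b3 (by norm_num))).trans (le_of_eq ?_)
  ring

/-! ### Time truncation error of the cubic term -/

lemma norm_add_sq_le (a b : ℂ) : ‖a + b‖ ^ 2 ≤ 2 * ‖a‖ ^ 2 + 2 * ‖b‖ ^ 2 := by
  refine (pow_le_pow_left₀ (norm_nonneg _) (norm_add_le a b) 2).trans ?_
  nlinarith [sq_nonneg (‖a‖ - ‖b‖)]

lemma sum_wt_two_le {S : Finset (ℤ × ℤ)} {a : ℤ × ℤ → ℂ} {E : ℝ}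
    (ha : ∑ ξ ∈ S, wt ξ ^ 4 * ‖a ξ‖ ^ 2 ≤ E ^ 2) : ∑ ξ ∈ S, wt ξ ^ 2 * ‖a ξ‖ ^ 2 ≤ E ^ 2 := by
  refine (Finset.sum_le_sum fun ξ _ => ?_).trans ha
  have := one_le_wt ξ
  gcongr
  norm_num

lemma gridNorm_time_cubic_sq_le {L : ℝ} (hL : 0 < L) {N : ℕ} (hN : 0 < N) (o : ℝ × ℝ)
    {S : Finset (ℤ × ℤ)} (hS : Separated N S) {a b : ℤ × ℤ → ℂ} {E W : ℝ}
    (ha : ∑ ξ ∈ S, wt ξ ^ 4 * ‖a ξ‖ ^ 2 ≤ E ^ 2) (hb : ∑ ξ ∈ S, wt ξ ^ 4 * ‖b ξ‖ ^ 2 ≤ E ^ 2)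
    (hW : ∑ ξ ∈ S, wt ξ ^ 2 * ‖a ξ - b ξ‖ ^ 2 ≤ W) :
    gridNorm (L / N) N o (discreteLaplacian (L / N) fun p =>
      (trig L S id a p + trig L S id b p) * (trig L S id a p - trig L S id b p) ^ 2 / 4) ^ 2
      ≤ 27 * (2 * Real.pi / L) ^ 4 * L ^ 2 * wtSum ^ 2 * (E * W) ^ 2 := by
  have hNr : (0 : ℝ) < N := by exact_mod_cast hN
  have hh : 0 < L / N := by positivity
  have hW0 : 0 ≤ W := le_trans (Finset.sum_nonneg fun ξ _ => by have := wt_pos ξ; positivity) hW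
  have hMx : ∑ ξ ∈ S, (wt ξ * ‖a ξ + b ξ‖) ^ 2 ≤ 4 * E ^ 2 := by
    have h1 := sum_wt_two_le ha
    have h2 := sum_wt_two_le hb
    calc _ ≤ ∑ ξ ∈ S, (2 * (wt ξ ^ 2 * ‖a ξ‖ ^ 2) + 2 * (wt ξ ^ 2 * ‖b ξ‖ ^ 2)) := by
          refine Finset.sum_le_sum fun ξ _ => ?_
          rw [mul_pow]
          have := mul_le_mul_of_nonneg_left (norm_add_sq_le (a ξ) (b ξ)) (sq_nonneg (wt ξ))
          linarith
      _ ≤ _ := by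
          rw [Finset.sum_add_distrib, ← Finset.mul_sum, ← Finset.mul_sum]; linarith
  have hMy : ∑ ξ ∈ S, (wt ξ * ‖a ξ - b ξ‖) ^ 2 ≤ W := by simpa only [mul_pow] using hW
  have hNx : ∑ ξ ∈ S, ‖a ξ + b ξ‖ ≤ √(wtSum * (4 * E ^ 2)) := by
    refine Real.le_sqrt_of_sq_le ((sq_sum_le_wtSum S).trans ?_)
    exact mul_le_mul_of_nonneg_left (by simpa only [mul_pow] using hMx) wtSum_nonneg
  have hNy : ∑ ξ ∈ S, ‖a ξ - b ξ‖ ≤ √(wtSum * W) := by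
    refine Real.le_sqrt_of_sq_le ((sq_sum_le_wtSum S).trans ?_)
    exact mul_le_mul_of_nonneg_left hW wtSum_nonneg
  have e : (fun p => (trig L S id a p + trig L S id b p)
      * (trig L S id a p - trig L S id b p) ^ 2 / 4) = trig L (S ×ˢ S ×ˢ S) sum3 (fun τ => 1 / 4 *
        ((a τ.1 + b τ.1) * ((a τ.2.1 - b τ.2.1) * (a τ.2.2 - b τ.2.2)))) := by
    rw [← smul_trig]
    ext p
    rw [Pi.smul_apply, ← trig_mul_mul L S (fun ξ => a ξ + b ξ) (fun ξ => a ξ - b ξ)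
      (fun ξ => a ξ - b ξ), ← trig_add, ← trig_sub, smul_eq_mul, Pi.add_apply, Pi.sub_apply]
    ring
  rw [e, discreteLaplacian_trig]
  refine (gridNorm_trilinear_sq_le hL hN o hS (fun ξ => norm_nonneg (a ξ + b ξ))
    (fun ξ => norm_nonneg (a ξ - b ξ)) (fun ξ => norm_nonneg (a ξ - b ξ))
    (fun ξ => (wt_pos ξ).le) (K := 3 / 4 * (2 * Real.pi / L) ^ 2) (fun τ _ => ?_)
    hNx hNy hNy hMx hMy hMy).trans (le_of_eq ?_)
  · rw [norm_mul, norm_mul, norm_mul, norm_mul, Complex.norm_real, Real.norm_eq_abs, ← mul_assoc]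
    refine mul_le_mul_of_nonneg_right ?_ (by positivity)
    have h1 := abs_dlapSymbol_le hh L (sum3 τ)
    have h2 := wt_sum3_le τ
    have h4 : ‖(1 / 4 : ℂ)‖ = 1 / 4 := by norm_num
    rw [h4]
    have h3 := mul_le_mul_of_nonneg_left h2 (sq_nonneg (2 * Real.pi / L))
    linarith
  · rw [Real.sq_sqrt (mul_nonneg wtSum_nonneg (by positivity : 0 ≤ 4 * E ^ 2)),
      Real.sq_sqrt (mul_nonneg wtSum_nonneg hW0)]
    ring

/-! ### Bounds on the modes -/

lemma intervalIntegral_le_Ioo {T : ℝ} {g : ℝ → ℝ} (hg : IntegrableOn g (Ioo 0 T))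
    (h0 : ∀ x, 0 ≤ g x) {a b : ℝ} (ha : 0 ≤ a) (hab : a ≤ b) (hb : b ≤ T) :
    ∫ x in a..b, g x ≤ ∫ x in Ioo 0 T, g x := by
  rw [intervalIntegral.integral_of_le hab, integral_Ioc_eq_integral_Ioo]
  exact setIntegral_mono_set hg (Filter.Eventually.of_forall h0)
    (Ioo_subset_Ioo ha hb).eventuallyLE

lemma IsPrimitive.norm_sub_sq_le_Ioo {T : ℝ} {u v : ℝ → ℂ} (h : IsPrimitive T u v)
    (hv2 : IntegrableOn (fun x => ‖v x‖ ^ 2) (Ioo 0 T)) {x y δ : ℝ} (hx : x ∈ Icc 0 T)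
    (hy : y ∈ Icc 0 T) (hδ : |x - y| ≤ δ) :
    ‖u x - u y‖ ^ 2 ≤ δ * ∫ t in Ioo 0 T, ‖v t‖ ^ 2 := by
  wlog hxy : y ≤ x generalizing x y with H
  · rw [norm_sub_rev]
    exact H hy hx (by rwa [abs_sub_comm]) (le_of_not_ge hxy)
  have h0 : ∀ t, 0 ≤ ‖v t‖ ^ 2 := fun t => by positivity
  refine (h.norm_sub_sq_le hv2 hy.1 hxy le_rfl hx.2).trans ?_
  rw [abs_of_nonneg (by linarith)] at hδ
  have := intervalIntegral_le_Ioo hv2 h0 hy.1 hxy hx.2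
  have := intervalIntegral.integral_nonneg (μ := volume) hxy fun t _ => h0 t
  have : 0 ≤ δ := (sub_nonneg.2 hxy).trans hδ
  gcongr

lemma sum_mul_integral_sq {T : ℝ} {g : ℤ × ℤ → ℝ → ℂ}
    (hg : ∀ ξ, IntegrableOn (fun t => ‖g ξ t‖ ^ 2) (Ioo 0 T)) (S : Finset (ℤ × ℤ))
    (w : ℤ × ℤ → ℝ) :
    ∑ ξ ∈ S, w ξ * ∫ t in Ioo 0 T, ‖g ξ t‖ ^ 2 = ∫ t in Ioo 0 T, ∑ ξ ∈ S, w ξ * ‖g ξ t‖ ^ 2 := by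
  rw [integral_finsetSum _ fun ξ _ => (hg ξ).const_mul _]
  simp only [integral_const_mul]

section Modes

variable {α β L T A D E F G : ℝ} {f f₁ f₂ f₃ f₄ : ℤ × ℤ → ℝ → ℂ}

lemma IsModes.hasDeriv₁ (h : IsModes α β L T f f₁ f₂ f₃ f₄ A D E F G) (hT : 0 < T) (ξ : ℤ × ℤ) :
    ∀ t ∈ Icc 0 T, HasDerivWithinAt (f ξ) (f₁ ξ t) (Icc 0 T) t := fun _ ht =>
  (h.prim₁ ξ).hasDerivWithinAt ((h.prim₂ ξ).continuousOn hT) ht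

lemma IsModes.hasDeriv₂ (h : IsModes α β L T f f₁ f₂ f₃ f₄ A D E F G) (hT : 0 < T) (ξ : ℤ × ℤ) :
    ∀ t ∈ Icc 0 T, HasDerivWithinAt (f₁ ξ) (f₂ ξ t) (Icc 0 T) t := fun _ ht =>
  (h.prim₂ ξ).hasDerivWithinAt ((h.prim₃ ξ).continuousOn hT) ht

lemma IsModes.hasDeriv₃ (h : IsModes α β L T f f₁ f₂ f₃ f₄ A D E F G) (hT : 0 < T) (ξ : ℤ × ℤ) :
    ∀ t ∈ Icc 0 T, HasDerivWithinAt (f₂ ξ) (f₃ ξ t) (Icc 0 T) t := fun _ ht =>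
  (h.prim₃ ξ).hasDerivWithinAt ((h.prim₄ ξ).continuousOn hT) ht

/-- A Landau type inequality for the time derivative of the modes. -/
lemma IsModes.sum_velocity_le (h : IsModes α β L T f f₁ f₂ f₃ f₄ A D E F G) (hT : 0 < T) {δ : ℝ}
    (hδ : 0 < δ) (hδT : δ ≤ T) {t : ℝ} (ht : t ∈ Icc 0 T) (S : Finset (ℤ × ℤ)) :
    ∑ ξ ∈ S, wt ξ ^ 2 * ‖f₁ ξ t‖ ^ 2 ≤ 8 * E ^ 2 / δ ^ 2 + 2 * δ * F ^ 2 := by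
  obtain ⟨r, hr0, hrt, htr, hrT⟩ : ∃ r, 0 ≤ r ∧ r ≤ t ∧ t ≤ r + δ ∧ r + δ ≤ T := by
    rcases le_total t (T - δ) with h1 | h1
    · exact ⟨t, ht.1, le_rfl, by linarith, by linarith⟩
    · exact ⟨T - δ, by linarith, h1, by linarith [ht.2], by linarith⟩
  have hp : ∀ ξ, ‖f₁ ξ t‖ ^ 2 ≤ 4 * (‖f ξ (r + δ)‖ ^ 2 + ‖f ξ r‖ ^ 2) / δ ^ 2
      + 2 * δ * ∫ x in Ioo 0 T, ‖f₂ ξ x‖ ^ 2 := by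
    intro ξ
    set J := ∫ x in Ioo 0 T, ‖f₂ ξ x‖ ^ 2
    have hJ : 0 ≤ J := setIntegral_nonneg measurableSet_Ioo fun x _ => by positivity
    have hm : ∀ x ∈ Icc r (r + δ), ‖f₁ ξ x - f₁ ξ t‖ ≤ √(δ * J) := fun x hx =>
      Real.le_sqrt_of_sq_le ((h.prim₂ ξ).norm_sub_sq_le_Ioo (h.sq₂ ξ)
        ⟨hr0.trans hx.1, hx.2.trans hrT⟩ ht (by rw [abs_le]; constructor <;> linarith [hx.1, hx.2]))
    have hd : ∀ x : ℝ, HasDerivAt (fun x : ℝ => f ξ r + ((x - r : ℝ) : ℂ) * f₁ ξ t) (f₁ ξ t) x := by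
      intro x
      have h1 : HasDerivAt (fun x : ℝ => ((x - r : ℝ) : ℂ)) 1 x := by
        simpa using ((hasDerivAt_id x).sub_const r).ofReal_comp
      simpa using (h1.mul_const (f₁ ξ t)).const_add (f ξ r)
    have h1 := norm_sub_le_of_hasDerivWithinAt (h.hasDeriv₁ hT ξ) hd hr0 hδ hrT (by simp) hm
      (r + δ) ⟨by linarith, le_rfl⟩
    simp only [add_sub_cancel_left] at h1
    have h2 := pow_le_pow_left₀ (norm_nonneg _) h1 2
    rw [mul_pow, Real.sq_sqrt (by positivity)] at h2
    have e : (δ : ℂ) * f₁ ξ t = (f ξ (r + δ) - f ξ r)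
        + -(f ξ (r + δ) - (f ξ r + (δ : ℂ) * f₁ ξ t)) := by ring
    have h3 := norm_add_sq_le (f ξ (r + δ) - f ξ r) (-(f ξ (r + δ) - (f ξ r + (δ : ℂ) * f₁ ξ t)))
    rw [← e, norm_mul, Complex.norm_real, Real.norm_of_nonneg hδ.le, mul_pow, norm_neg] at h3
    have h4 := norm_add_sq_le (f ξ (r + δ)) (-f ξ r)
    rw [norm_neg, ← sub_eq_add_neg] at h4
    have h5 : 4 * (‖f ξ (r + δ)‖ ^ 2 + ‖f ξ r‖ ^ 2) / δ ^ 2 + 2 * δ * J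
        = (4 * (‖f ξ (r + δ)‖ ^ 2 + ‖f ξ r‖ ^ 2) + 2 * (δ * J * δ ^ 2)) / δ ^ 2 := by
      field_simp
    rw [h5, le_div_iff₀ (by positivity)]
    linarith
  have b1 := sum_wt_two_le (h.boundE (r + δ) ⟨by linarith, hrT⟩ S)
  have b2 := sum_wt_two_le (h.boundE r ⟨hr0, by linarith⟩ S)
  have b3 := h.boundF S
  rw [← sum_mul_integral_sq h.sq₂ S fun ξ => wt ξ ^ 2] at b3
  calc _ ≤ ∑ ξ ∈ S, (4 / δ ^ 2 * (wt ξ ^ 2 * ‖f ξ (r + δ)‖ ^ 2)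
        + 4 / δ ^ 2 * (wt ξ ^ 2 * ‖f ξ r‖ ^ 2)
        + 2 * δ * (wt ξ ^ 2 * ∫ x in Ioo 0 T, ‖f₂ ξ x‖ ^ 2)) := by
        refine Finset.sum_le_sum fun ξ _ => ?_
        refine (mul_le_mul_of_nonneg_left (hp ξ) (sq_nonneg (wt ξ))).trans (le_of_eq ?_)
        ring
    _ = 4 / δ ^ 2 * (∑ ξ ∈ S, wt ξ ^ 2 * ‖f ξ (r + δ)‖ ^ 2)
        + 4 / δ ^ 2 * (∑ ξ ∈ S, wt ξ ^ 2 * ‖f ξ r‖ ^ 2)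
        + 2 * δ * ∑ ξ ∈ S, wt ξ ^ 2 * ∫ x in Ioo 0 T, ‖f₂ ξ x‖ ^ 2 := by
        rw [Finset.sum_add_distrib, Finset.sum_add_distrib, Finset.mul_sum, Finset.mul_sum,
          Finset.mul_sum]
    _ ≤ 4 / δ ^ 2 * E ^ 2 + 4 / δ ^ 2 * E ^ 2 + 2 * δ * F ^ 2 := by gcongr
    _ = _ := by ring

/-- The choice of the time scale in the Landau type inequality. -/
lemma exists_scale {T E F : ℝ} (hT : 0 < T) (hE : 0 ≤ E) (hF : 0 ≤ F) :
    ∃ δ, 0 < δ ∧ δ ≤ T ∧ E * (8 * E ^ 2 / δ ^ 2 + 2 * δ * F ^ 2)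
      ≤ (8 / T ^ 2 + 2 * T + 10) * (E ^ 3 * (1 + F ^ 2) + F) := by
  have hT2 : 0 ≤ 8 / T ^ 2 := by positivity
  have hE3 : 0 ≤ E ^ 3 := by positivity
  have hEF : 0 ≤ E ^ 3 * F ^ 2 := by positivity
  rcases le_or_gt 1 E with h1 | h1
  · refine ⟨T, hT, le_rfl, ?_⟩
    have h2 : E * F ^ 2 ≤ E ^ 3 * F ^ 2 :=
      mul_le_mul_of_nonneg_right (le_self_pow₀ h1 (by norm_num)) (sq_nonneg F)
    calc _ = 8 / T ^ 2 * E ^ 3 + 2 * T * (E * F ^ 2) := by ring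
      _ ≤ 8 / T ^ 2 * E ^ 3 + 2 * T * (E ^ 3 * F ^ 2) := by gcongr
      _ ≤ _ := by
        have := mul_nonneg hT2 hEF
        have := mul_nonneg hT.le hE3
        have := mul_nonneg hT2 hF
        have := mul_nonneg hT.le hF
        linarith
  · rcases le_or_gt (E * F * T) 1 with h2 | h2
    · refine ⟨T, hT, le_rfl, ?_⟩
      calc _ = 8 / T ^ 2 * E ^ 3 + 2 * (E * F * T) * F := by ring
        _ ≤ 8 / T ^ 2 * E ^ 3 + 2 * 1 * F := by gcongr
        _ ≤ _ := by
          have := mul_nonneg hT2 hEF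
          have := mul_nonneg hT.le hE3
          have := mul_nonneg hT.le hEF
          have := mul_nonneg hT2 hF
          have := mul_nonneg hT.le hF
          linarith
    · have hEFp : 0 < E * F := by
        by_contra hcon
        have : E * F = 0 := le_antisymm (not_lt.1 hcon) (mul_nonneg hE hF)
        rw [this, zero_mul] at h2
        linarith
      refine ⟨(E * F)⁻¹, by positivity, ?_, ?_⟩
      · rw [inv_le_iff_one_le_mul₀' hEFp]; exact h2.le
      · have h3 : E * (8 * E ^ 2 / (E * F)⁻¹ ^ 2 + 2 * (E * F)⁻¹ * F ^ 2)
            = 8 * (E ^ 2 * (E ^ 3 * F ^ 2)) + 2 * F := by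
          have hE0 : E ≠ 0 := left_ne_zero_of_mul hEFp.ne'
          have hF0 : F ≠ 0 := right_ne_zero_of_mul hEFp.ne'
          field_simp
        have h4 : E ^ 2 * (E ^ 3 * F ^ 2) ≤ 1 * (E ^ 3 * F ^ 2) :=
          mul_le_mul_of_nonneg_right (pow_le_one₀ hE h1.le) hEF
        rw [h3]
        have := mul_nonneg hT2 hEF
        have := mul_nonneg hT.le hE3
        have := mul_nonneg hT.le hEF
        have := mul_nonneg hT2 hF
        have := mul_nonneg hT.le hF
        have := mul_nonneg hT2 hE3
        linarith

lemma IsModes.sum_increment_le (h : IsModes α β L T f f₁ f₂ f₃ f₄ A D E F G) (hT : 0 < T) {V : ℝ}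
    {S : Finset (ℤ × ℤ)} (hV : ∀ t ∈ Icc 0 T, ∑ ξ ∈ S, wt ξ ^ 2 * ‖f₁ ξ t‖ ^ 2 ≤ V) {a s : ℝ}
    (ha : 0 ≤ a) (hs : 0 < s) (has : a + s ≤ T) :
    ∑ ξ ∈ S, wt ξ ^ 2 * ‖f ξ (a + s) - f ξ a‖ ^ 2 ≤ s ^ 2 * V := by
  have hc : ∀ ξ, IntegrableOn (fun x => ‖f₁ ξ x‖ ^ 2) (Ioo 0 T) := fun ξ =>
    (((h.prim₂ ξ).continuousOn hT).norm.pow 2).integrableOn_Icc.mono_set Ioo_subset_Icc_self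
  have hi : ∀ ξ, IntervalIntegrable (fun x => ‖f₁ ξ x‖ ^ 2) volume a (a + s) := fun ξ =>
    intervalIntegrable_of_mem (hc ξ) ⟨ha, by linarith⟩ ⟨by linarith, has⟩
  calc _ ≤ ∑ ξ ∈ S, wt ξ ^ 2 * (s * ∫ x in a..a + s, ‖f₁ ξ x‖ ^ 2) := by
        refine Finset.sum_le_sum fun ξ _ => mul_le_mul_of_nonneg_left ?_ (sq_nonneg _)
        simpa using (h.prim₁ ξ).norm_sub_sq_le (hc ξ) ha (by linarith) le_rfl has
    _ = s * ∫ x in a..a + s, ∑ ξ ∈ S, wt ξ ^ 2 * ‖f₁ ξ x‖ ^ 2 := by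
        rw [intervalIntegral.integral_finsetSum fun ξ _ => (hi ξ).const_mul _, Finset.mul_sum]
        refine Finset.sum_congr rfl fun ξ _ => ?_
        rw [intervalIntegral.integral_const_mul]; ring
    _ ≤ s * ∫ _ in a..a + s, V := by
        refine mul_le_mul_of_nonneg_left ?_ hs.le
        exact intervalIntegral.integral_mono_on (by linarith)
          (intervalIntegrable_of_mem (integrable_finsetSum S fun ξ _ => (hc ξ).const_mul _)
            ⟨ha, by linarith⟩ ⟨by linarith, has⟩) intervalIntegrable_const
          fun x hx => hV x ⟨ha.trans hx.1, hx.2.trans has⟩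
    _ = _ := by simp; ring

end Modes

/-! ### Summation over the time steps -/

lemma mul_floor_le {T s : ℝ} (hT : 0 < T) (hs : 0 < s) : s * (⌊T / s⌋₊ : ℝ) ≤ T := by
  have := Nat.floor_le (div_nonneg hT.le hs.le)
  rwa [le_div_iff₀ hs, mul_comm] at this

lemma step_le {T s : ℝ} (hT : 0 < T) (hs : 0 < s) {k : ℕ} (hk : k < ⌊T / s⌋₊) :
    s * k + s ≤ T := by
  have h1 : ((k + 1 : ℕ) : ℝ) ≤ (⌊T / s⌋₊ : ℝ) := by exact_mod_cast hk
  have h2 := mul_le_mul_of_nonneg_left h1 hs.le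
  push_cast at h2
  linarith [mul_floor_le hT hs]

/-- The energy of a mode over a time step. -/
def stepEnergy (s : ℝ) (v : ℝ → ℂ) (k : ℕ) : ℝ := ∫ x in s * k..s * k + s, ‖v x‖ ^ 2

lemma stepEnergy_nonneg {s : ℝ} (hs : 0 < s) (v : ℝ → ℂ) (k : ℕ) : 0 ≤ stepEnergy s v k :=
  integral_norm_sq_nonneg v hs

lemma sum_stepEnergy_le {T s : ℝ} (hT : 0 < T) (hs : 0 < s) {v : ℝ → ℂ}
    (hv : IntegrableOn (fun x => ‖v x‖ ^ 2) (Ioo 0 T)) :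
    ∑ k ∈ Finset.range ⌊T / s⌋₊, stepEnergy s v k ≤ ∫ x in Ioo 0 T, ‖v x‖ ^ 2 := by
  have h1 := intervalIntegral.sum_integral_adjacent_intervals (μ := volume)
    (f := fun x => ‖v x‖ ^ 2) (a := fun k : ℕ => s * k) (n := ⌊T / s⌋₊) fun k hk => by
      refine intervalIntegrable_of_mem hv ⟨by positivity, ?_⟩ ⟨by positivity, ?_⟩
      · linarith [step_le hT hs hk]
      · push_cast; linarith [step_le hT hs hk]
  have h2 : ∀ k : ℕ, stepEnergy s v k = ∫ x in s * k..s * ((k + 1 : ℕ) : ℝ), ‖v x‖ ^ 2 := by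
    intro k; rw [stepEnergy]; congr 1; push_cast; ring
  simp only [h2, h1]
  exact intervalIntegral_le_Ioo hv (fun x => by positivity) (by simp) (by simp; positivity)
    (mul_floor_le hT hs)

lemma sum_sum_stepEnergy_le {T s : ℝ} (hT : 0 < T) (hs : 0 < s) {g : ℤ × ℤ → ℝ → ℂ}
    (hg : ∀ ξ, IntegrableOn (fun t => ‖g ξ t‖ ^ 2) (Ioo 0 T)) {S : Finset (ℤ × ℤ)}
    {w : ℤ × ℤ → ℝ} (hw : ∀ ξ, 0 ≤ w ξ) {B : ℝ}
    (hB : ∫ t in Ioo 0 T, ∑ ξ ∈ S, w ξ * ‖g ξ t‖ ^ 2 ≤ B) :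
    ∑ k ∈ Finset.range ⌊T / s⌋₊, ∑ ξ ∈ S, w ξ * stepEnergy s (g ξ) k ≤ B := by
  rw [Finset.sum_comm]
  refine le_trans (Finset.sum_le_sum fun ξ _ => ?_) ((sum_mul_integral_sq hg S w).trans_le hB)
  rw [← Finset.mul_sum]
  exact mul_le_mul_of_nonneg_left (sum_stepEnergy_le hT hs (hg ξ)) (hw ξ)

lemma sum_range_pred_le {a : ℕ → ℝ} (ha : ∀ k, 0 ≤ a k) (K : ℕ) :
    ∑ k ∈ Finset.range K, a (k - 1) ≤ 2 * ∑ k ∈ Finset.range K, a k := by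
  cases K with
  | zero => simp
  | succ n =>
    rw [Finset.sum_range_succ', two_mul]
    simp only [Nat.add_sub_cancel, Nat.zero_sub]
    have h1 : ∑ k ∈ Finset.range n, a k ≤ ∑ k ∈ Finset.range (n + 1), a k :=
      Finset.sum_le_sum_of_subset_of_nonneg (Finset.range_mono (Nat.le_succ n)) fun _ _ _ => ha _
    have h2 : a 0 ≤ ∑ k ∈ Finset.range (n + 1), a k :=
      Finset.single_le_sum (fun k _ => ha k) (Finset.mem_range.2 (Nat.succ_pos n))
    linarith

/-! ### The residual of the first equation -/

/-- The residual of the first equation of the scheme. -/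
def residual (α β s h : ℝ) (φm φ φp ψ ψp : ℝ × ℝ → ℂ) (p : ℝ × ℝ) : ℂ :=
  (β : ℂ) * ((ψp p - ψ p) / s)
    - discreteLaplacian h
        (chi φp φ + ((α : ℂ) / 2) • (φp + φ) + discreteLaplacian h ((3 : ℂ) • φ - φm)) p
    - 1 / 2 * discreteLaplacian h (discreteLaplacian h (discreteLaplacian h (φp + φ))) p
    + (φp p - φ p) / s

/-- The contribution of the discrete Laplacian to the linear residual of a mode. -/
def spaceError (α μ lam : ℝ) (fm f fp : ℂ) : ℂ :=
  -((α * (μ - lam) : ℝ) : ℂ) * ((fp + f) / 2) - ((μ ^ 2 - lam ^ 2 : ℝ) : ℂ) * (3 * f - fm)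
    - ((μ ^ 3 - lam ^ 3 : ℝ) : ℂ) * ((fp + f) / 2)

/-- The linear residual of a mode, where `g`, `k`, `l` stand for its time derivatives. -/
def linError (α β s μ lam : ℝ) (fm f fp g gp k kp l lp : ℂ) : ℂ :=
  (β * (((gp - (s : ℂ) ^ 2 / 12 * lp) - (g - (s : ℂ) ^ 2 / 12 * l)) / s - (kp + k) / 2)
    + ((fp - f) / s - (gp + g) / 2))
  + (spaceError α μ lam fm f fp + (lam : ℂ) ^ 2 * (fp - 2 * f + fm))

/-- The residual of the cubic term at one time. -/
def cubeError (L : ℝ) (N : ℕ) (a : ℤ × ℤ → ℂ) : ℝ × ℝ → ℂ :=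
  discreteLaplacian (L / N) (fun p => trig L (box N) id a p ^ 3)
    - trig L (box N) id fun ξ => (lapSymbol L ξ : ℂ) * cubeCoeff L a ξ

lemma chi_eq (φ ψ : ℝ × ℝ → ℂ) :
    chi ψ φ = (1 / 2 : ℂ) • (fun p => φ p ^ 3) + ((1 / 2 : ℂ) • (fun p => ψ p ^ 3)
      + (-1 : ℂ) • fun p => (ψ p + φ p) * (ψ p - φ p) ^ 2 / 4) := by
  ext p
  simp only [chi, Pi.add_apply, Pi.smul_apply, smul_eq_mul]
  ring

lemma residual_eq {α β L s : ℝ} {N : ℕ} {fm f fp g gp k kp l lp : ℤ × ℤ → ℂ}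
    (heq : ∀ ξ, β * k ξ + g ξ = lapSymbol L ξ * (cubeCoeff L f ξ + α * f ξ
      + 2 * (lapSymbol L ξ * f ξ) + lapSymbol L ξ * (lapSymbol L ξ * f ξ)))
    (heqp : ∀ ξ, β * kp ξ + gp ξ = lapSymbol L ξ * (cubeCoeff L fp ξ + α * fp ξ
      + 2 * (lapSymbol L ξ * fp ξ) + lapSymbol L ξ * (lapSymbol L ξ * fp ξ))) :
    residual α β s (L / N) (trig L (box N) id fm) (trig L (box N) id f) (trig L (box N) id fp)
      (trig L (box N) id fun ξ => g ξ - (s : ℂ) ^ 2 / 12 * l ξ)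
      (trig L (box N) id fun ξ => gp ξ - (s : ℂ) ^ 2 / 12 * lp ξ)
    = ((trig L (box N) id fun ξ => linError α β s (dlapSymbol L (L / N) ξ) (lapSymbol L ξ)
        (fm ξ) (f ξ) (fp ξ) (g ξ) (gp ξ) (k ξ) (kp ξ) (l ξ) (lp ξ))
      + discreteLaplacian (L / N) (fun p => (trig L (box N) id fp p + trig L (box N) id f p)
          * (trig L (box N) id fp p - trig L (box N) id f p) ^ 2 / 4))
      + ((-1 / 2 : ℂ) • cubeError L N f + (-1 / 2 : ℂ) • cubeError L N fp) := by
  set B := box N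
  set h := L / N
  have e1 : (((β : ℂ) / s) • ((trig L B id fun ξ => gp ξ - (s : ℂ) ^ 2 / 12 * lp ξ)
        - (trig L B id fun ξ => g ξ - (s : ℂ) ^ 2 / 12 * l ξ))
      - discreteLaplacian h (((α : ℂ) / 2) • (trig L B id fp + trig L B id f))
      - discreteLaplacian h (discreteLaplacian h ((3 : ℂ) • trig L B id f - trig L B id fm))
      - (1 / 2 : ℂ) • discreteLaplacian h (discreteLaplacian h (discreteLaplacian h
          (trig L B id fp + trig L B id f)))
      + (1 / s : ℂ) • (trig L B id fp - trig L B id f))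
      = (trig L B id fun ξ => linError α β s (dlapSymbol L h ξ) (lapSymbol L ξ)
          (fm ξ) (f ξ) (fp ξ) (g ξ) (gp ξ) (k ξ) (kp ξ) (l ξ) (lp ξ))
        + ((1 / 2 : ℂ) • (trig L B id fun ξ => (lapSymbol L ξ : ℂ) * cubeCoeff L f ξ)
        + (1 / 2 : ℂ) • trig L B id fun ξ => (lapSymbol L ξ : ℂ) * cubeCoeff L fp ξ) := by
    simp only [trig_add, trig_sub, smul_trig, discreteLaplacian_trig, id]
    congr 1
    ext ξ
    simp only [linError, spaceError]
    push_cast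
    linear_combination (1 / 2 : ℂ) * heq ξ + (1 / 2 : ℂ) * heqp ξ
  ext p
  have e2 := congrFun e1 p
  simp only [Pi.add_apply, Pi.sub_apply, Pi.smul_apply, smul_eq_mul] at e2
  simp only [residual, chi_eq, discreteLaplacian_add, discreteLaplacian_smul, cubeError,
    Pi.add_apply, Pi.sub_apply, Pi.smul_apply, smul_eq_mul] at e2 ⊢
  linear_combination e2

/-- The constant in the estimate of `spaceError`. -/
def spaceConst (α L : ℝ) : ℝ :=
  α * (2 * Real.pi / L) ^ 4 + 6 * (2 * Real.pi / L) ^ 6 + 3 * (2 * Real.pi / L) ^ 8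

lemma norm_spaceError_le {α L h : ℝ} (hα : 0 ≤ α) (hh : 0 < h) (ξ : ℤ × ℤ) (fm f fp : ℂ) :
    ‖spaceError α (dlapSymbol L h ξ) (lapSymbol L ξ) fm f fp‖
      ≤ spaceConst α L * h ^ 2 * wt ξ ^ 4 * (‖fm‖ + ‖f‖ + ‖fp‖) := by
  have hw := one_le_wt ξ
  have e1 : |α| * |dlapSymbol L h ξ - lapSymbol L ξ|
      ≤ α * (2 * Real.pi / L) ^ 4 * (h ^ 2 * wt ξ ^ 4) := by
    rw [abs_of_nonneg hα]
    have h2 : wt ξ ^ 2 ≤ wt ξ ^ 4 := pow_le_pow_right₀ hw (by norm_num)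
    calc _ ≤ α * ((2 * Real.pi / L) ^ 4 * h ^ 2 * wt ξ ^ 2) :=
          mul_le_mul_of_nonneg_left (abs_dlapSymbol_sub_le hh L ξ) hα
      _ ≤ α * ((2 * Real.pi / L) ^ 4 * h ^ 2 * wt ξ ^ 4) := by gcongr
      _ = _ := by ring
  have e2 : |dlapSymbol L h ξ ^ 2 - lapSymbol L ξ ^ 2|
      ≤ 2 * (2 * Real.pi / L) ^ 6 * (h ^ 2 * wt ξ ^ 4) := by
    have h2 : wt ξ ^ 3 ≤ wt ξ ^ 4 := pow_le_pow_right₀ hw (by norm_num)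
    have h6 : 0 ≤ (2 * Real.pi / L) ^ 6 := by positivity
    calc _ ≤ 2 * (2 * Real.pi / L) ^ 6 * h ^ 2 * wt ξ ^ 3 := abs_dlapSymbol_pow_two_sub_le hh L ξ
      _ ≤ 2 * (2 * Real.pi / L) ^ 6 * h ^ 2 * wt ξ ^ 4 := by gcongr
      _ = _ := by ring
  have e3 := abs_dlapSymbol_pow_three_sub_le hh L ξ
  have hav : ‖(fp + f) / 2‖ ≤ ‖fm‖ + ‖f‖ + ‖fp‖ := by
    rw [norm_div, Complex.norm_ofNat]
    linarith [norm_add_le fp f, norm_nonneg fm, norm_nonneg f, norm_nonneg fp]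
  have hex : ‖3 * f - fm‖ ≤ 3 * (‖fm‖ + ‖f‖ + ‖fp‖) := by
    have := norm_sub_le (3 * f) fm
    rw [norm_mul, Complex.norm_ofNat] at this
    linarith [norm_nonneg fm, norm_nonneg f, norm_nonneg fp]
  set X := ‖fm‖ + ‖f‖ + ‖fp‖
  have hX : 0 ≤ X := by positivity
  rw [spaceError]
  refine (norm_sub_le _ _).trans ((add_le_add (norm_sub_le _ _) le_rfl).trans ?_)
  rw [norm_mul, norm_mul, norm_mul, norm_neg, Complex.norm_real, Complex.norm_real,
    Complex.norm_real, Real.norm_eq_abs, Real.norm_eq_abs, Real.norm_eq_abs, abs_mul]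
  have a1 := mul_le_mul e1 hav (norm_nonneg _) ((mul_nonneg (abs_nonneg _) (abs_nonneg _)).trans e1)
  have a2 := mul_le_mul e2 hex (norm_nonneg _) ((abs_nonneg _).trans e2)
  have a3 := mul_le_mul e3 hav (norm_nonneg _) ((abs_nonneg _).trans e3)
  refine (add_le_add (add_le_add a1 a2) a3).trans (le_of_eq ?_)
  rw [spaceConst]; ring

lemma sq_norm_linError_le {α β L s h : ℝ} (hα : 0 ≤ α) (hh : 0 < h) (ξ : ℤ × ℤ)
    {fm f fp g gp k kp l lp : ℂ} {I₂ I₃ I₄ : ℝ}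
    (h₄ : ‖((gp - (s : ℂ) ^ 2 / 12 * lp) - (g - (s : ℂ) ^ 2 / 12 * l)) / s - (kp + k) / 2‖ ^ 2
      ≤ 4 * s ^ 3 * I₄)
    (h₃ : ‖(fp - f) / s - (gp + g) / 2‖ ^ 2 ≤ 4 * s ^ 3 * I₃)
    (h₂ : ‖fp - 2 * f + fm‖ ^ 2 ≤ 6 * s ^ 3 * I₂) :
    ‖linError α β s (dlapSymbol L h ξ) (lapSymbol L ξ) fm f fp g gp k kp l lp‖ ^ 2
      ≤ 16 * β ^ 2 * s ^ 3 * I₄ + 16 * s ^ 3 * I₃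
        + 12 * spaceConst α L ^ 2 * h ^ 4
          * (wt ξ ^ 8 * ‖fm‖ ^ 2 + wt ξ ^ 8 * ‖f‖ ^ 2 + wt ξ ^ 8 * ‖fp‖ ^ 2)
        + 24 * (2 * Real.pi / L) ^ 8 * s ^ 3 * (wt ξ ^ 6 * I₂) := by
  have hw := one_le_wt ξ
  have b1 : ‖(β : ℂ) * (((gp - (s : ℂ) ^ 2 / 12 * lp) - (g - (s : ℂ) ^ 2 / 12 * l)) / s
      - (kp + k) / 2)‖ ^ 2 ≤ β ^ 2 * (4 * s ^ 3 * I₄) := by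
    rw [norm_mul, mul_pow, Complex.norm_real, Real.norm_eq_abs, sq_abs]
    exact mul_le_mul_of_nonneg_left h₄ (sq_nonneg β)
  have b3 : ‖spaceError α (dlapSymbol L h ξ) (lapSymbol L ξ) fm f fp‖ ^ 2
      ≤ 3 * spaceConst α L ^ 2 * h ^ 4
          * (wt ξ ^ 8 * ‖fm‖ ^ 2 + wt ξ ^ 8 * ‖f‖ ^ 2 + wt ξ ^ 8 * ‖fp‖ ^ 2) := by
    refine (pow_le_pow_left₀ (norm_nonneg _) (norm_spaceError_le hα hh ξ fm f fp) 2).trans ?_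
    have h3 : (‖fm‖ + ‖f‖ + ‖fp‖) ^ 2 ≤ 3 * (‖fm‖ ^ 2 + ‖f‖ ^ 2 + ‖fp‖ ^ 2) := by
      nlinarith [sq_nonneg (‖fm‖ - ‖f‖), sq_nonneg (‖f‖ - ‖fp‖), sq_nonneg (‖fm‖ - ‖fp‖)]
    calc _ = (spaceConst α L * h ^ 2 * wt ξ ^ 4) ^ 2 * (‖fm‖ + ‖f‖ + ‖fp‖) ^ 2 := by ring
      _ ≤ (spaceConst α L * h ^ 2 * wt ξ ^ 4) ^ 2 * (3 * (‖fm‖ ^ 2 + ‖f‖ ^ 2 + ‖fp‖ ^ 2)) :=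
          mul_le_mul_of_nonneg_left h3 (sq_nonneg _)
      _ = _ := by ring
  have b4 : ‖(lapSymbol L ξ : ℂ) ^ 2 * (fp - 2 * f + fm)‖ ^ 2
      ≤ (2 * Real.pi / L) ^ 8 * wt ξ ^ 6 * (6 * s ^ 3 * I₂) := by
    rw [norm_mul, mul_pow, norm_pow, Complex.norm_real, Real.norm_eq_abs, ← pow_mul]
    have h1 : |lapSymbol L ξ| ^ (2 * 2) ≤ (2 * Real.pi / L) ^ 8 * wt ξ ^ 6 := by
      have h2 := pow_le_pow_left₀ (abs_nonneg _) (abs_lapSymbol_le L ξ) 4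
      have h3 : wt ξ ^ 4 ≤ wt ξ ^ 6 := pow_le_pow_right₀ hw (by norm_num)
      calc _ ≤ ((2 * Real.pi / L) ^ 2 * wt ξ) ^ 4 := h2
        _ = ((2 * Real.pi / L) ^ 4) ^ 2 * wt ξ ^ 4 := by ring
        _ ≤ ((2 * Real.pi / L) ^ 4) ^ 2 * wt ξ ^ 6 := by gcongr
        _ = _ := by ring
    exact mul_le_mul h1 h₂ (sq_nonneg _) ((by positivity : (0 : ℝ) ≤ |lapSymbol L ξ| ^ (2 * 2)).trans h1)
  rw [linError]
  refine (norm_add_sq_le _ _).trans ?_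
  have c1 := norm_add_sq_le ((β : ℂ) * (((gp - (s : ℂ) ^ 2 / 12 * lp) - (g - (s : ℂ) ^ 2 / 12 * l)) / s
      - (kp + k) / 2)) ((fp - f) / s - (gp + g) / 2)
  have c2 := norm_add_sq_le (spaceError α (dlapSymbol L h ξ) (lapSymbol L ξ) fm f fp)
    ((lapSymbol L ξ : ℂ) ^ 2 * (fp - 2 * f + fm))
  linarith

section Modes

variable {α β L T A D E F G : ℝ} {f f₁ f₂ f₃ f₄ : ℤ × ℤ → ℝ → ℂ}

lemma IsModes.sq_norm_extrapolation_le (h : IsModes α β L T f f₁ f₂ f₃ f₄ A D E F G) (hT : 0 < T)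
    {s : ℝ} (hs : 0 < s) {k : ℕ} (hk : k < ⌊T / s⌋₊) (hk0 : 1 ≤ k ∨ ∀ ξ, f₁ ξ 0 = 0) (ξ : ℤ × ℤ) :
    ‖f ξ (s * k + s) - 2 * f ξ (s * k) + f ξ (s * ((k - 1 : ℕ) : ℝ))‖ ^ 2
      ≤ 6 * s ^ 3 * (stepEnergy s (f₂ ξ) (k - 1) + stepEnergy s (f₂ ξ) k) := by
  have hle := step_le hT hs hk
  cases k with
  | zero =>
    have h0 := hk0.resolve_left (by norm_num) ξ
    have h1 := sq_norm_increment_le (h.hasDeriv₁ hT ξ) (h.prim₂ ξ) (h.sq₂ ξ) (a := s * (0 : ℕ))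
      (by simp) hs hle
    have h2 := stepEnergy_nonneg hs (f₂ ξ) 0
    have h3 : (0 : ℝ) ≤ s ^ 3 := by positivity
    change _ ≤ s ^ 3 * stepEnergy s (f₂ ξ) 0 at h1
    have h4 := mul_nonneg h3 h2
    simp only [Nat.cast_zero, mul_zero, h0, sub_zero, zero_add, Nat.zero_sub] at h1 ⊢
    have e : f ξ s - 2 * f ξ 0 + f ξ 0 = f ξ s - f ξ 0 := by ring
    rw [e]
    linarith
  | succ j =>
    have e : s * ((j + 1 : ℕ) : ℝ) = s * j + s := by push_cast; ring
    have hle' := hle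
    rw [e] at hle'
    have h1 := sq_norm_second_difference_le (h.hasDeriv₁ hT ξ) (h.prim₂ ξ) (h.sq₂ ξ)
      (a := s * j) (by positivity) hs hle'
    simpa only [stepEnergy, e, Nat.add_sub_cancel] using h1

/-- The constant in the estimate of the first residual. -/
def residualConst (α β L T : ℝ) : ℝ :=
  64 * L ^ 2 * β ^ 2 + 64 * L ^ 2 + 288 * L ^ 2 * (2 * Real.pi / L) ^ 8
    + T * (144 * L ^ 2 * spaceConst α L ^ 2 + 96 * cubeConst L ^ 2 * L ^ 2 * wtSum ^ 2
      + 108 * (2 * Real.pi / L) ^ 4 * L ^ 2 * wtSum ^ 2)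

lemma residualConst_nonneg (α β L : ℝ) {T : ℝ} (hT : 0 < T) : 0 ≤ residualConst α β L T := by
  unfold residualConst; positivity

lemma IsModes.gridNorm_residual_sq_le (h : IsModes α β L T f f₁ f₂ f₃ f₄ A D E F G) (hα : 0 ≤ α)
    (hL : 0 < L) (hT : 0 < T) (hE : 0 ≤ E) {N : ℕ} (hN : 0 < N) (hNe : Even N) (o : ℝ × ℝ) {V : ℝ}
    (hV : ∀ t ∈ Icc 0 T, ∑ ξ ∈ box N, wt ξ ^ 2 * ‖f₁ ξ t‖ ^ 2 ≤ V) {s : ℝ} (hs : 0 < s) {k : ℕ}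
    (hk : k < ⌊T / s⌋₊) (hk0 : 1 ≤ k ∨ ∀ ξ, f₁ ξ 0 = 0) :
    gridNorm (L / N) N o (residual α β s (L / N)
      (trig L (box N) id fun ξ => f ξ (s * ((k - 1 : ℕ) : ℝ)))
      (trig L (box N) id fun ξ => f ξ (s * k)) (trig L (box N) id fun ξ => f ξ (s * k + s))
      (trig L (box N) id fun ξ => f₁ ξ (s * k) - (s : ℂ) ^ 2 / 12 * f₃ ξ (s * k))
      (trig L (box N) id fun ξ => f₁ ξ (s * k + s) - (s : ℂ) ^ 2 / 12 * f₃ ξ (s * k + s))) ^ 2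
    ≤ 64 * L ^ 2 * β ^ 2 * s ^ 3 * (∑ ξ ∈ box N, 1 * stepEnergy s (f₄ ξ) k)
      + 64 * L ^ 2 * s ^ 3 * (∑ ξ ∈ box N, 1 * stepEnergy s (f₃ ξ) k)
      + 96 * L ^ 2 * (2 * Real.pi / L) ^ 8 * s ^ 3
        * ((∑ ξ ∈ box N, wt ξ ^ 6 * stepEnergy s (f₂ ξ) (k - 1))
          + ∑ ξ ∈ box N, wt ξ ^ 6 * stepEnergy s (f₂ ξ) k)
      + (144 * L ^ 2 * spaceConst α L ^ 2 * ((L / N) ^ 4 * G ^ 2)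
        + 96 * cubeConst L ^ 2 * L ^ 2 * wtSum ^ 2 * ((L / N) ^ 4 * E ^ 6)
        + 108 * (2 * Real.pi / L) ^ 4 * L ^ 2 * wtSum ^ 2 * (s ^ 4 * (E * V) ^ 2)) := by
  have hNr : (0 : ℝ) < N := by exact_mod_cast hN
  have hh : 0 < L / N := by positivity
  have hle := step_le hT hs hk
  have hk' : (0 : ℝ) ≤ s * k := by positivity
  have t0 : s * k ∈ Icc 0 T := ⟨hk', by linarith⟩
  have t1 : s * k + s ∈ Icc 0 T := ⟨by linarith, hle⟩
  have tm : s * ((k - 1 : ℕ) : ℝ) ∈ Icc 0 T := by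
    refine ⟨by positivity, le_trans (mul_le_mul_of_nonneg_left ?_ hs.le) t0.2⟩
    exact_mod_cast Nat.sub_le k 1
  rw [residual_eq (fun ξ => h.equation _ t0 ξ) (fun ξ => h.equation _ t1 ξ)]
  have hlin : ∀ ξ, _ := fun ξ => sq_norm_linError_le (L := L) (β := β) hα hh ξ
    (I₃ := stepEnergy s (f₃ ξ) k) (I₄ := stepEnergy s (f₄ ξ) k)
    (sq_norm_corrected_trapezoid_le (h.hasDeriv₂ hT ξ) (h.hasDeriv₃ hT ξ) (h.prim₄ ξ) (h.sq₄ ξ)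
      hk' hs hle)
    (sq_norm_trapezoid_le (h.hasDeriv₁ hT ξ) (h.hasDeriv₂ hT ξ) (h.prim₃ ξ) (h.sq₃ ξ) hk' hs hle)
    (h.sq_norm_extrapolation_le hT hs hk hk0 ξ)
  have p1 := Finset.sum_le_sum fun ξ (_ : ξ ∈ box N) => hlin ξ
  simp only [Finset.sum_add_distrib, ← Finset.mul_sum, mul_add] at p1
  have p2 := gridNorm_time_cubic_sq_le hL hN o (separated_box N) (h.boundE _ t1 (box N))
    (h.boundE _ t0 (box N)) (h.sum_increment_le hT hV hk' hs hle)
  have p3 := gridNorm_cube_sub_sq_le hL hN hNe o hE (h.boundE _ t0)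
  have p4 := gridNorm_cube_sub_sq_le hL hN hNe o hE (h.boundE _ t1)
  change gridNorm _ _ _ (cubeError L N _) ^ 2 ≤ _ at p3 p4
  have g1 := h.boundG _ tm (box N)
  have g2 := h.boundG _ t0 (box N)
  have g3 := h.boundG _ t1 (box N)
  have hsc : 0 ≤ 12 * spaceConst α L ^ 2 * (L / N) ^ 4 := by positivity
  have g1' := mul_le_mul_of_nonneg_left g1 hsc
  have g2' := mul_le_mul_of_nonneg_left g2 hsc
  have g3' := mul_le_mul_of_nonneg_left g3 hsc
  refine (gridNorm_add_sq_le _ _ _ _ _).trans ?_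
  have q1 := gridNorm_add_sq_le (L / N) N o (trig L (box N) id fun ξ => linError α β s
      (dlapSymbol L (L / N) ξ) (lapSymbol L ξ) (f ξ (s * ((k - 1 : ℕ) : ℝ))) (f ξ (s * k))
      (f ξ (s * k + s)) (f₁ ξ (s * k)) (f₁ ξ (s * k + s)) (f₂ ξ (s * k)) (f₂ ξ (s * k + s))
      (f₃ ξ (s * k)) (f₃ ξ (s * k + s)))
    (discreteLaplacian (L / N) (fun p => (trig L (box N) id (fun ξ => f ξ (s * k + s)) p
      + trig L (box N) id (fun ξ => f ξ (s * k)) p)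
      * (trig L (box N) id (fun ξ => f ξ (s * k + s)) p
        - trig L (box N) id (fun ξ => f ξ (s * k)) p) ^ 2 / 4))
  have q2 := gridNorm_add_sq_le (L / N) N o ((-1 / 2 : ℂ) • cubeError L N fun ξ => f ξ (s * k))
    ((-1 / 2 : ℂ) • cubeError L N fun ξ => f ξ (s * k + s))
  have hn : ‖(-1 / 2 : ℂ)‖ ^ 2 = 1 / 4 := by norm_num
  rw [gridNorm_smul_sq, gridNorm_smul_sq, hn] at q2
  rw [gridNorm_trig_id_sq hL hN o (separated_box N)] at q1
  have p1' := mul_le_mul_of_nonneg_left p1 (sq_nonneg L)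
  have g1'' := mul_le_mul_of_nonneg_left g1' (sq_nonneg L)
  have g2'' := mul_le_mul_of_nonneg_left g2' (sq_nonneg L)
  have g3'' := mul_le_mul_of_nonneg_left g3' (sq_nonneg L)
  simp only [one_mul]
  linarith

end Modes

/-! ### Space-time estimates and the time derivatives of the projection -/

lemma hasDerivWithinAt_trig (L : ℝ) (B : Finset (ℤ × ℤ)) (p : ℝ × ℝ) {f : ℤ × ℤ → ℝ → ℂ}
    {f' : ℤ × ℤ → ℂ} {S : Set ℝ} {t : ℝ} (h : ∀ ξ, HasDerivWithinAt (f ξ) (f' ξ) S t) :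
    HasDerivWithinAt (fun r => trig L B id (fun ξ => f ξ r) p) (trig L B id f' p) S t :=
  HasDerivWithinAt.fun_sum fun ξ _ => (h ξ).mul_const _

lemma eqOn_iteratedDerivWithin_succ {u v w : ℝ → ℂ} {S : Set ℝ} {n : ℕ} (hS : UniqueDiffOn ℝ S)
    (hu : EqOn (iteratedDerivWithin n u S) v S) (hv : ∀ t ∈ S, HasDerivWithinAt v (w t) S t) :
    EqOn (iteratedDerivWithin (n + 1) u S) w S := fun t ht => by
  rw [iteratedDerivWithin_succ, derivWithin_congr hu (hu ht), (hv t ht).derivWithin (hS t ht)]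

lemma coeff_velocity_eq_zero {L T : ℝ} (hT : 0 < T) {Φ : ℝ → L2 L}
    (hΦ : HasDerivWithinAt Φ 0 (Icc 0 T) 0) {ξ : ℤ × ℤ} {z : ℂ}
    (hz : HasDerivWithinAt (fun t => fourierCoeff L (Φ t) ξ.1 ξ.2) z (Icc 0 T) 0) : z = 0 := by
  have h1 := (fourierCLM L ξ).hasFDerivAt.comp_hasDerivWithinAt (0 : ℝ) hΦ
  have h2 : HasDerivWithinAt (fun t => fourierCoeff L (Φ t) ξ.1 ξ.2) 0 (Icc 0 T) 0 := by
    simpa only [Function.comp_def, fourierCLM_apply, map_zero] using h1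
  exact (uniqueDiffOn_Icc hT 0 ⟨le_rfl, hT.le⟩).eq_deriv _ hz h2

lemma weighted_norms_le {a₀ a₂ a₄ a₆ a₈ b A B D E F G V : ℝ} (ha₀ : 0 ≤ a₀) (ha₂ : 0 ≤ a₂)
    (ha₄ : 0 ≤ a₄) (ha₆ : 0 ≤ a₆) (ha₈ : 0 ≤ a₈) (hb : 0 ≤ b) (nA : 0 ≤ A) (nB : 0 ≤ B)
    (nD : 0 ≤ D) (nE : 0 ≤ E) (nG : 0 ≤ G) (hFD : F ≤ D)
    (hscale : a₄ * E * V ≤ b * ((a₄ * E) ^ 3 * (1 + (a₂ * F) ^ 2) + a₂ * F)) :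
    a₀ * A + a₆ * D + a₈ * G + (a₄ * E) ^ 3 + a₄ * E * V
      ≤ (a₀ + a₆ + a₈ + (1 + b) * (a₄ ^ 3 * (1 + a₂ ^ 2)) + b * a₂)
        * (A + B + D + E ^ 3 * (1 + F ^ 2) + G) := by
  have nE3 : 0 ≤ E ^ 3 * (1 + F ^ 2) := by positivity
  have hEF : (a₄ * E) ^ 3 * (1 + (a₂ * F) ^ 2)
      ≤ a₄ ^ 3 * (1 + a₂ ^ 2) * (E ^ 3 * (1 + F ^ 2)) := by
    have h1 : 1 + (a₂ * F) ^ 2 ≤ (1 + a₂ ^ 2) * (1 + F ^ 2) := by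
      nlinarith [sq_nonneg a₂, sq_nonneg F]
    calc _ ≤ (a₄ * E) ^ 3 * ((1 + a₂ ^ 2) * (1 + F ^ 2)) := by gcongr
      _ = _ := by ring
  have hE1 : (a₄ * E) ^ 3 ≤ (a₄ * E) ^ 3 * (1 + (a₂ * F) ^ 2) :=
    le_mul_of_one_le_right (by positivity) (by linarith [sq_nonneg (a₂ * F)])
  set R := A + B + D + E ^ 3 * (1 + F ^ 2) + G with hR
  have e1 := mul_le_mul_of_nonneg_left (show A ≤ R by linarith) ha₀
  have e2 := mul_le_mul_of_nonneg_left (show D ≤ R by linarith) ha₆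
  have e3 := mul_le_mul_of_nonneg_left (show G ≤ R by linarith) ha₈
  have e4 := mul_le_mul_of_nonneg_left (show F ≤ R by linarith) (mul_nonneg hb ha₂)
  have e5 := mul_le_mul_of_nonneg_left (show E ^ 3 * (1 + F ^ 2) ≤ R by linarith)
    (by positivity : 0 ≤ (1 + b) * (a₄ ^ 3 * (1 + a₂ ^ 2)))
  have e6 := mul_le_mul_of_nonneg_left hEF (by positivity : 0 ≤ 1 + b)
  clear_value R
  calc _ ≤ a₀ * A + a₆ * D + a₈ * G + ((1 + b) * ((a₄ * E) ^ 3 * (1 + (a₂ * F) ^ 2))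
        + b * a₂ * F) := by linarith
    _ ≤ a₀ * R + a₆ * R + a₈ * R + ((1 + b) * (a₄ ^ 3 * (1 + a₂ ^ 2)) * R + b * a₂ * R) := by
      linarith
    _ = _ := by ring

lemma residual_bound_le {α β L T A D E G V s h : ℝ} (hT : 0 < T) (hA : 0 ≤ A) (hD : 0 ≤ D)
    (hE : 0 ≤ E) (hG : 0 ≤ G) (hV : 0 ≤ V) :
    64 * L ^ 2 * β ^ 2 * (s ^ 4 * A ^ 2) + 64 * L ^ 2 * (s ^ 4 * A ^ 2)
      + 288 * L ^ 2 * (2 * Real.pi / L) ^ 8 * (s ^ 4 * D ^ 2)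
      + T * (144 * L ^ 2 * spaceConst α L ^ 2 * (h ^ 4 * G ^ 2)
        + 96 * cubeConst L ^ 2 * L ^ 2 * wtSum ^ 2 * (h ^ 4 * E ^ 6)
        + 108 * (2 * Real.pi / L) ^ 4 * L ^ 2 * wtSum ^ 2 * (s ^ 4 * (E * V) ^ 2))
    ≤ (√(residualConst α β L T) * (A + D + G + E ^ 3 + E * V) * (s ^ 2 + h ^ 2)) ^ 2 := by
  rw [mul_assoc (√_), mul_pow (√_), Real.sq_sqrt (residualConst_nonneg α β L hT)]
  have hEV : 0 ≤ E * V := by positivity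
  have hE3 : 0 ≤ E ^ 3 := by positivity
  set Z := A + D + G + E ^ 3 + E * V with hZ
  have key : ∀ x y : ℝ, x ^ 2 ≤ s ^ 2 + h ^ 2 → 0 ≤ y → y ≤ Z →
      x ^ 4 * y ^ 2 ≤ (Z * (s ^ 2 + h ^ 2)) ^ 2 := by
    intro x y hx hy hyZ
    calc x ^ 4 * y ^ 2 = (y * x ^ 2) ^ 2 := by ring
      _ ≤ _ := pow_le_pow_left₀ (by positivity)
          (mul_le_mul hyZ hx (sq_nonneg x) (hy.trans hyZ)) 2
  have hs2 : s ^ 2 ≤ s ^ 2 + h ^ 2 := by linarith [sq_nonneg h]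
  have hh2 : h ^ 2 ≤ s ^ 2 + h ^ 2 := by linarith [sq_nonneg s]
  have y1 := key s A hs2 hA (by linarith)
  have y2 := key s D hs2 hD (by linarith)
  have y3 := key h G hh2 hG (by linarith)
  have y4 := key h (E ^ 3) hh2 hE3 (by linarith)
  have y5 := key s (E * V) hs2 hEV (by linarith)
  rw [← pow_mul] at y4
  generalize (Z * (s ^ 2 + h ^ 2)) ^ 2 = Q at *
  calc _ ≤ 64 * L ^ 2 * β ^ 2 * Q + 64 * L ^ 2 * Q + 288 * L ^ 2 * (2 * Real.pi / L) ^ 8 * Q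
      + T * (144 * L ^ 2 * spaceConst α L ^ 2 * Q + 96 * cubeConst L ^ 2 * L ^ 2 * wtSum ^ 2 * Q
        + 108 * (2 * Real.pi / L) ^ 4 * L ^ 2 * wtSum ^ 2 * Q) := by gcongr
    _ = _ := by rw [residualConst]; ring

lemma residual_sum_le {K c₁ c₂ c₃ s T X A D S₁ S₂ S₃ S₃' : ℝ} (hs : 0 < s) (hK : s * K ≤ T)
    (hX : 0 ≤ X) (hc₁ : 0 ≤ c₁) (hc₂ : 0 ≤ c₂) (hc₃ : 0 ≤ c₃) (h₁ : S₁ ≤ A) (h₂ : S₂ ≤ A)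
    (h₃ : S₃ ≤ D) (h₃' : S₃' ≤ 2 * S₃) :
    s * (c₁ * s ^ 3 * S₁ + c₂ * s ^ 3 * S₂ + c₃ * s ^ 3 * (S₃' + S₃) + K * X)
      ≤ c₁ * (s ^ 4 * A) + c₂ * (s ^ 4 * A) + 3 * c₃ * (s ^ 4 * D) + T * X := by
  have h4 : S₃' + S₃ ≤ 3 * D := by linarith
  calc _ = c₁ * (s ^ 4 * S₁) + c₂ * (s ^ 4 * S₂) + c₃ * (s ^ 4 * (S₃' + S₃)) + s * K * X := by ring
    _ ≤ c₁ * (s ^ 4 * A) + c₂ * (s ^ 4 * A) + c₃ * (s ^ 4 * (3 * D)) + T * X := by gcongr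
    _ = _ := by ring

section Modes

variable {α β L T A D E F G : ℝ} {f f₁ f₂ f₃ f₄ : ℤ × ℤ → ℝ → ℂ}

lemma IsModes.projVel_eq {Φ : ℝ → L2 L}
    (h : IsModes α β L T (fun ξ t => fourierCoeff L (Φ t) ξ.1 ξ.2) f₁ f₂ f₃ f₄ A D E F G)
    (hT : 0 < T) (s : ℝ) (N : ℕ) {t : ℝ} (ht : t ∈ Icc 0 T) :
    projVel L T s N Φ t
      = trig L (box N) id fun ξ => f₁ ξ t - (s : ℂ) ^ 2 / 12 * f₃ ξ t := by
  ext p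
  have hS := uniqueDiffOn_Icc hT
  have h0 : EqOn (iteratedDerivWithin 0 (fun r => proj L N Φ r p) (Icc 0 T))
      (fun r => trig L (box N) id (fun ξ => fourierCoeff L (Φ r) ξ.1 ξ.2) p) (Icc 0 T) := by
    intro r _
    simp only [iteratedDerivWithin_zero, proj_eq_trig]
  have h1 := eqOn_iteratedDerivWithin_succ hS h0 fun t ht =>
    hasDerivWithinAt_trig L (box N) p fun ξ => h.hasDeriv₁ hT ξ t ht
  have h2 := eqOn_iteratedDerivWithin_succ hS h1 fun t ht =>
    hasDerivWithinAt_trig L (box N) p fun ξ => h.hasDeriv₂ hT ξ t ht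
  have h3 := eqOn_iteratedDerivWithin_succ hS h2 fun t ht =>
    hasDerivWithinAt_trig L (box N) p fun ξ => h.hasDeriv₃ hT ξ t ht
  have e1 := h1 ht
  have e3 := h3 ht
  simp only [zero_add, Nat.reduceAdd] at e1 e3
  rw [projVel, e1, e3]
  simp only [trig, sub_mul, Finset.sum_sub_distrib, Finset.mul_sum]
  congr 1
  exact Finset.sum_congr rfl fun ξ _ => by ring

lemma IsModes.spaceTimeNorm_residual_le (h : IsModes α β L T f f₁ f₂ f₃ f₄ A D E F G) (hα : 0 ≤ α)
    (hL : 0 < L) (hT : 0 < T) (hA : 0 ≤ A) (hD : 0 ≤ D) (hE : 0 ≤ E) (hG : 0 ≤ G) {N : ℕ}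
    (hN : 0 < N) (hNe : Even N) (o : ℝ × ℝ) {V : ℝ} (hV0 : 0 ≤ V)
    (hV : ∀ t ∈ Icc 0 T, ∑ ξ ∈ box N, wt ξ ^ 2 * ‖f₁ ξ t‖ ^ 2 ≤ V) {s : ℝ} (hs : 0 < s)
    {𝒦 : Finset ℕ} (hK : 𝒦 ⊆ Finset.range ⌊T / s⌋₊)
    (hK0 : ∀ k ∈ 𝒦, 1 ≤ k ∨ ∀ ξ, f₁ ξ 0 = 0) :
    spaceTimeNorm s (L / N) N o 𝒦 (fun k => residual α β s (L / N)
      (trig L (box N) id fun ξ => f ξ (s * ((k - 1 : ℕ) : ℝ)))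
      (trig L (box N) id fun ξ => f ξ (s * k)) (trig L (box N) id fun ξ => f ξ (s * k + s))
      (trig L (box N) id fun ξ => f₁ ξ (s * k) - (s : ℂ) ^ 2 / 12 * f₃ ξ (s * k))
      (trig L (box N) id fun ξ => f₁ ξ (s * k + s) - (s : ℂ) ^ 2 / 12 * f₃ ξ (s * k + s)))
    ≤ √(residualConst α β L T) * (A + D + G + E ^ 3 + E * V) * (s ^ 2 + (L / N) ^ 2) := by
  have hNr : (0 : ℝ) < N := by exact_mod_cast hN
  have hh : 0 < L / N := by positivity
  have hC := residualConst_nonneg α β L hT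
  refine Real.sqrt_le_iff.2 ⟨by positivity, ?_⟩
  have hst : ∀ (v : ℤ × ℤ → ℝ → ℂ) (n k : ℕ), 0 ≤ ∑ ξ ∈ box N, wt ξ ^ n * stepEnergy s (v ξ) k :=
    fun v n k => Finset.sum_nonneg fun ξ _ =>
      mul_nonneg (pow_nonneg (wt_pos ξ).le _) (stepEnergy_nonneg hs _ _)
  have hst' : ∀ (v : ℤ × ℤ → ℝ → ℂ) (k : ℕ), 0 ≤ ∑ ξ ∈ box N, 1 * stepEnergy s (v ξ) k :=
    fun v k => Finset.sum_nonneg fun ξ _ => mul_nonneg zero_le_one (stepEnergy_nonneg hs _ _)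
  have hwt := wtSum_nonneg
  have b1 := (Finset.sum_le_sum fun k hk => h.gridNorm_residual_sq_le hα hL hT hE hN hNe o hV hs
    (Finset.mem_range.1 (hK hk)) (hK0 k hk)).trans
    (Finset.sum_le_sum_of_subset_of_nonneg hK fun k _ _ => by
      have := hst f₂ 6 k
      have := hst f₂ 6 (k - 1)
      have := hst' f₃ k
      have := hst' f₄ k
      positivity)
  rw [Finset.sum_add_distrib, Finset.sum_const, Finset.card_range, nsmul_eq_mul,
    Finset.sum_add_distrib, Finset.sum_add_distrib, ← Finset.mul_sum, ← Finset.mul_sum,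
    ← Finset.mul_sum, Finset.sum_add_distrib] at b1
  have s₄ := sum_sum_stepEnergy_le hT hs h.sq₄ (S := box N) (w := fun _ => 1)
    (fun _ => zero_le_one) (B := A ^ 2) (by simpa only [one_mul] using h.bound₄ (box N))
  have s₃ := sum_sum_stepEnergy_le hT hs h.sq₃ (S := box N) (w := fun _ => 1)
    (fun _ => zero_le_one) (B := A ^ 2) (by simpa only [one_mul] using h.bound₃ (box N))
  have s₂ := sum_sum_stepEnergy_le hT hs h.sq₂ (fun ξ => pow_nonneg (wt_pos ξ).le 6)
    (h.boundD (box N))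
  have s₁ := sum_range_pred_le (hst f₂ 6) ⌊T / s⌋₊
  refine (mul_le_mul_of_nonneg_left b1 hs.le).trans ((residual_sum_le hs (mul_floor_le hT hs)
    (by positivity) (by positivity) (by positivity) (by positivity) s₄ s₃ s₂ s₁).trans ?_)
  refine le_trans (le_of_eq ?_) (residual_bound_le hT hA hD hE hG hV0)
  ring

lemma IsModes.spaceTimeNorm_velocity_le (h : IsModes α β L T f f₁ f₂ f₃ f₄ A D E F G)
    (hL : 0 < L) (hT : 0 < T) (hA : 0 ≤ A) {N : ℕ} (hN : 0 < N) (o : ℝ × ℝ) {s : ℝ} (hs : 0 < s) :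
    spaceTimeNorm s (L / N) N o (Finset.range ⌊T / s⌋₊) (fun k => trig L (box N) id fun ξ =>
      ((f ξ (s * k + s) - f ξ (s * k)) / s
        - 1 / 2 * ((f₁ ξ (s * k + s) - (s : ℂ) ^ 2 / 12 * f₃ ξ (s * k + s))
          + (f₁ ξ (s * k) - (s : ℂ) ^ 2 / 12 * f₃ ξ (s * k)))) / s)
    ≤ 2 * L * A * (s ^ 2 + (L / N) ^ 2) := by
  have key : spaceTimeNorm s (L / N) N o (Finset.range ⌊T / s⌋₊) (fun k => trig L (box N) id fun ξ =>
      ((f ξ (s * k + s) - f ξ (s * k)) / s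
        - 1 / 2 * ((f₁ ξ (s * k + s) - (s : ℂ) ^ 2 / 12 * f₃ ξ (s * k + s))
          + (f₁ ξ (s * k) - (s : ℂ) ^ 2 / 12 * f₃ ξ (s * k)))) / s) ≤ 2 * L * A * s ^ 2 := by
    refine Real.sqrt_le_iff.2 ⟨by positivity, ?_⟩
    simp only [gridNorm_trig_id_sq hL hN o (separated_box N)]
    have b1 : ∀ k ∈ Finset.range ⌊T / s⌋₊, _ := fun k hk => Finset.sum_le_sum fun ξ
      (_ : ξ ∈ box N) => sq_norm_velocity_le (h.hasDeriv₁ hT ξ) (h.hasDeriv₂ hT ξ)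
        (h.hasDeriv₃ hT ξ) (h.prim₄ ξ) (h.sq₄ ξ) (a := s * k) (by positivity) hs
        (step_le hT hs (Finset.mem_range.1 hk))
    have b2 := Finset.sum_le_sum b1
    simp only [← Finset.mul_sum] at b2 ⊢
    have s₄ := sum_sum_stepEnergy_le hT hs h.sq₄ (S := box N) (w := fun _ => 1)
      (fun _ => zero_le_one) (B := A ^ 2) (by simpa only [one_mul] using h.bound₄ (box N))
    simp only [one_mul] at s₄
    have b3 := mul_le_mul_of_nonneg_left (b2.trans (mul_le_mul_of_nonneg_left s₄
      (by positivity : 0 ≤ 4 * s ^ 3))) (by positivity : 0 ≤ s * L ^ 2)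
    linarith
  refine key.trans ?_
  gcongr
  linarith [sq_nonneg (L / N)]

lemma IsModes.exists_residuals {Φ : ℝ → L2 L}
    (hm : IsModes α β L T (fun ξ t => fourierCoeff L (Φ t) ξ.1 ξ.2) f₁ f₂ f₃ f₄ A D E F G)
    (hα : 0 ≤ α) (hL : 0 < L) (hT : 0 < T) (hA : 0 ≤ A) (hD : 0 ≤ D) (hE : 0 ≤ E) (hG : 0 ≤ G)
    {δ M : ℝ} (hδ : 0 < δ) (hδT : δ ≤ T)
    (hM₁ : √(residualConst α β L T) * (A + D + G + E ^ 3
      + E * (8 * E ^ 2 / δ ^ 2 + 2 * δ * F ^ 2)) ≤ M) (hM₂ : 2 * L * A ≤ M) :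
    ∀ (N : ℕ) (h s : ℝ), 0 < N → Even N → h = L / N → 0 < s →
      ∃ τ₁ τ₂ : ℕ → ℝ × ℝ → ℂ,
        (∀ k < ⌊T / s⌋₊,
          SchemeEq1 α β s h (proj L N Φ (s * ((k - 1 : ℕ) : ℝ)))
            (proj L N Φ (s * k)) (proj L N Φ (s * (k + 1)))
            (projVel L T s N Φ (s * k)) (projVel L T s N Φ (s * (k + 1))) (τ₁ k) ∧
          SchemeEq2 s (proj L N Φ (s * k)) (proj L N Φ (s * (k + 1)))
            (projVel L T s N Φ (s * k)) (projVel L T s N Φ (s * (k + 1))) (τ₂ k)) ∧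
        ∀ o : ℝ × ℝ,
          spaceTimeNorm s h N o (Finset.Ico 1 ⌊T / s⌋₊) τ₁ ≤ M * (s ^ 2 + h ^ 2) ∧
          spaceTimeNorm s h N o (Finset.range ⌊T / s⌋₊) τ₂ ≤ M * (s ^ 2 + h ^ 2) ∧
          (HasDerivWithinAt Φ 0 (Set.Icc 0 T) 0 →
            spaceTimeNorm s h N o (Finset.range ⌊T / s⌋₊) τ₁ ≤ M * (s ^ 2 + h ^ 2)) := by
  intro N h s hN hNe hh hs
  subst hh
  have hsh : 0 ≤ s ^ 2 + (L / N) ^ 2 := by positivity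
  have hres := fun o 𝒦 h1 h2 => (hm.spaceTimeNorm_residual_le hα hL hT hA hD hE hG hN hNe o
    (by positivity) (fun t ht => hm.sum_velocity_le hT hδ hδT ht (box N)) hs (𝒦 := 𝒦) h1 h2).trans
    (mul_le_mul_of_nonneg_right hM₁ hsh)
  refine ⟨_, _, fun k hk => ?_, fun o => ⟨hres o _ ?_ ?_,
    (hm.spaceTimeNorm_velocity_le hL hT hA hN o hs).trans
      (mul_le_mul_of_nonneg_right hM₂ hsh), fun hΦ0 => hres o _ subset_rfl ?_⟩⟩
  · have hle := step_le hT hs hk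
    have hk' : 0 ≤ s * k := by positivity
    have e : s * ((k : ℝ) + 1) = s * k + s := by ring
    rw [e, hm.projVel_eq hT s N (t := s * k) ⟨hk', by linarith⟩,
      hm.projVel_eq hT s N (t := s * k + s) ⟨by linarith, hle⟩]
    simp only [proj_eq_trig]
    refine ⟨fun p => ?_, fun p => ?_⟩
    · simp only [residual]
      ring
    · have hs0 : (s : ℂ) ≠ 0 := by exact_mod_cast hs.ne'
      simp only [trig, Finset.mul_sum, ← Finset.sum_sub_distrib, ← Finset.sum_add_distrib,
        Finset.sum_div]
      refine Finset.sum_congr rfl fun ξ _ => ?_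
      field_simp
      ring
  · exact fun k hk => Finset.mem_range.2 (Finset.mem_Ico.1 hk).2
  · exact fun k hk => Or.inl (Finset.mem_Ico.1 hk).1
  · exact fun k _ => Or.inr fun ξ => coeff_velocity_eq_zero hT hΦ0
      (hm.hasDeriv₁ hT ξ 0 ⟨le_rfl, hT.le⟩)

end Modes

end MPFC

end

theorem mainTheorem3 (α β L T : ℝ) (hα : 0 < α) (hβ : 0 < β) (hL : 0 < L) (hT : 0 < T) :
    ∃ C : ℝ, 0 < C ∧ ∀ Φ : ℝ → MPFC.L2 L,
      ContinuousOn Φ (Set.Icc 0 T) → MPFC.IsSolution α β L T Φ → MPFC.IsRegular L T Φ →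
      ∃ M : ℝ, 0 ≤ M ∧
        M ≤ C * ((MPFC.bochnerSobolevNorm L T 4 2 0 Φ).toReal
              + (MPFC.bochnerSobolevNorm L T 2 ⊤ 2 Φ).toReal
              + (MPFC.bochnerSobolevNorm L T 2 2 6 Φ).toReal
              + (MPFC.bochnerSobolevNorm L T 0 ⊤ 4 Φ).toReal ^ 3
                * (1 + (MPFC.bochnerSobolevNorm L T 2 2 2 Φ).toReal ^ 2)
              + (MPFC.bochnerSobolevNorm L T 0 ⊤ 8 Φ).toReal) ∧
        ∀ (N : ℕ) (h s : ℝ), 0 < N → Even N → h = L / N → 0 < s →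
          ∃ τ₁ τ₂ : ℕ → ℝ × ℝ → ℂ,
            -- `k - 1` is truncated: in the step `k = 0` the ghost value is `Φ_N⁻¹ = Φ_N⁰`
            (∀ k < ⌊T / s⌋₊,
              MPFC.SchemeEq1 α β s h (MPFC.proj L N Φ (s * ((k - 1 : ℕ) : ℝ)))
                (MPFC.proj L N Φ (s * k)) (MPFC.proj L N Φ (s * (k + 1)))
                (MPFC.projVel L T s N Φ (s * k)) (MPFC.projVel L T s N Φ (s * (k + 1))) (τ₁ k) ∧
              MPFC.SchemeEq2 s (MPFC.proj L N Φ (s * k)) (MPFC.proj L N Φ (s * (k + 1)))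
                (MPFC.projVel L T s N Φ (s * k)) (MPFC.projVel L T s N Φ (s * (k + 1))) (τ₂ k)) ∧
            ∀ o : ℝ × ℝ,
              MPFC.spaceTimeNorm s h N o (Finset.Ico 1 ⌊T / s⌋₊) τ₁ ≤ M * (s ^ 2 + h ^ 2) ∧
              MPFC.spaceTimeNorm s h N o (Finset.range ⌊T / s⌋₊) τ₂ ≤ M * (s ^ 2 + h ^ 2) ∧
              (HasDerivWithinAt Φ 0 (Set.Icc 0 T) 0 →
                MPFC.spaceTimeNorm s h N o (Finset.range ⌊T / s⌋₊) τ₁ ≤ M * (s ^ 2 + h ^ 2)) := by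
  set a₀ := √(MPFC.sobConst L 0)
  set a₂ := √(MPFC.sobConst L 2)
  set a₄ := √(MPFC.sobConst L 4)
  set a₆ := √(MPFC.sobConst L 6)
  set a₈ := √(MPFC.sobConst L 8)
  set b := 8 / T ^ 2 + 2 * T + 10
  set κ := √(MPFC.residualConst α β L T)
  have ha₀ : 0 ≤ a₀ := Real.sqrt_nonneg _
  have ha₂ : 0 ≤ a₂ := Real.sqrt_nonneg _
  have ha₄ : 0 ≤ a₄ := Real.sqrt_nonneg _
  have ha₆ : 0 ≤ a₆ := Real.sqrt_nonneg _
  have ha₈ : 0 ≤ a₈ := Real.sqrt_nonneg _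
  have hκ : 0 ≤ κ := Real.sqrt_nonneg _
  have hb : 0 ≤ b := by positivity
  refine ⟨κ * (a₀ + a₆ + a₈ + (1 + b) * (a₄ ^ 3 * (1 + a₂ ^ 2)) + b * a₂) + 2 * L * a₀ + 1,
    by positivity, fun Φ hΦ hsol hreg => ⟨_, ?_, le_rfl, ?_⟩⟩
  · positivity
  obtain ⟨f₁, f₂, f₃, f₄, hm⟩ := MPFC.exists_isModes hL hT hΦ hsol hreg
  have hFD : (MPFC.bochnerSobolevNorm L T 2 2 2 Φ).toReal
      ≤ (MPFC.bochnerSobolevNorm L T 2 2 6 Φ).toReal :=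
    ENNReal.toReal_mono hreg.2.2.2.ne (MPFC.bochnerSobolevNorm_mono L T 2 2 (by norm_num) Φ)
  have hn : ∀ m p r, 0 ≤ (MPFC.bochnerSobolevNorm L T m p r Φ).toReal :=
    fun _ _ _ => ENNReal.toReal_nonneg
  have nA := hn 4 2 0
  have nB := hn 2 ⊤ 2
  have nD := hn 2 2 6
  have nE := hn 0 ⊤ 4
  have nF := hn 2 2 2
  have nG := hn 0 ⊤ 8
  obtain ⟨δ, hδ, hδT, hscale⟩ := MPFC.exists_scale hT (mul_nonneg ha₄ nE) (mul_nonneg ha₂ nF)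
  have hsum := MPFC.weighted_norms_le ha₀ ha₂ ha₄ ha₆ ha₈ hb nA nB nD nE nG hFD hscale
  generalize (MPFC.bochnerSobolevNorm L T 4 2 0 Φ).toReal = A at *
  generalize (MPFC.bochnerSobolevNorm L T 2 ⊤ 2 Φ).toReal = B at *
  generalize (MPFC.bochnerSobolevNorm L T 2 2 6 Φ).toReal = D at *
  generalize (MPFC.bochnerSobolevNorm L T 0 ⊤ 4 Φ).toReal = E at *
  generalize (MPFC.bochnerSobolevNorm L T 2 2 2 Φ).toReal = F at *
  generalize (MPFC.bochnerSobolevNorm L T 0 ⊤ 8 Φ).toReal = G at *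
  have hAR : A ≤ A + B + D + E ^ 3 * (1 + F ^ 2) + G := by
    have : 0 ≤ E ^ 3 * (1 + F ^ 2) := by positivity
    linarith
  set c := a₀ + a₆ + a₈ + (1 + b) * (a₄ ^ 3 * (1 + a₂ ^ 2)) + b * a₂ with hc
  have hc0 : 0 ≤ c := by positivity
  generalize A + B + D + E ^ 3 * (1 + F ^ 2) + G = R at *
  have hR : 0 ≤ R := nA.trans hAR
  have e₁ : 0 ≤ 2 * L * a₀ * R := by positivity
  have e₂ : 0 ≤ κ * c * R := by positivity
  refine hm.exists_residuals hα.le hL hT (mul_nonneg ha₀ nA) (mul_nonneg ha₆ nD)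
    (mul_nonneg ha₄ nE) (mul_nonneg ha₈ nG) hδ hδT ?_ ?_
  · refine (mul_le_mul_of_nonneg_left hsum hκ).trans ?_
    linarith
  · have := mul_le_mul_of_nonneg_left hAR (by positivity : 0 ≤ 2 * L * a₀)
    linarith
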